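/- **Theorem (String decomposition).** Let $\Sigma$ be an alphabet, disjoint from a set of nonterminals; $\Gamma$ consists of the symbols of $\Sigma$ and the nonterminals, and $\#\notin\Gamma$ is a starting symbol. A *grammar* is a finite set $G$ of rules of the form $c\to ab$ or $c\to a^r$, where $c$ is a nonterminal or $\#$, $a,b\in\Gamma$ and $r\ge 0$ is an integer; its *size* $|G|$ is its number of rules. If no symbol is the left-hand side of two rules of $G$, and if rewriting from $\#$ by the rules of $G$ ends in a string over $\Sigma$, this string is denoted $\mathrm{eval}(G)$; otherwise $\mathrm{eval}(G)$ is undefined. Let $\mathrm{ED}$ denote edit distance (insertions, deletions and substitutions of single symbols), and let $\widetilde O(\cdot)$ hide factors that are poly-logarithmic in $n$. For every constant $a$ there is a randomized algorithm (a single program for a word RAM with words of $O(\log n)$ bits and fair coin tosses) that, given integers $1\le k\le n$ and a string $x$ of length at most $n$ over an alphabet of at most $(n+1)^a$ symbols, always halts after at most $\widetilde O(|x|+1)$ steps and outputs a sequence of grammars $G^x_1,\dots,G^x_s$, such that the following hold. (a) For every such $x$, with probability at least $1-O(1/n)$, all $\mathrm{eval}(G^x_i)$ are defined, $x=\mathrm{eval}(G^x_1)\cdots\mathrm{eval}(G^x_s)$,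 and each $G^x_i$ has size $\widetilde O(k)$. (b) Let $x,y$ be two such strings with $\mathrm{ED}(x,y)\le k$, and let $G^x_1,\dots,G^x_s$ and $G^y_1,\dots,G^y_{s'}$ be the outputs of the algorithm on $x$ and on $y$ with the same parameters $n,k$ and the same randomness. With probability at least $4/5$ all of the following hold simultaneously: 1. $s=s'$; 2. $G^x_i=G^y_i$ for all $i\in\{1,\dots,s\}$ except for at most $k$ indices $i$; 3. all evaluations are defined and $\mathrm{ED}(x,y)=\sum_{i}\mathrm{ED}(\mathrm{eval}(G^x_i),\mathrm{eval}(G^y_i))$; 4. $x=\mathrm{eval}(G^x_1)\cdots\mathrm{eval}(G^x_s)$, $y=\mathrm{eval}(G^y_1)\cdots\mathrm{eval}(G^y_{s'})$, and all these grammars have size $\widetilde O(k)$. (c) Moreover, in the situation of (b), if $n$ is large enough (depending only on $a$), then the two equalities in 4 hold with probability at least $1-2/n$; all the grammars have size $\widetilde O(k)$ with probability at least $1-2/n$; and 1, 2 and 3 hold simultaneously with probability at least $9/10$. The constants and the exponents of the logarithms hidden in $O(\cdot)$ and $\widetilde O(\cdot)$ depend only on $a$. -/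

import Mathlib

/-! ### Edit distance -/

/-- `EditOp x y`: one insertion, deletion or substitution of a symbol turns `x` into `y`. -/
inductive EditOp : List ℕ → List ℕ → Prop
  | insertion (u v : List ℕ) (c : ℕ) : EditOp (u ++ v) (u ++ c :: v)
  | deletion (u v : List ℕ) (c : ℕ) : EditOp (u ++ c :: v) (u ++ v)
  | substitution (u v : List ℕ) (c d : ℕ) : EditOp (u ++ c :: v) (u ++ d :: v)

/-- `EditsIn m x y`: a sequence of exactly `m` edit operations turns `x` into `y`. -/
inductive EditsIn : ℕ → List ℕ → List ℕ → Prop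
  | refl (x : List ℕ) : EditsIn 0 x x
  | step {m : ℕ} {x y z : List ℕ} : EditOp x y → EditsIn m y z → EditsIn (m + 1) x z

/-- Edit distance: the minimum number of edit operations that turn `x` into `y`. -/
noncomputable def editDist (x y : List ℕ) : ℕ := sInf {m | EditsIn m x y}

/-- Some sequence of edit operations always exists, so the minimum above is a genuine one. -/
theorem exists_editsIn (x y : List ℕ) : ∃ m, EditsIn m x y := by
  induction x with
  | nil =>
    suffices h : ∀ (y u : List ℕ), ∃ m, EditsIn m u (u ++ y) from h y []
    intro y
    induction y with
    | nil => exact fun u => ⟨0, by simpa using EditsIn.refl u⟩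
    | cons c y ih =>
      intro u
      obtain ⟨m, hm⟩ := ih (u ++ [c])
      refine ⟨m + 1, .step (y := u ++ [c]) ?_ ?_⟩
      · simpa using EditOp.insertion u [] c
      · simpa using hm
  | cons c x ih =>
    obtain ⟨m, hm⟩ := ih
    exact ⟨m + 1, .step (EditOp.deletion [] x c) hm⟩

/-! ### Grammars -/

/-- The right-hand side of a rule: `ab`, or the power `a ^ r` stored in implicit form.  The symbols
of the work alphabet `Γ` are the terminals (the symbols of `Σ`) and the nonterminals (those of
`Γ \ Σ`), both named by natural numbers. -/
inductive Rhs
  | pair (a b : Symbol ℕ ℕ)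
  | power (a : Symbol ℕ ℕ) (r : ℕ)
deriving DecidableEq

/-- A rule.  The left-hand side is a nonterminal, or the starting symbol `#`, which is `none`
and which never occurs on a right-hand side. -/
structure Rule where
  lhs : Option ℕ
  rhs : Rhs
deriving DecidableEq

/-- A grammar is a finite set of rules; its size is its number of rules, `Finset.card`. -/
abbrev Grammar := Finset Rule

/-- A symbol of `Γ` as a symbol of `Γ ∪ {#}`. -/
def liftSymbol : Symbol ℕ ℕ → Symbol ℕ (Option ℕ)
  | .terminal t => .terminal t
  | .nonterminal v => .nonterminal (some v)

/-- The string that a right-hand side denotes. -/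
def Rhs.toList : Rhs → List (Symbol ℕ (Option ℕ))
  | .pair a b => [liftSymbol a, liftSymbol b]
  | .power a r => List.replicate r (liftSymbol a)

/-- The context-free grammar with the given rules and the starting symbol `#`. -/
def Grammar.toCFG (G : Grammar) : ContextFreeGrammar ℕ where
  NT := Option ℕ
  initial := none
  rules := G.image fun ρ => ⟨ρ.lhs, ρ.rhs.toList⟩

/-- No symbol is on the left-hand side of two rules. -/
def Grammar.Deterministic (G : Grammar) : Prop :=
  ∀ ρ ∈ G, ∀ ρ' ∈ G, ρ.lhs = ρ'.lhs → ρ = ρ'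

/-- `G.Evaluates w`: the grammar `G` is deterministic, `eval G` is defined and `eval G = w`, that
is, rewriting from `#` by the rules of `G` ends in the string `w` of terminals.  (All rewritings in
a deterministic grammar end in the same string.) -/
def Grammar.Evaluates (G : Grammar) (w : List ℕ) : Prop :=
  G.Deterministic ∧ w ∈ G.toCFG.language

/-! ### A word RAM with random coins

Programs are structured (`while`) programs over registers and a memory that is addressed by
registers.  Every primitive instruction and every test costs one step. -/

/-- Binary machine operations. -/
inductive Op
  | plus | minus | times | quot | rem | less | equal

/-- The value of a machine operation on natural numbers (truncated subtraction, quotient and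
remainder; comparisons give `0` or `1`). -/
def Op.eval : Op → ℕ → ℕ → ℕ
  | .plus, a, b => a + b
  | .minus, a, b => a - b
  | .times, a, b => a * b
  | .quot, a, b => a / b
  | .rem, a, b => a % b
  | .less, a, b => if a < b then 1 else 0
  | .equal, a, b => if a = b then 1 else 0

/-- Programs; the arguments `i j l` are names of registers. -/
inductive Prog
  | skip
  /-- write the constant `v` to register `i` -/
  | lit (i v : ℕ)
  /-- write the result of `o` on registers `j` and `l` to register `i` -/
  | op (o : Op) (i j l : ℕ)
  /-- write the memory cell whose address is in register `j` to register `i` -/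
  | load (i j : ℕ)
  /-- write register `j` to the memory cell whose address is in register `i` -/
  | store (i j : ℕ)
  /-- toss a fair coin and write the result, `0` or `1`, to register `i` -/
  | coin (i : ℕ)
  /-- append register `i` to the output -/
  | emit (i : ℕ)
  | seq (p q : Prog)
  /-- run `p` if register `i` is not zero, and `q` otherwise -/
  | branch (i : ℕ) (p q : Prog)
  /-- run `p` as long as register `i` is not zero -/
  | loop (i : ℕ) (p : Prog)

/-- The state of the machine; `coins` are the results of the coin tosses still to come. -/
structure MState where
  reg : ℕ → ℕ
  mem : ℕ → ℕ
  coins : List Bool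
  out : List ℕ

/-- Write to a register. -/
def MState.setReg (s : MState) (i v : ℕ) : MState :=
  { s with reg := Function.update s.reg i v }

/-- `Prog.Runs w p s t s'`: on a machine with `w`-bit words, the program `p` started in the state
`s` halts after `t` steps in the state `s'`.  Results of operations are reduced modulo `2 ^ w`.  A
program that asks for more coins than there are does not halt. -/
inductive Prog.Runs (w : ℕ) : Prog → MState → ℕ → MState → Prop
  | skip (s : MState) : Runs w .skip s 1 s
  | lit (s : MState) (i v : ℕ) : Runs w (.lit i v) s 1 (s.setReg i (v % 2 ^ w))
  | op (s : MState) (o : Op) (i j l : ℕ) :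
      Runs w (.op o i j l) s 1 (s.setReg i (o.eval (s.reg j) (s.reg l) % 2 ^ w))
  | load (s : MState) (i j : ℕ) :
      Runs w (.load i j) s 1 (s.setReg i (s.mem (s.reg j)))
  | store (s : MState) (i j : ℕ) :
      Runs w (.store i j) s 1 { s with mem := Function.update s.mem (s.reg i) (s.reg j) }
  | coin (s : MState) (i : ℕ) (b : Bool) (bs : List Bool) (h : s.coins = b :: bs) :
      Runs w (.coin i) s 1 { s.setReg i (b.toNat % 2 ^ w) with coins := bs }
  | emit (s : MState) (i : ℕ) :
      Runs w (.emit i) s 1 { s with out := s.out ++ [s.reg i] }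
  | seq {p q : Prog} {s s' s'' : MState} {t t' : ℕ} :
      Runs w p s t s' → Runs w q s' t' s'' → Runs w (.seq p q) s (t + t') s''
  | branch_true {i : ℕ} {p q : Prog} {s s' : MState} {t : ℕ} :
      s.reg i ≠ 0 → Runs w p s t s' → Runs w (.branch i p q) s (t + 1) s'
  | branch_false {i : ℕ} {p q : Prog} {s s' : MState} {t : ℕ} :
      s.reg i = 0 → Runs w q s t s' → Runs w (.branch i p q) s (t + 1) s'
  | loop_done {i : ℕ} {p : Prog} {s : MState} :
      s.reg i = 0 → Runs w (.loop i p) s 1 s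
  | loop_step {i : ℕ} {p : Prog} {s s' s'' : MState} {t t' : ℕ} :
      s.reg i ≠ 0 → Runs w p s t s' → Runs w (.loop i p) s' t' s'' →
      Runs w (.loop i p) s (t + t' + 1) s''

/-- The initial state on the parameters `n`, `k`, the input string `x` and the coins `ρ`: the
numbers `n`, `k`, `|x|` are in the registers `0`, `1`, `2`, and the symbols of `x` are in the memory
cells `0, …, |x| - 1`; everything else is zero, and nothing has been output. -/
def initState (n k : ℕ) (x : List ℕ) {m : ℕ} (ρ : Fin m → Bool) : MState where
  reg i := if i = 0 then n else if i = 1 then k else if i = 2 then x.length else 0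
  mem i := x.getD i 0
  coins := List.ofFn ρ
  out := []

/-- The words that encode a symbol of `Γ`. -/
def encodeSymbol : Symbol ℕ ℕ → List ℕ
  | .terminal t => [0, t]
  | .nonterminal v => [1, v]

/-- The words that encode a left-hand side. -/
def encodeLhs : Option ℕ → List ℕ
  | none => [0, 0]
  | some v => [1, v]

/-- The words that encode a right-hand side; the exponent `r` is a single word. -/
def encodeRhs : Rhs → List ℕ
  | .pair a b => 0 :: (encodeSymbol a ++ encodeSymbol b)
  | .power a r => 1 :: (encodeSymbol a ++ [r])

/-- The words that encode a list of rules, preceded by the number of rules. -/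
def encodeRules (l : List Rule) : List ℕ :=
  l.length :: l.flatMap fun ρ => encodeLhs ρ.lhs ++ encodeRhs ρ.rhs

/-- `Encodes out gs`: the words `out` are an encoding of the sequence of grammars `gs`, each
written as a list of its rules. -/
def Encodes (out : List ℕ) (gs : List Grammar) : Prop :=
  ∃ ls : List (List Rule), ls.map List.toFinset = gs ∧ out = ls.flatMap encodeRules

/-- `Prog.Computes w p s T gs`: with `w`-bit words, `p` started in the state `s` halts within `T`
steps and its output encodes the sequence of grammars `gs`. -/
def Prog.Computes (w : ℕ) (p : Prog) (s : MState) (T : ℕ) (gs : List Grammar) : Prop :=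
  ∃ (t : ℕ) (s' : MState), p.Runs w s t s' ∧ t ≤ T ∧ Encodes s'.out gs

/-- The probability of an event over `m` independent fair coins. -/
noncomputable def coinProb {m : ℕ} (E : (Fin m → Bool) → Prop) : ℝ :=
  ({ρ | E ρ}.ncard : ℝ) / 2 ^ m

/-! ### Decompositions -/

/-- A positive integer of order `log n`. -/
def lg (n : ℕ) : ℕ := Nat.log 2 (n + 2)

/-- `x` is an admissible input: it has length at most `n`, over an alphabet of `(n + 1) ^ a`
symbols. -/
def IsInput (a n : ℕ) (x : List ℕ) : Prop :=
  x.length ≤ n ∧ ∀ c ∈ x, c < (n + 1) ^ a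

/-- The grammars `gs` evaluate, in order, to strings whose concatenation is `x`. -/
def EvaluateTo (gs : List Grammar) (x : List ℕ) : Prop :=
  ∃ bs : List (List ℕ), List.Forall₂ Grammar.Evaluates gs bs ∧ bs.flatten = x

/-- All grammars in `gs` have size at most `S`. -/
def SizeAtMost (S : ℕ) (gs : List Grammar) : Prop :=
  ∀ G ∈ gs, G.card ≤ S

/-- The sequences `gs` and `hs` have equal length, they differ in at most `k` positions, and their
grammars have evaluations whose edit distances, position by position, add up to that of `x` and
`y`. -/
def Aligned (k : ℕ) (x y : List ℕ) (gs hs : List Grammar) : Prop :=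
  gs.length = hs.length ∧
  (gs.zip hs).countP (fun p => p.1 ≠ p.2) ≤ k ∧
  ∃ bs cs : List (List ℕ),
    List.Forall₂ Grammar.Evaluates gs bs ∧ List.Forall₂ Grammar.Evaluates hs cs ∧
    editDist x y = (List.zipWith editDist bs cs).sum

/-!
The decomposition is obtained by randomized recompression with splitting.  Above the string `x` a
forest of nodes is built in `90 lg n` rounds.  Every node has a name, and its name is a random linear
hash value of what it replaces (`parentNode`).  Rounds alternate between two ways of joining adjacent
nodes (`joins`): a maximal run of equal names becomes a power rule, and a node with an even name
followed by one with an odd name becomes a pair rule.  Before each round every block of nodes is cut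
in front of all nodes whose names pass a random splitting test of probability about `K / D`, where
`K` is logarithmic and `D` is `k` times a power of the logarithm (`splitBlocks`).  The grammars of
the decomposition are those of the nodes that are left at the end (`nodeGrammar`).

Four events decide whether the result is good.

* Names determine rules (`prob_not_freshNames_succ`).  The hash family is pairwise independent, and
  names are so long that collisions are rare.  Then all grammars are deterministic and evaluate to
  the strings below their nodes, which concatenate to `x` (`evaluateTo_map_nodeGrammar`).
* Blocks have few names (`prob_not_fewNames`).  A segment with `D` different names has no splitting
  name only with probability exponentially small in `K`, by a second-moment bound for each of the `K`
  independent rows of the test.  Since the nodes below a node lie in one block of each level, its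
  grammar has at most `D` rules per level (`card_nodeGrammar_le`).
* Blocks shrink to single nodes (`prob_exists_length_ne_one`).  After a round that joins equal names,
  adjacent groups are different, so the parities of their new names are independent and the next
  round joins them with probability `1 / 4`.
* Edits stay local (`prob_not_apartBy`).  All choices depend on names only.  So a single edit affects,
  at each level, a part of one block that grows by at most one group on either side per round; it can
  change the block structure only if one of these few names is a splitting name.  A chain of
  `ED(x, y)` single edits yields decompositions of equal length in which the total cost of position
  by position edits is at most `ED(x, y)`, and every position that differs costs at least one edit
  (`aligned_of_apartBy`).  As the evaluations concatenate to `x` and `y`, the edit distances of the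
  positions cannot add up to less than `ED(x, y)`.

Splitting at random names rather than at random positions is what makes the two decompositions agree,
because both runs use the same random words.

The program stores all levels as rows of names, with a mark at the first node of each block
(`markedLevel`), and the starting positions of the groups; the grammars are read off by following
these positions down the levels.  Its correctness and its running time are proved together in a small
Hoare logic with step counts (`Prog.Ends`), in which a syntactic frame rule (`Frame`) takes care of
the registers that a subprogram does not touch.
-/


/-! ### Averages over finite probability spaces -/

/-- The average of `f` over a finite type, that is, its expectation for the uniform distribution. -/
noncomputable def avg {Ω : Type*} [Fintype Ω] (f : Ω → ℝ) : ℝ := (∑ ω, f ω) / Fintype.card Ω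

open Classical in
/-- The probability of an event for the uniform distribution on a finite type. -/
noncomputable def prob {Ω : Type*} [Fintype Ω] (E : Ω → Prop) : ℝ := avg fun ω => if E ω then 1 else 0

section Averages

variable {Ω Ω' : Type*} [Fintype Ω] [Fintype Ω']

theorem avg_mono {f g : Ω → ℝ} (h : ∀ ω, f ω ≤ g ω) : avg f ≤ avg g := by
  unfold avg
  gcongr with ω
  exact h ω

theorem avg_add (f g : Ω → ℝ) : avg (fun ω => f ω + g ω) = avg f + avg g := by
  simp only [avg, Finset.sum_add_distrib, add_div]

theorem avg_sum {ι : Type*} (s : Finset ι) (f : ι → Ω → ℝ) :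
    avg (fun ω => ∑ i ∈ s, f i ω) = ∑ i ∈ s, avg (f i) := by
  simp only [avg]
  rw [Finset.sum_comm, Finset.sum_div]

theorem avg_list_sum {ι : Type*} (l : List ι) (f : ι → Ω → ℝ) :
    avg (fun ω => (l.map fun i => f i ω).sum) = (l.map fun i => avg (f i)).sum := by
  induction l with
  | nil => simp [avg]
  | cons a l ih => simp [avg_add, ih]

theorem avg_const_mul (c : ℝ) (f : Ω → ℝ) : avg (fun ω => c * f ω) = c * avg f := by
  simp only [avg, ← Finset.mul_sum, mul_div_assoc]

theorem avg_const [Nonempty Ω] (c : ℝ) : avg (fun _ : Ω => c) = c := by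
  simp [avg]

theorem avg_le [Nonempty Ω] {f : Ω → ℝ} {c : ℝ} (h : ∀ ω, f ω ≤ c) : avg f ≤ c :=
  (avg_mono h).trans_eq (avg_const c)

theorem avg_comp_bijective {e : Ω → Ω'} (he : e.Bijective) (f : Ω' → ℝ) :
    avg (fun ω => f (e ω)) = avg f := by
  simp only [avg, he.sum_comp f, Fintype.card_of_bijective he]

theorem avg_prod (f : Ω × Ω' → ℝ) : avg f = avg fun ω => avg fun ω' => f (ω, ω') := by
  simp only [avg, Fintype.sum_prod_type, Fintype.card_prod, Nat.cast_mul, ← Finset.sum_div]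
  rw [div_div, mul_comm]

theorem prob_mono {E F : Ω → Prop} (h : ∀ ω, E ω → F ω) : prob E ≤ prob F := by
  refine avg_mono fun ω => ?_
  by_cases hE : E ω
  · simp [hE, h ω hE]
  · simp only [hE, if_false]; positivity

theorem prob_or_le (E F : Ω → Prop) : prob (fun ω => E ω ∨ F ω) ≤ prob E + prob F := by
  unfold prob
  rw [← avg_add]
  refine avg_mono fun ω => ?_
  by_cases hE : E ω <;> by_cases hF : F ω <;> simp [hE, hF]

theorem prob_exists_le {ι : Type*} (s : Finset ι) (E : ι → Ω → Prop) :
    prob (fun ω => ∃ i ∈ s, E i ω) ≤ ∑ i ∈ s, prob (E i) := by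
  unfold prob
  rw [← avg_sum]
  refine avg_mono fun ω => ?_
  by_cases h : ∃ i ∈ s, E i ω
  · obtain ⟨i, hi, hE⟩ := h
    rw [if_pos ⟨i, hi, hE⟩]
    refine le_trans ?_ (Finset.single_le_sum (fun j _ => ?_) hi)
    · simp [hE]
    · positivity
  · rw [if_neg h]
    exact Finset.sum_nonneg fun i _ => by positivity

theorem prob_le_avg {E : Ω → Prop} {f : Ω → ℝ} (h0 : ∀ ω, 0 ≤ f ω) (h1 : ∀ ω, E ω → 1 ≤ f ω) :
    prob E ≤ avg f := by
  refine avg_mono fun ω => ?_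
  by_cases hE : E ω
  · simp [hE, h1 ω hE]
  · simp [hE, h0 ω]

theorem prob_eq_avg (E : Ω → Prop) [DecidablePred E] :
    prob E = avg fun ω => if E ω then (1 : ℝ) else 0 := by
  unfold prob
  congr!

theorem prob_not [Nonempty Ω] (E : Ω → Prop) : prob (fun ω => ¬ E ω) = 1 - prob E := by
  classical
  have h : (fun ω => (if ¬ E ω then (1 : ℝ) else 0) + (if E ω then 1 else 0)) = fun _ => 1 := by
    funext ω
    by_cases hE : E ω <;> simp [hE]
  rw [prob_eq_avg, prob_eq_avg, eq_sub_iff_add_eq, ← avg_add, h, avg_const]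

theorem coinProb_eq_prob {m : ℕ} (E : (Fin m → Bool) → Prop) : coinProb E = prob E := by
  classical
  simp only [coinProb, prob, avg, Finset.sum_boole]
  congr 2
  · rw [Set.ncard_eq_toFinset_card']
    congr 1
    ext
    simp
  · simp

/-- A surjective homomorphism of finite groups maps the uniform distribution to the uniform
distribution. -/
theorem avg_comp_hom {A B : Type*} [AddCommGroup A] [AddCommGroup B] [Fintype A] [Fintype B]
    (φ : A →+ B) (hφ : Function.Surjective φ) (f : B → ℝ) : avg (fun x => f (φ x)) = avg f := by
  classical
  have hfib : ∀ b, (Finset.univ.filter fun x => φ x = b).card =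
      (Finset.univ.filter fun x => φ x = 0).card := fun b =>
    AddMonoidHom.card_fiber_eq_of_mem_range φ (hφ b) ⟨0, map_zero φ⟩
  set c := (Finset.univ.filter fun x => φ x = 0).card with hc
  have hcard : Fintype.card A = Fintype.card B * c := by
    rw [← Finset.card_univ, Finset.card_eq_sum_card_fiberwise (f := φ) (t := Finset.univ)
      (by simp), Finset.sum_congr rfl fun b _ => hfib b]
    simp [Finset.card_univ]
  have hcpos : (c : ℝ) ≠ 0 := by
    have : 0 < Fintype.card A := Fintype.card_pos
    rw [hcard] at this
    exact_mod_cast (Nat.pos_of_mul_pos_left this).ne'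
  have hsum : ∑ x, f (φ x) = (∑ b, f b) * c := by
    rw [← Finset.sum_fiberwise (s := Finset.univ) (g := φ), Finset.sum_mul]
    refine Finset.sum_congr rfl fun b _ => ?_
    rw [Finset.sum_congr rfl (g := fun _ => f b) (fun x hx => by
      rw [(Finset.mem_filter.1 hx).2]), Finset.sum_const, hfib b, nsmul_eq_mul, mul_comm]
  rw [avg, avg, hsum, hcard, Nat.cast_mul, mul_div_mul_right _ _ hcpos]

end Averages

/-! ### Sequences of random words -/

section Words

variable {Z : Type*} {N : ℕ}

/-- A finite sequence of words as an infinite one, padded with zeros. -/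
def padWords [Zero Z] (ω : Fin N → Z) : ℕ → Z := fun t => if h : t < N then ω ⟨t, h⟩ else 0

/-- The sequence that agrees with `T` before position `t₀` and with `T'` from there on. -/
def splice (t₀ : ℕ) (T T' : ℕ → Z) : ℕ → Z := fun t => if t < t₀ then T t else T' t

theorem splice_of_lt {t₀ t : ℕ} (T T' : ℕ → Z) (h : t < t₀) : splice t₀ T T' t = T t := if_pos h

theorem splice_of_le {t₀ t : ℕ} (T T' : ℕ → Z) (h : t₀ ≤ t) : splice t₀ T T' t = T' t :=
  if_neg h.not_gt

/-- Words from position `t₀` on may be drawn afresh, independently of the earlier ones. -/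
theorem avg_splice [Zero Z] [Fintype Z] (t₀ : ℕ) (f : (ℕ → Z) → ℝ) :
    (avg fun ω : Fin N → Z => f (padWords ω)) =
      avg fun ω : Fin N → Z => avg fun ω' : Fin N → Z =>
        f (splice t₀ (padWords ω) (padWords ω')) := by
  let mix : (Fin N → Z) → (Fin N → Z) → (Fin N → Z) := fun ω ω' t =>
    if (t : ℕ) < t₀ then ω t else ω' t
  have hmix : ∀ ω ω', splice t₀ (padWords ω) (padWords ω') = padWords (mix ω ω') := by
    intro ω ω'
    funext t
    simp only [splice, padWords, mix]
    split_ifs <;> rfl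
  have hbij : Function.Bijective fun p : (Fin N → Z) × (Fin N → Z) => (mix p.1 p.2, mix p.2 p.1) := by
    refine Function.Involutive.bijective fun p => ?_
    ext t <;> simp only [mix] <;> split_ifs <;> rfl
  have h := avg_comp_bijective hbij fun p => f (padWords p.1)
  rw [avg_prod, avg_prod] at h
  simp only [hmix]
  rw [h]
  exact congrArg avg (funext fun ω => (avg_const (Ω := Fin N → Z) (f (padWords ω))).symm)

/-- If, whatever the words before position `t₀` are, an event has probability at most `c` over the
words from `t₀` on, then it has probability at most `c`. -/
theorem prob_le_of_splice [Zero Z] [Fintype Z] (t₀ : ℕ) (E : (ℕ → Z) → Prop) (c : ℝ)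
    (h : ∀ T : ℕ → Z, prob (fun ω : Fin N → Z => E (splice t₀ T (padWords ω))) ≤ c) :
    prob (fun ω : Fin N → Z => E (padWords ω)) ≤ c := by
  classical
  have h2 := avg_splice (N := N) t₀ fun T : ℕ → Z => if E T then (1 : ℝ) else 0
  rw [prob_eq_avg, h2]
  refine avg_le fun ω => le_trans (le_of_eq ?_) (h (padWords ω))
  rw [prob_eq_avg]

end Words

/-! ### The linear hash family -/

/-- The sum of the words of `T` at the positions `t + i`, where `i < m` runs over the nonzero bits
of `v`. -/
def bitSum {Z : Type*} [AddCommGroup Z] (T : ℕ → Z) (t m v : ℕ) : Z :=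
  ∑ i ∈ Finset.range m, if v.testBit i then T (t + i) else 0

/-- The hash value of the `m`-bit number `v` for the random words `T t, …, T (t + m)`. -/
def linHash {Z : Type*} [AddCommGroup Z] (T : ℕ → Z) (t m v : ℕ) : Z := T t + bitSum T (t + 1) m v

section Hash

variable {Z : Type*} [AddCommGroup Z]

theorem bitSum_congr {T T' : ℕ → Z} {t m : ℕ} (v : ℕ) (h : ∀ i, t ≤ i → i < t + m → T i = T' i) :
    bitSum T t m v = bitSum T' t m v := by
  refine Finset.sum_congr rfl fun i hi => ?_
  rw [h (t + i) (by lia) (by have := Finset.mem_range.1 hi; lia)]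

theorem linHash_congr {T T' : ℕ → Z} {t m : ℕ} (v : ℕ) (h : ∀ i, t ≤ i → i ≤ t + m → T i = T' i) :
    linHash T t m v = linHash T' t m v := by
  rw [linHash, linHash, h t le_rfl (by lia), bitSum_congr v fun i h1 h2 => h i (by lia) (by lia)]

/-- Hashing of concatenated bit strings. -/
theorem bitSum_add (T : ℕ → Z) (t h m a b : ℕ) (ha : a < 2 ^ h) :
    bitSum T t (h + m) (a + 2 ^ h * b) = bitSum T t h a + bitSum T (t + h) m b := by
  unfold bitSum
  rw [Finset.sum_range_add]
  congr 1
  · refine Finset.sum_congr rfl fun i hi => ?_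
    rw [add_comm a, Nat.testBit_two_pow_mul_add _ ha, if_pos (Finset.mem_range.1 hi)]
  · refine Finset.sum_congr rfl fun i hi => ?_
    rw [add_comm a, Nat.testBit_two_pow_mul_add _ ha, if_neg (Nat.le_add_right h i).not_gt,
      Nat.add_sub_cancel_left, add_assoc]

/-- A hash value as an additive function of the random words. -/
def hashHom (N t m v : ℕ) : (Fin N → Z) →+ Z where
  toFun ω := linHash (padWords ω) t m v
  map_zero' := by simp [linHash, bitSum, padWords]
  map_add' ω ω' := by
    have hp : padWords (ω + ω') = fun t => padWords ω t + padWords ω' t := by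
      funext t
      simp only [padWords]
      split_ifs <;> simp
    simp only [linHash, bitSum, hp]
    have : ∀ i, (if v.testBit i then padWords ω (t + 1 + i) + padWords ω' (t + 1 + i) else 0) =
        (if v.testBit i then padWords ω (t + 1 + i) else 0) +
        (if v.testBit i then padWords ω' (t + 1 + i) else 0) := fun i => by split_ifs <;> simp
    simp only [this, Finset.sum_add_distrib]
    abel

theorem exists_words {N : ℕ} (t s : ℕ) (hts : t < s) (hs : s < N) (a b : Z) :
    ∃ ω : Fin N → Z, padWords ω t = a ∧ padWords ω s = b ∧
      ∀ i, i ≠ t → i ≠ s → padWords ω i = 0 := by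
  refine ⟨fun i => if (i : ℕ) = t then a else if (i : ℕ) = s then b else 0, ?_, ?_, ?_⟩
  · simp [padWords, hts.trans hs]
  · simp [padWords, hs, hts.ne']
  · intro i h1 h2
    simp [padWords, h1, h2]

theorem bitSum_single (T : ℕ → Z) (t m i v : ℕ) (hi : i < m) (h : ∀ j, j < m → j ≠ i → T (t + j) = 0) :
    bitSum T t m v = if v.testBit i then T (t + i) else 0 := by
  unfold bitSum
  refine Finset.sum_eq_single i (fun j hj hji => ?_) (fun h => absurd (Finset.mem_range.2 hi) h)
  rw [h j (Finset.mem_range.1 hj) hji]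
  simp

/-- The hash value of a single number is uniformly distributed. -/
theorem avg_linHash [Fintype Z] {N t m : ℕ} (v : ℕ) (hN : t + m < N) (f : Z → ℝ) :
    (avg fun ω : Fin N → Z => f (linHash (padWords ω) t m v)) = avg f := by
  refine avg_comp_hom (hashHom N t m v) (fun a => ?_) f
  refine ⟨fun i => if (i : ℕ) = t then a else 0, ?_⟩
  have : bitSum (padWords fun i : Fin N => if (i : ℕ) = t then a else 0) (t + 1) m v = 0 :=
    Finset.sum_eq_zero fun i _ => by
      have : t + 1 + i ≠ t := by lia
      simp [padWords, this]
  change linHash _ _ _ _ = a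
  rw [linHash, this]
  simp [padWords, show t < N by lia]

/-- The hash values of two different numbers are independent and uniformly distributed. -/
theorem avg_linHash_pair [Fintype Z] {N t m u v : ℕ} (hN : t + m < N) (hu : u < 2 ^ m) (hv : v < 2 ^ m)
    (huv : u ≠ v) (f : Z × Z → ℝ) :
    (avg fun ω : Fin N → Z => f (linHash (padWords ω) t m u, linHash (padWords ω) t m v)) = avg f := by
  refine avg_comp_hom ((hashHom N t m u).prod (hashHom N t m v)) (fun p => ?_) f
  obtain ⟨i, hi⟩ := Nat.exists_testBit_ne_of_ne huv
  have him : i < m := by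
    by_contra h
    have h2 : 2 ^ m ≤ 2 ^ i := Nat.pow_le_pow_right (by norm_num) (by lia)
    rw [Nat.testBit_lt_two_pow (hu.trans_le h2), Nat.testBit_lt_two_pow (hv.trans_le h2)] at hi
    exact hi rfl
  -- The first word and the word of a bit where `u` and `v` differ determine both hash values.
  have key : ∀ a b : Z, ∃ ω : Fin N → Z, ∀ v, linHash (padWords ω) t m v =
      a + if v.testBit i then b else 0 := by
    intro a b
    obtain ⟨ω, h1, h2, h3⟩ := exists_words (N := N) t (t + 1 + i) (by lia) (by lia) a b
    refine ⟨ω, fun v => ?_⟩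
    rw [linHash, h1, bitSum_single _ _ _ i v him (fun j _ hji => h3 _ (by lia) (by lia)), h2]
  cases hui : u.testBit i
  · have hvi : v.testBit i = true := by
      cases h : v.testBit i
      · exact absurd (hui.trans h.symm) hi
      · rfl
    obtain ⟨ω, hω⟩ := key p.1 (p.2 - p.1)
    refine ⟨ω, Prod.ext ?_ ?_⟩
    · exact (hω u).trans (by simp [hui])
    · exact (hω v).trans (by simp [hvi])
  · have hvi : v.testBit i = false := by
      cases h : v.testBit i
      · rfl
      · exact absurd (hui.trans h.symm) hi
    obtain ⟨ω, hω⟩ := key p.2 (p.1 - p.2)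
    refine ⟨ω, Prod.ext ?_ ?_⟩
    · exact (hω u).trans (by simp [hui])
    · exact (hω v).trans (by simp [hvi])

end Hash


/-! ### Hash values in `ZMod (2 ^ h)` -/

section HashProbabilities

variable {h : ℕ}

theorem sum_zmod_val (f : ℕ → ℝ) :
    ∑ z : ZMod (2 ^ h), f z.val = ∑ i ∈ Finset.range (2 ^ h), f i := by
  refine Finset.sum_bij (fun z _ => z.val) (fun z _ => Finset.mem_range.2 z.val_lt)
    (fun z _ z' _ hz => ZMod.val_injective _ hz) (fun i hi => ?_) (fun _ _ => rfl)
  exact ⟨i, Finset.mem_univ _, ZMod.val_cast_of_lt (Finset.mem_range.1 hi)⟩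

theorem avg_zmod_val (f : ℕ → ℝ) :
    (avg fun z : ZMod (2 ^ h) => f z.val) = (∑ i ∈ Finset.range (2 ^ h), f i) / 2 ^ h := by
  rw [avg, sum_zmod_val, ZMod.card]
  push_cast
  rfl

theorem avg_val_lt {θ : ℕ} (hθ : θ ≤ 2 ^ h) :
    (avg fun z : ZMod (2 ^ h) => if z.val < θ then (1 : ℝ) else 0) = θ / 2 ^ h := by
  rw [avg_zmod_val fun i => if i < θ then (1 : ℝ) else 0, Finset.sum_boole]
  congr 2
  rw [← Finset.card_range θ]
  congr 1
  ext i
  simp only [Finset.mem_filter, Finset.mem_range, Finset.card_range]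
  lia

theorem sum_range_two_mul_parity (m : ℕ) (f : ℕ → ℝ) (c : ℝ) (hf : ∀ i, f (2 * i) + f (2 * i + 1) = c) :
    ∑ i ∈ Finset.range (2 * m), f i = m * c := by
  induction m with
  | zero => simp
  | succ m ih =>
    rw [show 2 * (m + 1) = 2 * m + 1 + 1 by ring, Finset.sum_range_succ, Finset.sum_range_succ, ih,
      add_assoc, hf]
    push_cast
    ring

theorem avg_val_parity (hh : 0 < h) (b : ℕ) (hb : b < 2) :
    (avg fun z : ZMod (2 ^ h) => if z.val % 2 = b then (1 : ℝ) else 0) = 1 / 2 := by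
  rw [avg_zmod_val fun i => if i % 2 = b then (1 : ℝ) else 0]
  obtain ⟨g, rfl⟩ := Nat.exists_eq_succ_of_ne_zero hh.ne'
  rw [pow_succ', sum_range_two_mul_parity _ _ 1]
  · rw [Nat.succ_eq_add_one, pow_succ]
    push_cast
    field_simp
  · intro i
    interval_cases b <;> simp [Nat.add_mod]

variable {N t m : ℕ}

local notation "Z" => ZMod (2 ^ h)

theorem prob_linHash_eq_const (v : ℕ) (hN : t + m < N) (c : ℕ) :
    prob (fun ω : Fin N → Z => (linHash (padWords ω) t m v).val = c) ≤ 1 / 2 ^ h := by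
  rw [prob_eq_avg, avg_linHash v hN fun z : Z => if z.val = c then (1 : ℝ) else 0,
    avg_zmod_val fun i => if i = c then (1 : ℝ) else 0]
  gcongr
  rw [Finset.sum_ite_eq']
  split_ifs <;> norm_num

theorem prob_linHash_eq_linHash {u v : ℕ} (hN : t + m < N) (hu : u < 2 ^ m) (hv : v < 2 ^ m)
    (huv : u ≠ v) :
    prob (fun ω : Fin N → Z => linHash (padWords ω) t m u = linHash (padWords ω) t m v) ≤
      1 / 2 ^ h := by
  rw [prob_eq_avg, avg_linHash_pair hN hu hv huv fun p : Z × Z => if p.1 = p.2 then (1 : ℝ) else 0,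
    avg_prod]
  refine avg_le fun a => ?_
  rw [avg, Finset.sum_ite_eq, if_pos (Finset.mem_univ a), ZMod.card]
  push_cast
  rfl

/-- Two numbers with independent hash values get hash values of prescribed different parities with
probability `1 / 4`. -/
theorem prob_not_parities {u v : ℕ} (hh : 0 < h) (hN : t + m < N) (hu : u < 2 ^ m) (hv : v < 2 ^ m)
    (huv : u ≠ v) :
    prob (fun ω : Fin N → Z => ¬ ((linHash (padWords ω) t m u).val % 2 = 0 ∧
      (linHash (padWords ω) t m v).val % 2 = 1)) = 3 / 4 := by
  rw [prob_not, prob_eq_avg, avg_linHash_pair hN hu hv huv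
    fun p : Z × Z => if p.1.val % 2 = 0 ∧ p.2.val % 2 = 1 then (1 : ℝ) else 0, avg_prod]
  have : (fun a : Z => avg fun b : Z => if a.val % 2 = 0 ∧ b.val % 2 = 1 then (1 : ℝ) else 0) =
      fun a : Z => (1 / 2 : ℝ) * if a.val % 2 = 0 then 1 else 0 := by
    funext a
    by_cases ha : a.val % 2 = 0
    · simp only [ha, true_and, avg_val_parity hh 1 (by norm_num)]
      norm_num
    · simp [ha, avg]
  rw [this, avg_const_mul, avg_val_parity hh 0 (by norm_num)]
  norm_num

theorem prob_linHash_lt (v : ℕ) (hN : t + m < N) {θ : ℕ} (hθ : θ ≤ 2 ^ h) :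
    prob (fun ω : Fin N → Z => (linHash (padWords ω) t m v).val < θ) = θ / 2 ^ h := by
  rw [prob_eq_avg, avg_linHash v hN fun z : Z => if z.val < θ then (1 : ℝ) else 0, avg_val_lt hθ]

theorem avg_linHash_lt_mul {u v : ℕ} (hN : t + m < N) (hu : u < 2 ^ m) (hv : v < 2 ^ m)
    (huv : u ≠ v) {θ : ℕ} (hθ : θ ≤ 2 ^ h) :
    (avg fun ω : Fin N → Z => (if (linHash (padWords ω) t m u).val < θ then (1 : ℝ) else 0) *
      if (linHash (padWords ω) t m v).val < θ then 1 else 0) = (θ / 2 ^ h) * (θ / 2 ^ h) := by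
  rw [avg_linHash_pair hN hu hv huv fun p : Z × Z =>
    (if p.1.val < θ then (1 : ℝ) else 0) * if p.2.val < θ then 1 else 0, avg_prod]
  have h1 : ∀ a : Z, (avg fun b : Z => (if a.val < θ then (1 : ℝ) else 0) *
      if b.val < θ then 1 else 0) = (θ / 2 ^ h) * if a.val < θ then 1 else 0 := fun a => by
    rw [avg_const_mul, avg_val_lt hθ, mul_comm]
  simp only [h1]
  rw [avg_const_mul, avg_val_lt hθ]

/-- Bonferroni: if a threshold is met with probability about `1 / D`, then with constant probability
at least one of `D` pairwise independent hash values meets it. -/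
theorem prob_forall_not_lt {D : ℕ} (hD : 0 < D) (hDh : D ≤ 2 ^ h) (hN : t + m < N) (s : Finset ℕ)
    (hs : s.card = D) (hsm : ∀ v ∈ s, v < 2 ^ m) :
    prob (fun ω : Fin N → Z => ∀ v ∈ s, ¬ (linHash (padWords ω) t m v).val < 2 ^ h / D) ≤ 5 / 8 := by
  set θ := 2 ^ h / D with hθdef
  have hθ : θ ≤ 2 ^ h := Nat.div_le_self _ _
  let X : ℕ → (Fin N → Z) → ℝ := fun v ω => if (linHash (padWords ω) t m v).val < θ then 1 else 0
  have hX : ∀ v, avg (X v) = θ / 2 ^ h := fun v => by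
    rw [← prob_linHash_lt (N := N) v hN hθ, prob_eq_avg]
  set p : ℝ := θ / 2 ^ h with hp
  have hXX : ∀ u ∈ s, ∀ v ∈ s, u ≠ v → avg (fun ω => X u ω * X v ω) = p * p :=
    fun u hu v hv huv => avg_linHash_lt_mul hN (hsm u hu) (hsm v hv) huv hθ
  have hD0 : (0 : ℝ) < D := by exact_mod_cast hD
  have hM0 : (0 : ℝ) < 2 ^ h := by positivity
  have hx1 : D * p ≤ 1 := by
    rw [hp, mul_div_assoc', div_le_one hM0]
    have : D * θ ≤ 2 ^ h := Nat.mul_div_le _ _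
    exact_mod_cast this
  have hx2 : 1 / 2 ≤ D * p := by
    rw [hp, mul_div_assoc', le_div_iff₀ hM0]
    have h1 : 1 ≤ θ := (Nat.one_le_div_iff hD).2 hDh
    have h2 : 2 ^ h < D * (θ + 1) := by
      rw [mul_comm]
      exact Nat.lt_mul_of_div_lt (Nat.lt_succ_self _) hD
    have h3 : 2 ^ h ≤ 2 * (D * θ) := by nlinarith
    have h4 : (2 : ℝ) ^ h ≤ 2 * (D * θ) := by exact_mod_cast h3
    linarith
  have hX01 : ∀ v ω, X v ω = 0 ∨ X v ω = 1 := fun v ω => by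
    simp only [X]
    split_ifs <;> simp
  -- The indicator of "no value meets the threshold" is at most `1 - m + m (m - 1) / 2`, where `m`
  -- is the number of values that meet it.
  have hbon : ∀ ω : Fin N → Z, (if ∀ v ∈ s, ¬ (linHash (padWords ω) t m v).val < θ then (1 : ℝ) else 0) ≤
      1 + ((-1) * ∑ v ∈ s, X v ω + (1 / 2) * ∑ q ∈ s.offDiag, X q.1 ω * X q.2 ω) := by
    intro ω
    set c := (s.filter fun v => (linHash (padWords ω) t m v).val < θ).card with hc
    have hsum : ∑ v ∈ s, X v ω = c := by
      simp only [X, Finset.sum_boole, hc]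
    have hoff : ∑ q ∈ s.offDiag, X q.1 ω * X q.2 ω = (c : ℝ) * c - c := by
      have h1 : ∑ q ∈ s ×ˢ s, X q.1 ω * X q.2 ω = (c : ℝ) * c := by
        rw [Finset.sum_product, ← hsum, Finset.sum_mul_sum]
      have h2 : ∑ q ∈ s.diag, X q.1 ω * X q.2 ω = c := by
        rw [Finset.sum_diag, ← hsum]
        refine Finset.sum_congr rfl fun v _ => ?_
        rcases hX01 v ω with h | h <;> simp [h]
      rw [← Finset.diag_union_offDiag, Finset.sum_union (Finset.disjoint_diag_offDiag s), h2] at h1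
      linarith
    rw [hsum, hoff]
    split_ifs with hall
    · have : c = 0 := by
        rw [hc, Finset.card_eq_zero, Finset.filter_eq_empty_iff]
        exact fun v hv => hall v hv
      simp [this]
    · have hc1 : 1 ≤ c := by
        push Not at hall
        obtain ⟨v, hv, hlt⟩ := hall
        exact Finset.card_pos.2 ⟨v, Finset.mem_filter.2 ⟨hv, hlt⟩⟩
      have : (0 : ℝ) ≤ ((c : ℝ) - 1) * (c - 2) := by
        rcases Nat.lt_or_ge c 2 with h | h
        · rw [show c = 1 by lia]; norm_num
        · have : (2 : ℝ) ≤ c := by exact_mod_cast h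
          nlinarith
      nlinarith
  rw [prob_eq_avg]
  refine (avg_mono hbon).trans ?_
  rw [avg_add, avg_const, avg_add, avg_const_mul, avg_const_mul, avg_sum, avg_sum,
    Finset.sum_congr rfl fun v _ => hX v, Finset.sum_congr rfl fun q hq => hXX q.1
      (Finset.mem_offDiag.1 hq).1 q.2 (Finset.mem_offDiag.1 hq).2.1 (Finset.mem_offDiag.1 hq).2.2,
    Finset.sum_const, Finset.sum_const, Finset.offDiag_card, hs]
  simp only [nsmul_eq_mul]
  have hDD : ((D * D - D : ℕ) : ℝ) ≤ D * D := by exact_mod_cast Nat.sub_le _ _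
  have hpp : 0 ≤ p * p := mul_self_nonneg p
  have := mul_le_mul_of_nonneg_right hDD hpp
  nlinarith

end HashProbabilities

/-! ### The splitting test -/

/-- `v` is a splitting name for the words `T` from position `t` on: in one of `K` rows, each of
`h + 1` words, its hash value is less than `θ`. -/
def isSplit {h : ℕ} (K θ : ℕ) (T : ℕ → ZMod (2 ^ h)) (t v : ℕ) : Bool :=
  decide (∃ i ∈ Finset.range K, (linHash T (t + i * (h + 1)) h v).val < θ)

section Splitting

variable {h K θ N t : ℕ}

local notation "Z" => ZMod (2 ^ h)

theorem isSplit_congr {T T' : ℕ → Z} (v : ℕ)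
    (hT : ∀ i, t ≤ i → i < t + K * (h + 1) → T i = T' i) : isSplit K θ T t v = isSplit K θ T' t v := by
  refine decide_eq_decide.2 (exists_congr fun i => and_congr_right fun hi => ?_)
  have : (i + 1) * (h + 1) ≤ K * (h + 1) := Nat.mul_le_mul_right _ (by simpa using hi)
  rw [linHash_congr v fun j h1 h2 => hT j (by lia) (by lia)]

theorem prob_isSplit_le (v : ℕ) (hN : t + K * (h + 1) ≤ N) (D : ℕ) :
    prob (fun ω : Fin N → Z => isSplit K (2 ^ h / D) (padWords ω) t v = true) ≤ K / D := by
  simp only [isSplit, decide_eq_true_eq]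
  refine (prob_exists_le _ _).trans ?_
  have hθ : 2 ^ h / D ≤ 2 ^ h := Nat.div_le_self _ _
  rw [Finset.sum_congr rfl (g := fun _ => ((2 ^ h / D : ℕ) : ℝ) / 2 ^ h) fun i hi => ?_]
  · rw [Finset.sum_const, Finset.card_range, nsmul_eq_mul, div_eq_mul_inv (K : ℝ)]
    refine mul_le_mul_of_nonneg_left ?_ (Nat.cast_nonneg K)
    rw [div_le_iff₀ (by positivity), inv_mul_eq_div]
    refine Nat.cast_div_le.trans_eq ?_
    push_cast
    rfl
  · have : (i + 1) * (h + 1) ≤ K * (h + 1) := Nat.mul_le_mul_right _ (by simpa using hi)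
    exact prob_linHash_lt v (by lia) hθ

/-- The rows are independent, so that `D` different names are all no splitting names only with
probability exponentially small in the number of rows. -/
theorem prob_forall_not_isSplit {D : ℕ} (hD : 0 < D) (hDh : D ≤ 2 ^ h) (hN : t + K * (h + 1) ≤ N)
    (s : Finset ℕ) (hs : s.card = D) (hsm : ∀ v ∈ s, v < 2 ^ h) :
    prob (fun ω : Fin N → Z => ∀ v ∈ s, isSplit K (2 ^ h / D) (padWords ω) t v = false) ≤
      (5 / 8) ^ K := by
  induction K with
  | zero =>
    rw [pow_zero, prob_eq_avg]
    exact avg_le fun ω => by split_ifs <;> norm_num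
  | succ K ih =>
    have ih' := ih (by rw [Nat.succ_mul] at hN; lia)
    rw [Nat.succ_mul] at hN
    have hset : ∀ T : ℕ → Z, (∀ v ∈ s, isSplit (K + 1) (2 ^ h / D) T t v = false) ↔
        (∀ v ∈ s, isSplit K (2 ^ h / D) T t v = false) ∧
        ∀ v ∈ s, ¬ (linHash T (t + K * (h + 1)) h v).val < 2 ^ h / D := by
      intro T
      rw [← forall₂_and]
      refine forall₂_congr fun v _ => ?_
      simp only [isSplit, Finset.range_add_one, decide_eq_false_iff_not, Finset.exists_mem_insert,
        not_or]
      exact and_comm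
    simp only [hset]
    rw [prob_eq_avg, avg_splice (N := N) (t + K * (h + 1)) fun T : ℕ → Z =>
      if (∀ v ∈ s, isSplit K (2 ^ h / D) T t v = false) ∧
        ∀ v ∈ s, ¬ (linHash T (t + K * (h + 1)) h v).val < 2 ^ h / D then (1 : ℝ) else 0]
    rw [pow_succ']
    rw [prob_eq_avg] at ih'
    refine le_trans (avg_mono (g := fun ω : Fin N → Z => (5 / 8 : ℝ) *
      if ∀ v ∈ s, isSplit K (2 ^ h / D) (padWords ω) t v = false then 1 else 0) fun ω => ?_) ?_
    · have h1 : ∀ ω' : Fin N → Z, ∀ v, isSplit K (2 ^ h / D)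
          (splice (t + K * (h + 1)) (padWords ω) (padWords ω')) t v =
          isSplit K (2 ^ h / D) (padWords ω) t v := fun ω' v =>
        isSplit_congr v fun i _ hi => splice_of_lt _ _ hi
      have h2 : ∀ ω' : Fin N → Z, ∀ v,
          linHash (splice (t + K * (h + 1)) (padWords ω) (padWords ω')) (t + K * (h + 1)) h v =
          linHash (padWords ω') (t + K * (h + 1)) h v := fun ω' v =>
        linHash_congr v fun i hi _ => splice_of_le _ _ hi
      simp only [h1, h2]
      by_cases hω : ∀ v ∈ s, isSplit K (2 ^ h / D) (padWords ω) t v = false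
      · simp only [eq_true hω, true_and, if_true, mul_one]
        rw [← prob_eq_avg]
        exact prob_forall_not_lt hD hDh (by lia) s hs hsm
      · simp [hω, avg]
    · rw [avg_const_mul]
      exact mul_le_mul_of_nonneg_left ih' (by norm_num)

end Splitting


/-! ### Edit scripts -/

theorem EditOp.append_context {x y : List ℕ} (h : EditOp x y) (p q : List ℕ) :
    EditOp (p ++ x ++ q) (p ++ y ++ q) := by
  cases h with
  | insertion u v c => simpa using EditOp.insertion (p ++ u) (v ++ q) c
  | deletion u v c => simpa using EditOp.deletion (p ++ u) (v ++ q) c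
  | substitution u v c d => simpa using EditOp.substitution (p ++ u) (v ++ q) c d

theorem EditsIn.append_context {m : ℕ} {x y : List ℕ} (h : EditsIn m x y) (p q : List ℕ) :
    EditsIn m (p ++ x ++ q) (p ++ y ++ q) := by
  induction h with
  | refl x => exact .refl _
  | step h _ ih => exact .step (h.append_context p q) ih

theorem EditsIn.trans {m m' : ℕ} {x y z : List ℕ} (h : EditsIn m x y) (h' : EditsIn m' y z) :
    EditsIn (m + m') x z := by
  induction h with
  | refl x => simpa using h'
  | step h _ ih => rw [Nat.add_right_comm]; exact .step h (ih h')

theorem EditsIn.editDist_le {m : ℕ} {x y : List ℕ} (h : EditsIn m x y) : editDist x y ≤ m :=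
  Nat.sInf_le h

theorem editsIn_editDist (x y : List ℕ) : EditsIn (editDist x y) x y :=
  Nat.sInf_mem (exists_editsIn x y)

theorem editsIn_flatten : ∀ {bs cs : List (List ℕ)}, bs.length = cs.length →
    EditsIn (List.zipWith editDist bs cs).sum bs.flatten cs.flatten
  | [], [], _ => .refl _
  | b :: bs, c :: cs, h => by
    have h1 := (editsIn_editDist b c).append_context [] bs.flatten
    have h2 := (editsIn_flatten (bs := bs) (cs := cs) (by simpa using h)).append_context c []
    simpa using h1.trans (by simpa using h2)

/-- `ApartBy ev m l l'`: the items of `l` can be changed into those of `l'`, position by position,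
at a total cost of `m`, where changing an item costs the length of an edit script between the
evaluations by `ev`, and only equal items are at cost `0`. -/
inductive ApartBy {α : Type*} (ev : α → List ℕ) : ℕ → List α → List α → Prop
  | nil : ApartBy ev 0 [] []
  | cons {c m : ℕ} {a b : α} {l l' : List α} : EditsIn c (ev a) (ev b) → (c = 0 → a = b) →
      ApartBy ev m l l' → ApartBy ev (c + m) (a :: l) (b :: l')

namespace ApartBy

variable {α : Type*} {ev : α → List ℕ} {m m' : ℕ} {l l' l'' : List α}

theorem refl (l : List α) : ApartBy ev 0 l l := by
  induction l with
  | nil => exact .nil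
  | cons a l ih => simpa using ApartBy.cons (.refl (ev a)) (fun _ => rfl) ih

theorem trans (h : ApartBy ev m l l') (h' : ApartBy ev m' l' l'') : ApartBy ev (m + m') l l'' := by
  induction h generalizing m' l'' with
  | nil => simpa using h'
  | cons he h0 _ ih =>
    cases h' with
    | cons he' h0' h' =>
      rw [Nat.add_add_add_comm]
      exact .cons (he.trans he') (fun h => (h0 (by lia)).trans (h0' (by lia))) (ih h')

theorem append_left (p : List α) (h : ApartBy ev m l l') : ApartBy ev m (p ++ l) (p ++ l') := by
  induction p with
  | nil => exact h
  | cons a p ih => simpa using ApartBy.cons (.refl (ev a)) (fun _ => rfl) ih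

theorem length_eq (h : ApartBy ev m l l') : l.length = l'.length := by
  induction h with
  | nil => rfl
  | cons _ _ _ ih => simp [ih]

theorem countP_le {β : Type*} [DecidableEq β] (f : α → β) (h : ApartBy ev m l l') :
    ((l.map f).zip (l'.map f)).countP (fun p => p.1 ≠ p.2) ≤ m := by
  induction h with
  | nil => simp
  | @cons c m a b l l' _ h0 _ ih =>
    simp only [List.map_cons, List.zip_cons_cons, List.countP_cons]
    rcases Nat.eq_zero_or_pos c with hc | hc
    · simpa [h0 hc, hc] using ih
    · split_ifs <;> lia

theorem sum_editDist_le (h : ApartBy ev m l l') :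
    (List.zipWith editDist (l.map ev) (l'.map ev)).sum ≤ m := by
  induction h with
  | nil => simp
  | cons he _ _ ih => simpa using Nat.add_le_add he.editDist_le ih

end ApartBy

/-! ### Chains of related list entries -/

namespace List

variable {α : Type*}

/-- The number of pairs of adjacent entries that are not related. -/
def cuts (R : α → α → Bool) : List α → ℕ
  | a :: b :: l => (if R a b then 0 else 1) + cuts R (b :: l)
  | _ => 0

theorem splitBy_cons_of_rel {R : α → α → Bool} {a b : α} {l g : List α} {gs : List (List α)}
    (h : R a b = true) (hl : (b :: l).splitBy R = g :: gs) :
    (a :: b :: l).splitBy R = (a :: g) :: gs := by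
  have hne : g ≠ [] := ne_nil_of_mem_splitBy (r := R) (l := b :: l) (hl ▸ mem_cons_self)
  have hflat : g ++ gs.flatten = b :: l := by simpa [hl] using flatten_splitBy R (b :: l)
  obtain ⟨c, g, rfl⟩ := exists_cons_of_ne_nil hne
  obtain rfl : c = b := by simpa using (List.cons.inj hflat).1
  have hch := isChain_getLast_head_splitBy R (c :: l)
  rw [hl] at hch
  rw [← hflat]
  change ((a :: c :: g) :: gs).flatten.splitBy R = _
  refine splitBy_flatten ?_ ?_ ?_
  · have := nil_notMem_splitBy R (c :: l)
    rw [hl] at this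
    simpa using this
  · intro m hm
    rcases mem_cons.1 hm with rfl | hm
    · exact isChain_cons_cons.2 ⟨h, isChain_of_mem_splitBy (l := c :: l) (hl ▸ mem_cons_self)⟩
    · exact isChain_of_mem_splitBy (l := c :: l) (hl ▸ mem_cons_of_mem _ hm)
  · rw [isChain_cons] at hch ⊢
    refine ⟨fun y hy => ?_, hch.2⟩
    obtain ⟨_, hb, hr⟩ := hch.1 y hy
    exact ⟨by simp, hb, by simpa using hr⟩

theorem splitBy_cons_of_not_rel {R : α → α → Bool} {a b : α} {l : List α} (h : R a b = false) :
    (a :: b :: l).splitBy R = [a] :: (b :: l).splitBy R := by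
  have := splitBy_append (r := R) (l := [a]) (m := b :: l)
    (by simpa using h)
  simpa [splitBy_of_isChain] using this

theorem length_splitBy (R : α → α → Bool) : ∀ {l : List α}, l ≠ [] →
    (l.splitBy R).length = l.cuts R + 1
  | [a], _ => by simp [splitBy_of_isChain, cuts]
  | a :: b :: l, _ => by
    have ih := length_splitBy R (l := b :: l) (by simp)
    cases h : R a b
    · simp [splitBy_cons_of_not_rel h, cuts, h, ih, add_comm]
    · obtain ⟨g, gs, hg⟩ := exists_cons_of_ne_nil (splitBy_ne_nil (r := R).2 (cons_ne_nil b l))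
      simpa [splitBy_cons_of_rel h hg, cuts, h, hg] using ih

theorem cuts_le_length (R : α → α → Bool) : ∀ l : List α, l.cuts R ≤ l.length - 1
  | [] => by simp [cuts]
  | [a] => by simp [cuts]
  | a :: b :: l => by
    have := cuts_le_length R (b :: l)
    simp only [cuts, length_cons] at this ⊢
    split_ifs <;> lia

theorem cuts_eq_zero_of_isChain {R : α → α → Bool} : ∀ {l : List α},
    l.IsChain (fun a b => R a b = true) → l.cuts R = 0
  | [], _ => rfl
  | [_], _ => rfl
  | a :: b :: l, h => by
    rw [isChain_cons_cons] at h
    simp [cuts, h.1, cuts_eq_zero_of_isChain h.2]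

theorem cuts_append_le (R : α → α → Bool) : ∀ l m : List α,
    (l ++ m).cuts R ≤ l.cuts R + 1 + m.cuts R
  | [], m => by simp [cuts]
  | [a], [] => by simp [cuts]
  | [a], b :: m => by
    simp only [cuts, singleton_append]
    split_ifs <;> lia
  | a :: b :: l, m => by
    have := cuts_append_le R (b :: l) m
    simp only [cuts, cons_append] at this ⊢
    lia

theorem cuts_add_cuts_le (R : α → α → Bool) : ∀ l m : List α,
    l.cuts R + m.cuts R ≤ (l ++ m).cuts R
  | [], m => by simp [cuts]
  | [a], [] => by simp [cuts]
  | [a], b :: m => by simp [cuts]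
  | a :: b :: l, m => by
    have := cuts_add_cuts_le R (b :: l) m
    simp only [cuts, cons_append] at this ⊢
    lia

theorem sum_cuts_le_cuts_flatten (R : α → α → Bool) (L : List (List α)) :
    (L.map (cuts R)).sum ≤ L.flatten.cuts R := by
  induction L with
  | nil => simp [cuts]
  | cons l L ih =>
    simp only [map_cons, sum_cons, flatten_cons]
    exact (Nat.add_le_add_left ih _).trans (cuts_add_cuts_le R _ _)

/-- A change of the middle part of a list affects only the chains that meet it. -/
theorem exists_splitBy_append (R : α → α → Bool) (U V : List α) :
    ∃ (P : List (List α)) (U' V' : List α) (Q : List (List α)),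
      U = P.flatten ++ U' ∧ V = V' ++ Q.flatten ∧
      U'.IsChain (fun a b => R a b = true) ∧ V'.IsChain (fun a b => R a b = true) ∧
      ∀ A, (U ++ A ++ V).splitBy R = P ++ (U' ++ A ++ V').splitBy R ++ Q := by
  have hleft : ∃ (P : List (List α)) (U' : List α), U = P.flatten ++ U' ∧
      U'.IsChain (fun a b => R a b = true) ∧
      ∀ A, (U ++ A).splitBy R = P ++ (U' ++ A).splitBy R := by
    rcases eq_nil_or_concat' (U.splitBy R) with h | ⟨P, U', h⟩
    · exact ⟨[], [], by simpa using h, isChain_nil, by simp [splitBy_eq_nil.1 h]⟩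
    · have hflat : P.flatten ++ U' = U := by simpa [h] using flatten_splitBy R U
      have hne := nil_notMem_splitBy R U
      have hch := isChain_getLast_head_splitBy R U
      have hmem : ∀ m ∈ P ++ [U'], m.IsChain fun a b => R a b = true := fun m hm =>
        isChain_of_mem_splitBy (h ▸ hm)
      rw [h] at hne hch
      have hU' : U' ≠ [] := fun h => hne (by simp [h])
      refine ⟨P, U', hflat.symm, hmem U' (by simp), fun A => ?_⟩
      have hP : P.flatten.splitBy R = P := splitBy_flatten (fun h => hne (by simp [h]))
        (fun m hm => hmem m (mem_append_left _ hm)) hch.left_of_append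
      rw [← hflat, append_assoc, splitBy_append, hP]
      intro x hx y hy
      obtain ⟨P', p, rfl⟩ := eq_nil_or_concat' P |>.resolve_left (by rintro rfl; simp at hx)
      obtain ⟨u, U'', rfl⟩ := exists_cons_of_ne_nil hU'
      have hp : p ≠ [] := fun h => hne (by simp [h])
      obtain rfl : u = y := by simpa using hy
      rw [append_assoc, isChain_append] at hch
      have h3 := hch.2.1
      simp only [cons_append, nil_append, isChain_cons_cons] at h3
      obtain ⟨_, _, h4⟩ := h3.1
      have h5 : (P' ++ [p]).flatten.getLast? = some (p.getLast hp) := by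
        simp [getLast?_append, getLast?_eq_getLast_of_ne_nil hp]
      rw [h5] at hx
      obtain rfl := Option.mem_some_iff.1 hx
      simpa using h4
  have hright : ∃ (V' : List α) (Q : List (List α)), V = V' ++ Q.flatten ∧
      V'.IsChain (fun a b => R a b = true) ∧
      ∀ A, (A ++ V).splitBy R = (A ++ V').splitBy R ++ Q := by
    rcases h : V.splitBy R with _ | ⟨V', Q⟩
    · exact ⟨[], [], by simpa using h, isChain_nil, by simp [splitBy_eq_nil.1 h]⟩
    · have hflat : V' ++ Q.flatten = V := by simpa [h] using flatten_splitBy R V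
      have hne := nil_notMem_splitBy R V
      have hch := isChain_getLast_head_splitBy R V
      have hmem : ∀ m ∈ V' :: Q, m.IsChain fun a b => R a b = true := fun m hm =>
        isChain_of_mem_splitBy (h ▸ hm)
      rw [h] at hne hch
      have hV' : V' ≠ [] := fun h => hne (by simp [h])
      refine ⟨V', Q, hflat.symm, hmem V' (by simp), fun A => ?_⟩
      have hQ : Q.flatten.splitBy R = Q := splitBy_flatten (fun h => hne (by simp [h]))
        (fun m hm => hmem m (mem_cons_of_mem _ hm)) hch.tail
      rw [← hflat, ← append_assoc, splitBy_append, hQ]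
      intro x hx y hy
      obtain ⟨q, Q', rfl⟩ := exists_cons_of_ne_nil (l := Q) (by rintro rfl; simp at hy)
      have hq : q ≠ [] := fun h => hne (by simp [h])
      obtain ⟨b, q', rfl⟩ := exists_cons_of_ne_nil hq
      obtain rfl : b = y := by simpa using hy
      rw [isChain_cons_cons] at hch
      obtain ⟨_, _, h4⟩ := hch.1
      have h5 : (A ++ V').getLast? = some (V'.getLast hV') := by
        simp [getLast?_append, getLast?_eq_getLast_of_ne_nil hV']
      rw [h5] at hx
      obtain rfl := Option.mem_some_iff.1 hx
      simpa using h4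
  obtain ⟨P, U', h1, h2, h3⟩ := hleft
  obtain ⟨V', Q, h4, h5, h6⟩ := hright
  refine ⟨P, U', V', Q, h1, h4, h2, h5, fun A => ?_⟩
  rw [h6, append_assoc U, h3]
  simp

theorem length_splitBy_append_le {R : α → α → Bool} {U V : List α}
    (hU : U.IsChain fun a b => R a b = true) (hV : V.IsChain fun a b => R a b = true) {A : List α}
    (hA : A ≠ []) : ((U ++ A ++ V).splitBy R).length ≤ A.length + 2 := by
  rw [length_splitBy R (by simp [hA])]
  have h1 := cuts_append_le R (U ++ A) V
  have h2 := cuts_append_le R U A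
  have h3 := cuts_le_length R A
  have h4 := length_pos_of_ne_nil hA
  rw [cuts_eq_zero_of_isChain hU] at h2
  rw [cuts_eq_zero_of_isChain hV] at h1
  lia

end List


/-! ### The decomposition -/

/-- A node of the derivation forest that the parsing rounds build above a string. -/
structure Node where
  /-- the nonterminal of the node -/
  name : ℕ
  /-- the string below the node; it serves the analysis only and is never computed -/
  exp : List ℕ
  /-- the rule that expands the nonterminal -/
  rule : Rule
  /-- the rules of all nodes strictly below -/
  sub : List Rule

/-- The node above a single letter `c`, whose name is `v = c + 1`.  The name `0` belongs to a
sentinel, which evaluates to the empty string: it keeps the first block nonempty even above the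
empty string. -/
def leafNode (v : ℕ) : Node where
  name := v
  exp := if v = 0 then [] else [v - 1]
  rule := ⟨some v, .power (.terminal (v - 1)) (if v = 0 then 0 else 1)⟩
  sub := []

/-- The leaves above a string: a sentinel, and one leaf for every letter. -/
def leaves (x : List ℕ) : List Node := leafNode 0 :: x.map fun c => leafNode (c + 1)

/-- The name of the first node of a group. -/
def firstName (g : List Node) : ℕ := (g.map Node.name).headD 0

/-- The name of the last node of a group. -/
def lastName (g : List Node) : ℕ := (g.map Node.name).getLastD 0

/-- The right-hand side for a group of `r` nodes whose first and last names are `a` and `b`. -/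
def groupRhs (a b r : ℕ) : Rhs :=
  if a = b then .power (.nonterminal a) r else .pair (.nonterminal a) (.nonterminal b)

/-- The first name, the last name and the length of a group, coded by a single number. -/
def groupKey (h : ℕ) (g : List Node) : ℕ :=
  firstName g + 2 ^ h * (lastName g + 2 ^ h * g.length)

/-- The rules at and below the nodes of a list. -/
def allRules (g : List Node) : List Rule := g.flatMap fun c => c.rule :: c.sub

/-- The string below a list of nodes. -/
def expand (g : List Node) : List ℕ := g.flatMap Node.exp

/-- The node above a group of nodes.  Its name is a hash value of the group that depends only on the
names in it, so that equal groups get equal names wherever they occur, also in different strings. -/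
def parentNode {h : ℕ} (T : ℕ → ZMod (2 ^ h)) (t : ℕ) (g : List Node) : Node where
  name := (linHash T t (3 * h) (groupKey h g)).val
  exp := expand g
  rule := ⟨some (linHash T t (3 * h) (groupKey h g)).val,
    groupRhs (firstName g) (lastName g) g.length⟩
  sub := allRules g

/-- The rule for joining adjacent nodes to groups: rounds of even number join equal names, and those
of odd number join an even name with a following odd name, so that groups have at most two nodes. -/
def joins (j : ℕ) (n n' : Node) : Bool :=
  if j % 2 = 0 then n.name = n'.name else n.name % 2 = 0 ∧ n'.name % 2 = 1

/-- The number of random words for one level: `3 h + 1` for the names, and `K` rows of `h + 1` words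
for the splitting test. -/
def chunk (h K : ℕ) : ℕ := 3 * h + 1 + K * (h + 1)

/-- Start a new block before every splitting name.  Blocks are never joined again. -/
def splitBlocks {h : ℕ} (K θ : ℕ) (T : ℕ → ZMod (2 ^ h)) (t : ℕ) (bs : List (List Node)) :
    List (List Node) :=
  bs.flatMap fun b => b.splitBy fun _ n => !isSplit K θ T t n.name

/-- Replace every block by the list of the parents of its groups. -/
def groupBlocks {h : ℕ} (T : ℕ → ZMod (2 ^ h)) (t j : ℕ) (bs : List (List Node)) :
    List (List Node) :=
  bs.map fun b => (b.splitBy (joins j)).map (parentNode T t)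

/-- The blocks of nodes at level `j`, before the splitting at this level. -/
def level {h : ℕ} (K θ : ℕ) (T : ℕ → ZMod (2 ^ h)) (x : List ℕ) : ℕ → List (List Node)
  | 0 => [leaves x]
  | j + 1 => groupBlocks T ((j + 1) * chunk h K) j
      (splitBlocks K θ T (j * chunk h K + (3 * h + 1)) (level K θ T x j))

/-- The blocks of nodes at level `j`, after the splitting at this level. -/
def splitLevel {h : ℕ} (K θ : ℕ) (T : ℕ → ZMod (2 ^ h)) (x : List ℕ) (j : ℕ) : List (List Node) :=
  splitBlocks K θ T (j * chunk h K + (3 * h + 1)) (level K θ T x j)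

/-- The grammar of a node. -/
def nodeGrammar (n : Node) : Grammar :=
  (⟨none, .power (.nonterminal n.name) 1⟩ :: n.rule :: n.sub).toFinset

section Basic

variable {h K θ : ℕ} {T T' : ℕ → ZMod (2 ^ h)} {x : List ℕ} {j : ℕ}

theorem level_succ : level K θ T x (j + 1) =
    groupBlocks T ((j + 1) * chunk h K) j (splitLevel K θ T x j) := rfl

theorem flatten_splitBlocks (t : ℕ) (bs : List (List Node)) :
    (splitBlocks K θ T t bs).flatten = bs.flatten := by
  induction bs with
  | nil => rfl
  | cons b bs ih =>
    simp only [splitBlocks, List.flatMap_cons, List.flatten_append, List.flatten_cons,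
      List.flatten_splitBy] at ih ⊢
    rw [ih]

theorem flatten_splitLevel : (splitLevel K θ T x j).flatten = (level K θ T x j).flatten :=
  flatten_splitBlocks _ _

theorem nil_notMem_splitBlocks (t : ℕ) (bs : List (List Node)) : [] ∉ splitBlocks K θ T t bs := by
  simp [splitBlocks]

theorem nil_notMem_level : ∀ j, [] ∉ level K θ T x j
  | 0 => by simp [level, leaves]
  | j + 1 => by
    simp only [level_succ, groupBlocks, List.mem_map, List.map_eq_nil_iff, List.splitBy_eq_nil,
      exists_eq_right]
    exact nil_notMem_splitBlocks _ _

theorem parentNode_congr {t : ℕ} (g : List Node) (hT : ∀ i, t ≤ i → i ≤ t + 3 * h → T i = T' i) :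
    parentNode T t g = parentNode T' t g := by
  simp only [parentNode, linHash_congr (groupKey h g) hT]

theorem groupBlocks_congr {t : ℕ} (bs : List (List Node))
    (hT : ∀ i, t ≤ i → i ≤ t + 3 * h → T i = T' i) :
    groupBlocks T t j bs = groupBlocks T' t j bs := by
  simp only [groupBlocks, funext fun g => parentNode_congr g hT]

theorem splitBlocks_congr {t : ℕ} (bs : List (List Node))
    (hT : ∀ i, t ≤ i → i < t + K * (h + 1) → T i = T' i) :
    splitBlocks K θ T t bs = splitBlocks K θ T' t bs := by
  simp only [splitBlocks, isSplit_congr _ hT]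

theorem chunk_mono {i j : ℕ} (hij : i ≤ j) : i * chunk h K ≤ j * chunk h K :=
  Nat.mul_le_mul_right _ hij

theorem level_congr : ∀ {j : ℕ}, (∀ i, i < j * chunk h K + (3 * h + 1) → T i = T' i) →
    level K θ T x j = level K θ T' x j
  | 0, _ => rfl
  | j + 1, hT => by
    have hc : (j + 1) * chunk h K = j * chunk h K + (3 * h + 1) + K * (h + 1) := by
      rw [Nat.succ_mul, chunk]; lia
    rw [level, level, level_congr (j := j) fun i hi => hT i (by lia),
      splitBlocks_congr _ fun i _ hi => hT i (by lia), groupBlocks_congr _ fun i _ hi => hT i (by lia)]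

theorem splitLevel_congr (hT : ∀ i, i < (j + 1) * chunk h K → T i = T' i) :
    splitLevel K θ T x j = splitLevel K θ T' x j := by
  have hc : (j + 1) * chunk h K = j * chunk h K + (3 * h + 1) + K * (h + 1) := by
    rw [Nat.succ_mul, chunk]; lia
  rw [splitLevel, splitLevel, level_congr fun i hi => hT i (by lia),
    splitBlocks_congr _ fun i _ hi => hT i (by lia)]

end Basic

/-! ### Evaluation of the grammars -/

section Evaluation

variable {h K θ : ℕ} {T : ℕ → ZMod (2 ^ h)} {x : List ℕ} {j : ℕ}

theorem expand_append (g g' : List Node) : expand (g ++ g') = expand g ++ expand g' :=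
  List.flatMap_append

theorem expand_flatten (L : List (List Node)) : expand L.flatten = (L.map expand).flatten := by
  induction L with
  | nil => rfl
  | cons l L ih => simp [expand_append, ih]

theorem expand_map_parentNode (t : ℕ) (L : List (List Node)) :
    expand (L.map (parentNode T t)) = expand L.flatten := by
  induction L with
  | nil => rfl
  | cons l L ih =>
    rw [List.flatten_cons, expand_append, ← ih]
    rfl

theorem expand_leaves (x : List ℕ) : expand (leaves x) = x := by
  have : ∀ x : List ℕ, expand (x.map fun c => leafNode (c + 1)) = x := fun x => by
    induction x with
    | nil => rfl
    | cons c x ih => simpa [expand, leafNode] using ih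
  change expand ([leafNode 0] ++ _) = x
  rw [expand_append, this]
  rfl

theorem expand_groupBlocks (t : ℕ) (bs : List (List Node)) :
    expand (groupBlocks T t j bs).flatten = expand bs.flatten := by
  induction bs with
  | nil => rfl
  | cons b bs ih =>
    simp only [groupBlocks, List.map_cons, List.flatten_cons, expand_append, expand_map_parentNode,
      List.flatten_splitBy] at ih ⊢
    rw [ih]

theorem expand_level : ∀ j, expand (level K θ T x j).flatten = x
  | 0 => by simpa [level] using expand_leaves x
  | j + 1 => by rw [level_succ, expand_groupBlocks, flatten_splitLevel, expand_level j]

/-- The nodes at level `j + 1` are the parents of the groups at level `j`. -/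
theorem mem_level_succ {n : Node} (hn : n ∈ (level K θ T x (j + 1)).flatten) :
    ∃ b ∈ splitLevel K θ T x j, ∃ g ∈ b.splitBy (joins j),
      n = parentNode T ((j + 1) * chunk h K) g := by
  simp only [level_succ, groupBlocks, List.mem_flatten, List.mem_map] at hn
  obtain ⟨_, ⟨b, hb, rfl⟩, hn⟩ := hn
  obtain ⟨g, hg, rfl⟩ := List.mem_map.1 hn
  exact ⟨b, hb, g, hg, rfl⟩

theorem mem_level_of_mem_group {b g : List Node} (hb : b ∈ splitLevel K θ T x j)
    (hg : g ∈ b.splitBy (joins j)) {c : Node} (hc : c ∈ g) : c ∈ (level K θ T x j).flatten := by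
  rw [← flatten_splitLevel]
  refine List.mem_flatten.2 ⟨b, hb, ?_⟩
  rw [← List.flatten_splitBy (joins j) b]
  exact List.mem_flatten.2 ⟨g, hg, hc⟩

theorem toList_groupRhs {g : List Node} (hg : g ≠ [])
    (hch : g.IsChain fun a b => joins j a b = true) :
    (groupRhs (firstName g) (lastName g) g.length).toList =
      g.map fun n => Symbol.nonterminal (some n.name) := by
  obtain ⟨a, g, rfl⟩ := List.exists_cons_of_ne_nil hg
  rcases Nat.mod_two_eq_zero_or_one j with hj | hj
  · -- In a round of even number all names of a group are equal.
    have hall : ∀ n ∈ g, n.name = a.name := by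
      clear hg
      induction g generalizing a with
      | nil => simp
      | cons b g ih =>
        rw [List.isChain_cons_cons] at hch
        have hab : a.name = b.name := by simpa [joins, hj] using hch.1
        intro n hn
        rcases List.mem_cons.1 hn with rfl | hn
        · exact hab.symm
        · rw [hab]
          exact ih b hch.2 n hn
    have hmap : g.map (fun n => n.name) = List.replicate g.length a.name :=
      List.eq_replicate_iff.2 ⟨by simp, by simpa using hall⟩
    have hlast : lastName (a :: g) = a.name := by
      have h2 : (a :: g).map Node.name = List.replicate (g.length + 1) a.name := by
        simpa [List.replicate_succ] using hmap
      rw [lastName, h2]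
      simp [List.getLastD_eq_getLast?, List.getLast?_replicate]
    have hfirst : firstName (a :: g) = a.name := rfl
    rw [hlast, hfirst, groupRhs, if_pos rfl]
    symm
    simp only [Rhs.toList, liftSymbol]
    rw [List.eq_replicate_iff]
    refine ⟨by simp, ?_⟩
    simp only [List.map_cons, List.mem_cons, List.mem_map]
    rintro _ (rfl | ⟨n, hn, rfl⟩)
    · rfl
    · rw [hall n hn]
  · -- In a round of odd number a group is a single node, or two nodes of different parity.
    rcases g with _ | ⟨b, g⟩
    · simp [firstName, lastName, groupRhs, Rhs.toList, liftSymbol]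
    · rw [List.isChain_cons_cons] at hch
      have hab : a.name % 2 = 0 ∧ b.name % 2 = 1 := by simpa [joins, hj] using hch.1
      rcases g with _ | ⟨c, g⟩
      · have hne : a.name ≠ b.name := fun h => by rw [h] at hab; lia
        simp [firstName, lastName, groupRhs, Rhs.toList, liftSymbol, hne]
      · have hbc : b.name % 2 = 0 ∧ c.name % 2 = 1 := by
          simpa [joins, hj] using (List.isChain_cons_cons.1 hch.2).1
        lia

theorem derives_of_mem_rules {G : Grammar} {ρ : Rule} (hρ : ρ ∈ G) :
    G.toCFG.Derives [.nonterminal ρ.lhs] ρ.rhs.toList := by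
  refine ContextFreeGrammar.Produces.single ⟨⟨ρ.lhs, ρ.rhs.toList⟩, ?_, ?_⟩
  · unfold Grammar.toCFG
    exact Finset.mem_image_of_mem (fun ρ : Rule => ContextFreeRule.mk ρ.lhs ρ.rhs.toList) hρ
  · exact ContextFreeRule.Rewrites.input_output

theorem derives_expand {G : Grammar} (g : List Node)
    (hg : ∀ c ∈ g, G.toCFG.Derives [.nonterminal (some c.name)] (c.exp.map .terminal)) :
    G.toCFG.Derives (g.map fun n => .nonterminal (some n.name)) ((expand g).map .terminal) := by
  induction g with
  | nil => exact .refl _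
  | cons c g ih =>
    have h1 := hg c (by simp)
    have h2 := ih fun c hc => hg c (by simp [hc])
    have h3 := (h1.append_right (g.map fun n => .nonterminal (some n.name))).trans
      (h2.append_left (c.exp.map .terminal))
    simpa [expand] using h3

/-- If a grammar contains the rules at and below a node, then the name of the node derives the
string below it. -/
theorem derives_node {G : Grammar} : ∀ (j : ℕ) (n : Node), n ∈ (level K θ T x j).flatten →
    (∀ ρ ∈ n.rule :: n.sub, ρ ∈ G) →
    G.toCFG.Derives [.nonterminal (some n.name)] (n.exp.map .terminal)
  | 0, n, hn, hG => by
    obtain ⟨v, rfl⟩ : ∃ v, n = leafNode v := by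
      simp only [level, List.flatten_singleton, leaves, List.mem_cons, List.mem_map] at hn
      rcases hn with rfl | ⟨c, _, rfl⟩
      · exact ⟨0, rfl⟩
      · exact ⟨c + 1, rfl⟩
    have h1 := derives_of_mem_rules (hG _ List.mem_cons_self)
    have h2 : (leafNode v).rule.rhs.toList = (leafNode v).exp.map .terminal := by
      by_cases hv : v = 0 <;> simp [leafNode, Rhs.toList, liftSymbol, hv]
    rw [h2] at h1
    exact h1
  | j + 1, n, hn, hG => by
    obtain ⟨b, hb, g, hg, rfl⟩ := mem_level_succ hn
    have h1 := derives_of_mem_rules (hG _ List.mem_cons_self)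
    simp only [parentNode] at h1
    rw [toList_groupRhs (List.ne_nil_of_mem_splitBy hg) (List.isChain_of_mem_splitBy hg)] at h1
    refine h1.trans (derives_expand g fun c hc => derives_node j c
      (mem_level_of_mem_group hb hg hc) fun ρ hρ => hG ρ ?_)
    exact List.mem_cons_of_mem _ (List.mem_flatMap.2 ⟨c, hc, hρ⟩)

/-- A name that is used at level `j` has the same rule at all its occurrences at the levels up to
`j`. -/
def FreshNames (K θ : ℕ) (T : ℕ → ZMod (2 ^ h)) (x : List ℕ) (j : ℕ) : Prop :=
  ∀ n ∈ (level K θ T x j).flatten, ∀ i ≤ j, ∀ n' ∈ (level K θ T x i).flatten,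
    n.name = n'.name → n.rule = n'.rule

theorem freshNames_zero : FreshNames K θ T x 0 := by
  intro n hn i hi n' hn' hname
  obtain rfl : i = 0 := by lia
  have key : ∀ n ∈ (level K θ T x 0).flatten, n = leafNode n.name := fun n hn => by
    simp only [level, List.flatten_singleton, leaves, List.mem_cons, List.mem_map] at hn
    rcases hn with rfl | ⟨c, _, rfl⟩ <;> rfl
  rw [key n hn, key n' hn', hname]

theorem rule_lhs : ∀ {j : ℕ} {n : Node}, n ∈ (level K θ T x j).flatten → n.rule.lhs = some n.name
  | 0, n, hn => by
    simp only [level, List.flatten_singleton, leaves, List.mem_cons, List.mem_map] at hn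
    rcases hn with rfl | ⟨c, _, rfl⟩ <;> rfl
  | j + 1, n, hn => by
    obtain ⟨b, hb, g, hg, rfl⟩ := mem_level_succ hn
    rfl

/-- The rules below a node are the rules of nodes at lower levels. -/
theorem exists_node_of_mem_sub : ∀ {j : ℕ} {n : Node}, n ∈ (level K θ T x j).flatten →
    ∀ ρ ∈ n.sub, ∃ i < j, ∃ n' ∈ (level K θ T x i).flatten, ρ = n'.rule
  | 0, n, hn, ρ, hρ => by
    simp only [level, List.flatten_singleton, leaves, List.mem_cons, List.mem_map] at hn
    rcases hn with rfl | ⟨c, _, rfl⟩ <;> simp [leafNode] at hρ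
  | j + 1, n, hn, ρ, hρ => by
    obtain ⟨b, hb, g, hg, rfl⟩ := mem_level_succ hn
    obtain ⟨c, hc, hρ⟩ := List.mem_flatMap.1 hρ
    have hcl := mem_level_of_mem_group hb hg hc
    rcases List.mem_cons.1 hρ with rfl | hρ
    · exact ⟨j, by lia, c, hcl, rfl⟩
    · obtain ⟨i, hi, n', hn', h⟩ := exists_node_of_mem_sub hcl ρ hρ
      exact ⟨i, by lia, n', hn', h⟩

/-- Fresh names make the grammar of a node deterministic, and the rules below the node derive the
string below it. -/
theorem evaluates_nodeGrammar (hfresh : ∀ i ≤ j, FreshNames K θ T x i) {n : Node}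
    (hn : n ∈ (level K θ T x j).flatten) : (nodeGrammar n).Evaluates n.exp := by
  constructor
  · have key : ∀ ρ ∈ nodeGrammar n, ρ = ⟨none, .power (.nonterminal n.name) 1⟩ ∨
        ∃ i ≤ j, ∃ n' ∈ (level K θ T x i).flatten, ρ = n'.rule := by
      intro ρ hρ
      simp only [nodeGrammar, List.mem_toFinset, List.mem_cons] at hρ
      rcases hρ with rfl | rfl | hρ
      · exact .inl rfl
      · exact .inr ⟨j, le_rfl, n, hn, rfl⟩
      · obtain ⟨i, hi, n', hn', h⟩ := exists_node_of_mem_sub hn ρ hρ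
        exact .inr ⟨i, hi.le, n', hn', h⟩
    intro ρ hρ ρ' hρ' hl
    rcases key ρ hρ with rfl | ⟨i, hi, m, hm, rfl⟩ <;> rcases key ρ' hρ' with rfl | ⟨i', hi', m', hm', rfl⟩
    · rfl
    · rw [rule_lhs hm'] at hl; simp at hl
    · rw [rule_lhs hm] at hl; simp at hl
    · rw [rule_lhs hm, rule_lhs hm'] at hl
      have hname := Option.some.inj hl
      rcases le_total i i' with h | h
      · exact (hfresh i' hi' m' hm' i h m hm hname.symm).symm
      · exact hfresh i hi m hm i' h m' hm' hname
  · rw [ContextFreeGrammar.mem_language_iff]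
    have h1 : (nodeGrammar n).toCFG.Derives [.nonterminal none] [.nonterminal (some n.name)] :=
      derives_of_mem_rules (G := nodeGrammar n) (ρ := ⟨none, .power (.nonterminal n.name) 1⟩)
        (by simp [nodeGrammar])
    exact h1.trans (derives_node j n hn fun ρ hρ => by
      simp only [nodeGrammar, List.mem_toFinset]
      exact List.mem_cons_of_mem _ hρ)

/-- When names determine rules, the grammars evaluate to the strings below the nodes, whatever the
blocks are. -/
theorem evaluateTo_map_nodeGrammar (hfresh : ∀ i ≤ j, FreshNames K θ T x i) :
    List.Forall₂ Grammar.Evaluates ((level K θ T x j).flatten.map nodeGrammar)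
      ((level K θ T x j).flatten.map Node.exp) := by
  rw [List.forall₂_map_left_iff, List.forall₂_map_right_iff, List.forall₂_same]
  exact fun n hn => evaluates_nodeGrammar hfresh hn

end Evaluation


/-! ### Sizes of the grammars -/

section Size

variable {h K θ : ℕ} {T : ℕ → ZMod (2 ^ h)} {x : List ℕ} {j : ℕ}

/-- The set of names in a list of nodes. -/
def nameSet (b : List Node) : Finset ℕ := (b.map Node.name).toFinset

/-- All blocks at level `j` have at most `D` different names. -/
def FewNames (K θ D : ℕ) (T : ℕ → ZMod (2 ^ h)) (x : List ℕ) (j : ℕ) : Prop :=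
  ∀ b ∈ splitLevel K θ T x j, (nameSet b).card ≤ D

theorem mem_level_of_mem_splitLevel {b : List Node} (hb : b ∈ splitLevel K θ T x j) :
    ∃ b₀ ∈ level K θ T x j, b <:+: b₀ := by
  simp only [splitLevel, splitBlocks, List.mem_flatMap] at hb
  obtain ⟨b₀, hb₀, hb⟩ := hb
  refine ⟨b₀, hb₀, ?_⟩
  have h2 := List.infix_of_mem_flatten hb
  rwa [List.flatten_splitBy] at h2

theorem card_rules_le (hfresh : FreshNames K θ T x j) {b : List Node}
    (hb : ∀ c ∈ b, c ∈ (level K θ T x j).flatten) :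
    (b.map Node.rule).toFinset.card ≤ (nameSet b).card := by
  refine Finset.card_le_card_of_injOn (fun ρ => ρ.lhs.getD 0) ?_ ?_
  · intro ρ hρ
    obtain ⟨c, hc, rfl⟩ : ∃ c ∈ b, c.rule = ρ := by simpa using hρ
    have : c.rule.lhs.getD 0 = c.name := by rw [rule_lhs (hb c hc)]; rfl
    simpa [nameSet, this] using ⟨c, hc, rfl⟩
  · intro ρ hρ ρ' hρ' heq
    obtain ⟨c, hc, rfl⟩ : ∃ c ∈ b, c.rule = ρ := by simpa using hρ
    obtain ⟨c', hc', rfl⟩ : ∃ c ∈ b, c.rule = ρ' := by simpa using hρ'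
    refine hfresh c (hb c hc) j le_rfl c' (hb c' hc') ?_
    simpa [rule_lhs (hb c hc), rule_lhs (hb c' hc')] using heq

/-- Let names determine rules and let the blocks of the levels below have at most `D` names each.
The groups of a block lie in a single block of the level below, so that every level contributes at
most `D` rules below a block. -/
theorem card_sub_le {D : ℕ} : ∀ {j : ℕ}, (∀ i < j, FreshNames K θ T x i) →
    (∀ i < j, FewNames K θ D T x i) → ∀ b ∈ level K θ T x j,
    (b.flatMap Node.sub).toFinset.card ≤ j * D
  | 0, _, _, b, hb => by
    obtain rfl : b = leaves x := by simpa [level] using hb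
    have : (leaves x).flatMap Node.sub = [] := by
      simp [leaves, leafNode, List.flatMap_map]
    simp [this]
  | j + 1, hfresh, hfew, b, hb => by
    rw [level_succ, groupBlocks, List.mem_map] at hb
    obtain ⟨b₁, hb₁, rfl⟩ := hb
    obtain ⟨b₀, hb₀, hsub⟩ := mem_level_of_mem_splitLevel hb₁
    have ih := card_sub_le (fun i hi => hfresh i (by lia)) (fun i hi => hfew i (by lia)) b₀ hb₀
    have hrules := (card_rules_le (hfresh j (by lia)) fun c hc =>
      List.mem_flatten.2 ⟨b₀, hb₀, hsub.subset hc⟩).trans (hfew j (by lia) b₁ hb₁)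
    refine (Finset.card_le_card (t := (b₁.map Node.rule).toFinset ∪
      (b₀.flatMap Node.sub).toFinset) ?_).trans ?_
    · intro ρ hρ
      simp only [List.mem_toFinset, List.mem_flatMap, List.mem_map] at hρ
      obtain ⟨_, ⟨g, hg, rfl⟩, hρ⟩ := hρ
      obtain ⟨c, hc, hρ⟩ := List.mem_flatMap.1 hρ
      have hcb : c ∈ b₁ := by
        rw [← List.flatten_splitBy (joins j) b₁]
        exact List.mem_flatten.2 ⟨g, hg, hc⟩
      rw [Finset.mem_union, List.mem_toFinset, List.mem_toFinset]
      rcases List.mem_cons.1 hρ with rfl | hρ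
      · exact .inl (List.mem_map_of_mem hcb)
      · exact .inr (List.mem_flatMap.2 ⟨c, hsub.subset hcb, hρ⟩)
    · refine (Finset.card_union_le _ _).trans ?_
      rw [Nat.succ_mul]
      lia

theorem card_nodeGrammar_le {D : ℕ} (hfresh : ∀ i < j, FreshNames K θ T x i)
    (hfew : ∀ i < j, FewNames K θ D T x i) {n : Node} (hn : n ∈ (level K θ T x j).flatten) :
    (nodeGrammar n).card ≤ j * D + 2 := by
  obtain ⟨b, hb, hn⟩ := List.mem_flatten.1 hn
  have h1 := card_sub_le hfresh hfew b hb
  have h2 : n.sub.toFinset ⊆ (b.flatMap Node.sub).toFinset := by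
    intro ρ hρ
    rw [List.mem_toFinset] at hρ ⊢
    exact List.mem_flatMap.2 ⟨n, hn, hρ⟩
  have h3 := Finset.card_le_card h2
  rw [nodeGrammar, List.toFinset_cons, List.toFinset_cons]
  have h4 := Finset.card_insert_le n.rule n.sub.toFinset
  have h5 := Finset.card_insert_le (⟨none, .power (.nonterminal n.name) 1⟩ : Rule)
    (insert n.rule n.sub.toFinset)
  lia

end Size

/-! ### The effect of a single edit -/

section Alignment

variable {h K θ : ℕ} {T : ℕ → ZMod (2 ^ h)}

/-- Two sequences of blocks agree except for nonempty parts `A` and `B` of one block, with at most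
`c` nodes each, below which the strings differ by one edit operation. -/
def OneEdit (c : ℕ) (X Y : List (List Node)) (A B : List Node) : Prop :=
  A ≠ [] ∧ B ≠ [] ∧ A.length ≤ c ∧ B.length ≤ c ∧ EditOp (expand A) (expand B) ∧
  ∃ P U V Q, X = P ++ (U ++ A ++ V) :: Q ∧ Y = P ++ (U ++ B ++ V) :: Q

theorem exists_oneEdit_leaves {x y : List ℕ} (hxy : EditOp x y) :
    ∃ A B, OneEdit 2 [leaves x] [leaves y] A B := by
  have key : ∀ u v a b : List ℕ, a.length ≤ 1 → b.length ≤ 1 → EditOp a b →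
      ∃ A B, OneEdit 2 [leaves (u ++ a ++ v)] [leaves (u ++ b ++ v)] A B := by
    intro u v a b ha hb hab
    have hne : leaves u ≠ [] := by simp [leaves]
    obtain ⟨U, s, hU⟩ : ∃ U s, leaves u = U ++ [s] :=
      (List.eq_nil_or_concat' (leaves u)).resolve_left hne
    let f := fun c : ℕ => leafNode (c + 1)
    have hexp : ∀ a : List ℕ, expand (a.map f) = a := fun a => by
      have h1 : expand ([leafNode 0] ++ a.map f) = a := expand_leaves a
      rwa [expand_append] at h1
    have hl : ∀ a, leaves (u ++ a ++ v) = U ++ (s :: a.map f) ++ v.map f := fun a => by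
      have : leaves (u ++ a ++ v) = leaves u ++ a.map f ++ v.map f := by simp [leaves, f]
      rw [this, hU]
      simp
    refine ⟨s :: a.map f, s :: b.map f, by simp, by simp, by simpa using ha, by simpa using hb, ?_,
      [], U, v.map f, [], by rw [hl]; rfl, by rw [hl]; rfl⟩
    have h1 : ∀ a : List ℕ, expand (s :: a.map f) = s.exp ++ a ++ [] := fun a => by
      rw [List.append_nil]
      conv_rhs => rw [← hexp a]
      rfl
    rw [h1, h1]
    exact hab.append_context _ _
  cases hxy with
  | insertion u v c => simpa using key u v [] [c] (by simp) (by simp) (.insertion [] [] c)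
  | deletion u v c => simpa using key u v [c] [] (by simp) (by simp) (.deletion [] [] c)
  | substitution u v c d =>
    simpa using key u v [c] [d] (by simp) (by simp) (.substitution [] [] c d)

theorem splitBlocks_append (t : ℕ) (P Q : List (List Node)) : splitBlocks K θ T t (P ++ Q) =
    splitBlocks K θ T t P ++ splitBlocks K θ T t Q := List.flatMap_append

theorem groupBlocks_append (t j : ℕ) (P Q : List (List Node)) : groupBlocks T t j (P ++ Q) =
    groupBlocks T t j P ++ groupBlocks T t j Q := List.map_append

/-- If there is no splitting name in the edited part, the edited block is split in the same way on
both sides. -/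
theorem OneEdit.splitBlocks {c t : ℕ} {X Y : List (List Node)} {A B : List Node}
    (hXY : OneEdit c X Y A B) (hA : ∀ n ∈ A ++ B, isSplit K θ T t n.name = false) :
    OneEdit c (splitBlocks K θ T t X) (splitBlocks K θ T t Y) A B := by
  obtain ⟨hA0, hB0, hAc, hBc, hE, P, U, V, Q, rfl, rfl⟩ := hXY
  refine ⟨hA0, hB0, hAc, hBc, hE, ?_⟩
  set R : Node → Node → Bool := fun _ n => !isSplit K θ T t n.name with hR
  obtain ⟨P', U', V', Q', -, -, hU', hV', hsplit⟩ := List.exists_splitBy_append R U V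
  have hb : ∀ b : List Node, _root_.splitBlocks K θ T t (P ++ b :: Q) =
      _root_.splitBlocks K θ T t P ++ (b.splitBy R ++ _root_.splitBlocks K θ T t Q) := fun b => by
    rw [splitBlocks_append]
    rfl
  have hUA : ∀ A : List Node, (∀ n ∈ A, isSplit K θ T t n.name = false) →
      (U' ++ A).IsChain fun a b => R a b = true := by
    intro A hA
    refine List.isChain_append.2 ⟨hU', ?_, fun a _ b hb => ?_⟩
    · exact List.Pairwise.isChain (List.pairwise_iff_forall_sublist.2 fun {a b} hab => by
        simp [hR, hA b (hab.subset (by simp))])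
    · simp [hR, hA b (List.mem_of_mem_head? hb)]
  rw [hb, hb, hsplit, hsplit]
  have hA1 : ∀ n ∈ A, isSplit K θ T t n.name = false := fun n hn => hA n (by simp [hn])
  have hB1 : ∀ n ∈ B, isSplit K θ T t n.name = false := fun n hn => hA n (by simp [hn])
  -- A block starts at the edited part or before it; it ends with the edited part exactly if the
  -- next name is a splitting name.
  rcases V' with _ | ⟨v, V'⟩
  · have h1 : ∀ A : List Node, A ≠ [] → (∀ n ∈ A, isSplit K θ T t n.name = false) →
        (U' ++ A ++ []).splitBy R = [U' ++ A ++ []] := fun A h0 hA =>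
      List.splitBy_of_isChain (by simp [h0]) (by simpa using hUA A hA)
    exact ⟨_root_.splitBlocks K θ T t P ++ P', U', [], Q' ++ _root_.splitBlocks K θ T t Q,
      by rw [h1 A hA0 hA1]; simp, by rw [h1 B hB0 hB1]; simp⟩
  · cases hv : isSplit K θ T t v.name
    · have h1 : ∀ A : List Node, A ≠ [] → (∀ n ∈ A, isSplit K θ T t n.name = false) →
          (U' ++ A ++ v :: V').splitBy R = [U' ++ A ++ v :: V'] := fun A h0 hA =>
        List.splitBy_of_isChain (by simp) (List.isChain_append.2
          ⟨hUA A hA, hV', fun a _ b hb => by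
            obtain rfl : v = b := by simpa using hb
            simp [hR, hv]⟩)
      exact ⟨_root_.splitBlocks K θ T t P ++ P', U', v :: V', Q' ++ _root_.splitBlocks K θ T t Q,
        by rw [h1 A hA0 hA1]; simp, by rw [h1 B hB0 hB1]; simp⟩
    · have h1 : ∀ A : List Node, A ≠ [] → (∀ n ∈ A, isSplit K θ T t n.name = false) →
          (U' ++ A ++ v :: V').splitBy R = [U' ++ A ++ [], v :: V'] := fun A h0 hA => by
        rw [List.splitBy_append_cons _ fun a _ => by simp [hR, hv],
          List.splitBy_of_isChain (by simp [h0]) (hUA A hA), List.splitBy_of_isChain (by simp) hV']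
        simp
      exact ⟨_root_.splitBlocks K θ T t P ++ P', U', [],
        (v :: V') :: (Q' ++ _root_.splitBlocks K θ T t Q),
        by rw [h1 A hA0 hA1]; simp, by rw [h1 B hB0 hB1]; simp⟩

/-- Joining nodes to groups spreads an edit by at most one group on either side. -/
theorem OneEdit.groupBlocks {c t j : ℕ} {X Y : List (List Node)} {A B : List Node}
    (hXY : OneEdit c X Y A B) :
    ∃ A' B', OneEdit (c + 2) (groupBlocks T t j X) (groupBlocks T t j Y) A' B' := by
  obtain ⟨hA0, hB0, hAc, hBc, hE, P, U, V, Q, rfl, rfl⟩ := hXY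
  obtain ⟨P', U', V', Q', -, -, hU', hV', hsplit⟩ := List.exists_splitBy_append (joins j) U V
  have hb : ∀ A : List Node, _root_.groupBlocks T t j (P ++ (U ++ A ++ V) :: Q) =
      _root_.groupBlocks T t j P ++ (P'.map (parentNode T t) ++
        ((U' ++ A ++ V').splitBy (joins j)).map (parentNode T t) ++
        Q'.map (parentNode T t)) :: _root_.groupBlocks T t j Q := fun A => by
    rw [groupBlocks_append, ← List.map_append, ← List.map_append, ← hsplit]
    rfl
  refine ⟨((U' ++ A ++ V').splitBy (joins j)).map (parentNode T t),
    ((U' ++ B ++ V').splitBy (joins j)).map (parentNode T t), by simp [hA0], by simp [hB0], ?_, ?_, ?_,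
    _, _, _, _, hb A, hb B⟩
  · rw [List.length_map]
    exact (List.length_splitBy_append_le hU' hV' hA0).trans (by lia)
  · rw [List.length_map]
    exact (List.length_splitBy_append_le hU' hV' hB0).trans (by lia)
  · rw [expand_map_parentNode, expand_map_parentNode, List.flatten_splitBy, List.flatten_splitBy,
      expand_append, expand_append, expand_append, expand_append]
    exact hE.append_context _ _

theorem OneEdit.apartBy {c : ℕ} {X Y : List (List Node)} {A B : List Node}
    (hXY : OneEdit c X Y A B) : ApartBy expand 1 X Y := by
  obtain ⟨-, -, -, -, hE, P, U, V, Q, rfl, rfl⟩ := hXY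
  refine ApartBy.append_left P (ApartBy.cons (c := 1) (m := 0) ?_ (by simp) (.refl Q))
  simp only [expand_append]
  exact .step (hE.append_context _ _) (.refl _)

/-- The blocks at level `J`, if they consist of single nodes, give aligned decompositions. -/
theorem aligned_of_apartBy {J k : ℕ} {x y : List ℕ}
    (hxy : ApartBy expand (editDist x y) (level K θ T x J) (level K θ T y J))
    (hk : editDist x y ≤ k) (hx : ∀ b ∈ level K θ T x J, b.length = 1)
    (hy : ∀ b ∈ level K θ T y J, b.length = 1) (hfx : ∀ i ≤ J, FreshNames K θ T x i)
    (hfy : ∀ i ≤ J, FreshNames K θ T y i) :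
    Aligned k x y ((level K θ T x J).flatten.map nodeGrammar)
      ((level K θ T y J).flatten.map nodeGrammar) := by
  have hflat : ∀ {bs : List (List Node)}, (∀ b ∈ bs, b.length = 1) →
      bs.flatten = bs.map fun b => b.headD (leafNode 0) := by
    intro bs hbs
    induction bs with
    | nil => rfl
    | cons b bs ih =>
      obtain ⟨n, rfl⟩ := List.length_eq_one_iff.1 (hbs b (by simp))
      simp [ih fun b hb => hbs b (by simp [hb])]
  have hexp : ∀ {bs : List (List Node)}, (∀ b ∈ bs, b.length = 1) →
      bs.flatten.map Node.exp = bs.map expand := by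
    intro bs hbs
    rw [hflat hbs, List.map_map]
    refine List.map_congr_left fun b hb => ?_
    obtain ⟨n, rfl⟩ := List.length_eq_one_iff.1 (hbs b hb)
    simp [expand]
  have hlen : (level K θ T x J).length = (level K θ T y J).length := hxy.length_eq
  refine ⟨?_, ?_, (level K θ T x J).flatten.map Node.exp, (level K θ T y J).flatten.map Node.exp,
    evaluateTo_map_nodeGrammar hfx, evaluateTo_map_nodeGrammar hfy, ?_⟩
  · rw [hflat hx, hflat hy]
    simpa using hlen
  · rw [hflat hx, hflat hy, List.map_map, List.map_map]
    exact (hxy.countP_le _).trans hk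
  · rw [hexp hx, hexp hy]
    refine le_antisymm ?_ hxy.sum_editDist_le
    have h1 := (editsIn_flatten (bs := (level K θ T x J).map expand)
      (cs := (level K θ T y J).map expand) (by simpa using hlen)).editDist_le
    rwa [← expand_flatten, ← expand_flatten, expand_level, expand_level] at h1

end Alignment


/-! ### Probability that a name determines its rule -/

section Bounds

variable {h K θ : ℕ} {T : ℕ → ZMod (2 ^ h)} {x : List ℕ} {j : ℕ}

/-- Letters are below `2 ^ h` by assumption, and all other names are residues modulo `2 ^ h`. -/
theorem name_lt (hx : ∀ c ∈ x, c + 1 < 2 ^ h) : ∀ {j : ℕ} {n : Node},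
    n ∈ (level K θ T x j).flatten → n.name < 2 ^ h
  | 0, n, hn => by
    simp only [level, List.flatten_singleton, leaves, List.mem_cons, List.mem_map] at hn
    rcases hn with rfl | ⟨c, hc, rfl⟩
    · exact Nat.two_pow_pos h
    · exact hx c hc
  | j + 1, n, hn => by
    obtain ⟨b, hb, g, hg, rfl⟩ := mem_level_succ hn
    exact ZMod.val_lt _

theorem length_splitBy_le {α : Type*} (R : α → α → Bool) (l : List α) :
    (l.splitBy R).length ≤ l.length := by
  rcases eq_or_ne l [] with rfl | hl
  · simp
  · have h1 := List.length_splitBy R hl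
    have h2 := List.cuts_le_length R l
    have h3 := List.length_pos_of_ne_nil hl
    lia

theorem length_groupBlocks_le (t j : ℕ) (bs : List (List Node)) :
    (groupBlocks T t j bs).flatten.length ≤ bs.flatten.length := by
  induction bs with
  | nil => rfl
  | cons b bs ih =>
    have := length_splitBy_le (joins j) b
    simp only [groupBlocks, List.map_cons, List.flatten_cons, List.length_append,
      List.length_map] at ih ⊢
    lia

theorem length_level_le : ∀ j, (level K θ T x j).flatten.length ≤ x.length + 1
  | 0 => by simp [level, leaves]
  | j + 1 => by
    rw [level_succ]
    refine (length_groupBlocks_le _ _ _).trans ?_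
    rw [flatten_splitLevel]
    exact length_level_le j

theorem firstName_mem {g : List Node} (hg : g ≠ []) : ∃ n ∈ g, firstName g = n.name := by
  obtain ⟨a, g, rfl⟩ := List.exists_cons_of_ne_nil hg
  exact ⟨a, by simp, rfl⟩

theorem lastName_mem {g : List Node} (hg : g ≠ []) : ∃ n ∈ g, lastName g = n.name := by
  obtain ⟨g, a, rfl⟩ := (List.eq_nil_or_concat' g).resolve_left hg
  exact ⟨a, by simp, by simp [lastName]⟩

/-- A group of nodes with small names and small length. -/
structure IsSmallGroup (h : ℕ) (g : List Node) : Prop where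
  first : firstName g < 2 ^ h
  last : lastName g < 2 ^ h
  length : g.length < 2 ^ h

theorem isSmallGroup (hx : ∀ c ∈ x, c + 1 < 2 ^ h) (hxl : x.length + 1 < 2 ^ h) {b g : List Node}
    (hb : b ∈ splitLevel K θ T x j) (hg : g ∈ b.splitBy (joins j)) : IsSmallGroup h g := by
  have hne := List.ne_nil_of_mem_splitBy hg
  refine ⟨?_, ?_, ?_⟩
  · obtain ⟨n, hn, h⟩ := firstName_mem hne
    rw [h]
    exact name_lt hx (mem_level_of_mem_group hb hg hn)
  · obtain ⟨n, hn, h⟩ := lastName_mem hne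
    rw [h]
    exact name_lt hx (mem_level_of_mem_group hb hg hn)
  · have h1 := (List.infix_of_mem_flatten hg).length_le
    have h2 := (List.infix_of_mem_flatten hb).length_le
    have h3 := length_level_le (K := K) (θ := θ) (T := T) (x := x) j
    rw [List.flatten_splitBy] at h1
    rw [flatten_splitLevel] at h2
    lia

theorem groupKey_lt {g : List Node} (hg : IsSmallGroup h g) : groupKey h g < 2 ^ (3 * h) := by
  obtain ⟨h1, h2, h3⟩ := hg
  have h4 : lastName g + 2 ^ h * g.length < 2 ^ h * 2 ^ h := by nlinarith
  rw [show 3 * h = h + h + h by ring, pow_add, pow_add, groupKey]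
  nlinarith

theorem groupKey_inj {g g' : List Node} (hg : IsSmallGroup h g) (hg' : IsSmallGroup h g')
    (heq : groupKey h g = groupKey h g') :
    firstName g = firstName g' ∧ lastName g = lastName g' ∧ g.length = g'.length := by
  have key : ∀ a b a' b' : ℕ, a < 2 ^ h → a' < 2 ^ h → a + 2 ^ h * b = a' + 2 ^ h * b' →
      a = a' ∧ b = b' := by
    intro a b a' b' ha ha' he
    have h1 := congrArg (· % 2 ^ h) he
    simp only [Nat.add_mul_mod_self_left, Nat.mod_eq_of_lt ha, Nat.mod_eq_of_lt ha'] at h1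
    refine ⟨h1, ?_⟩
    rw [h1] at he
    exact Nat.eq_of_mul_eq_mul_left (Nat.two_pow_pos h) (Nat.add_left_cancel he)
  obtain ⟨h1, h2⟩ := key _ _ _ _ hg.first hg'.first heq
  exact ⟨h1, key _ _ _ _ hg.last hg'.last h2⟩

/-- The groups at level `j`. -/
def groups (K θ : ℕ) (T : ℕ → ZMod (2 ^ h)) (x : List ℕ) (j : ℕ) : List (List Node) :=
  (splitLevel K θ T x j).flatMap fun b => b.splitBy (joins j)

theorem length_groups_le : (groups K θ T x j).length ≤ x.length + 1 := by
  have h1 := length_level_le (K := K) (θ := θ) (T := T) (x := x) (j + 1)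
  have h2 : (level K θ T x (j + 1)).flatten.length = (groups K θ T x j).length := by
    simp only [level_succ, groupBlocks, groups, List.length_flatten, List.length_flatMap,
      List.map_map]
    congr 2
    funext b
    simp
  lia

end Bounds

section FreshNames

variable {h K θ N : ℕ} {x : List ℕ} {j : ℕ}

/-- The new names at level `j + 1` are hash values of at most `|x| + 1` different groups. They
collide with each other or with one of the `(j + 1) (|x| + 1)` old names only if one of at most `(j
+ 2) (|x| + 1) ^ 2` events of probability `2 ^ (-h)` occurs. -/
theorem prob_not_freshNames_succ (hx : ∀ c ∈ x, c + 1 < 2 ^ h) (hxl : x.length + 1 < 2 ^ h)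
    (hN : (j + 1) * chunk h K + (3 * h + 1) ≤ N) :
    prob (fun ω : Fin N → ZMod (2 ^ h) => ¬ FreshNames K θ (padWords ω) x (j + 1)) ≤
      (j + 2) * (x.length + 1) ^ 2 / 2 ^ h := by
  set t := (j + 1) * chunk h K with ht
  refine prob_le_of_splice t (fun T => ¬ FreshNames K θ T x (j + 1)) _ fun T => ?_
  -- With the earlier words fixed, only the names at level `j + 1` are random.
  set κ : Finset ℕ := ((groups K θ T x j).map (groupKey h)).toFinset with hκ
  set F : Finset ℕ := (Finset.range (j + 1)).biUnion fun i => nameSet (level K θ T x i).flatten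
    with hF
  have hκc : κ.card ≤ x.length + 1 := (List.toFinset_card_le _).trans (by
    rw [List.length_map]
    exact length_groups_le)
  have hFc : F.card ≤ (j + 1) * (x.length + 1) := by
    refine Finset.card_biUnion_le.trans
      ((Finset.sum_le_card_nsmul _ _ (x.length + 1) fun i _ => ?_).trans ?_)
    · refine (List.toFinset_card_le _).trans ?_
      rw [List.length_map]
      exact length_level_le i
    · simp
  have hκlt : ∀ u ∈ κ, u < 2 ^ (3 * h) := by
    intro u hu
    simp only [hκ, List.mem_toFinset, List.mem_map, groups, List.mem_flatMap] at hu
    obtain ⟨g, ⟨b, hb, hg⟩, rfl⟩ := hu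
    exact groupKey_lt (isSmallGroup hx hxl hb hg)
  refine (prob_mono (F := fun ω : Fin N → ZMod (2 ^ h) =>
    (∃ p ∈ κ.offDiag, linHash (padWords ω) t (3 * h) p.1 = linHash (padWords ω) t (3 * h) p.2) ∨
    (∃ p ∈ κ ×ˢ F, (linHash (padWords ω) t (3 * h) p.1).val = p.2)) fun ω hω => ?_).trans ?_
  · by_contra hcon
    push Not at hcon
    obtain ⟨hc1, hc2⟩ := hcon
    refine hω ?_
    set S := splice t T (padWords ω) with hS
    have hlow : ∀ i ≤ j, level K θ S x i = level K θ T x i := fun i hi =>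
      level_congr fun a ha => splice_of_lt _ _ (by
        have h1 := chunk_mono (h := h) (K := K) hi
        rw [ht, Nat.succ_mul, chunk]
        rw [chunk] at h1 ha
        lia)
    have hsl : splitLevel K θ S x j = splitLevel K θ T x j :=
      splitLevel_congr fun a ha => splice_of_lt _ _ ha
    have hhash : ∀ u, linHash S t (3 * h) u = linHash (padWords ω) t (3 * h) u := fun u =>
      linHash_congr u fun a ha _ => splice_of_le _ _ ha
    intro n hn i hi n' hn' hname
    obtain ⟨b, hb, g, hg, rfl⟩ := mem_level_succ hn
    rw [hsl] at hb
    have hgκ : groupKey h g ∈ κ := by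
      simp only [hκ, List.mem_toFinset, List.mem_map, groups, List.mem_flatMap]
      exact ⟨g, ⟨b, hb, hg⟩, rfl⟩
    have hsg := isSmallGroup hx hxl hb hg
    rcases Nat.lt_or_ge j i with hij | hij
    · obtain rfl : i = j + 1 := by lia
      obtain ⟨b', hb', g', hg', rfl⟩ := mem_level_succ hn'
      rw [hsl] at hb'
      have hgκ' : groupKey h g' ∈ κ := by
        simp only [hκ, List.mem_toFinset, List.mem_map, groups, List.mem_flatMap]
        exact ⟨g', ⟨b', hb', hg'⟩, rfl⟩
      have hsg' := isSmallGroup hx hxl hb' hg'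
      simp only [parentNode] at hname ⊢
      have hkey : groupKey h g = groupKey h g' := by
        by_contra hne
        refine hc1 (groupKey h g, groupKey h g') (Finset.mem_offDiag.2 ⟨hgκ, hgκ', hne⟩) ?_
        rw [← hhash, ← hhash]
        exact ZMod.val_injective _ hname
      obtain ⟨h1, h2, h3⟩ := groupKey_inj hsg hsg' hkey
      rw [hkey, h1, h2, h3]
    · rw [hlow i hij] at hn'
      refine absurd ?_ (hc2 (groupKey h g, n'.name) (Finset.mem_product.2 ⟨hgκ, ?_⟩))
      · rw [← hname]
        simp only [parentNode]
        rw [hhash]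
      · simp only [hF, Finset.mem_biUnion, Finset.mem_range, nameSet, List.mem_toFinset]
        exact ⟨i, by lia, List.mem_map_of_mem hn'⟩
  · refine (prob_or_le _ _).trans ?_
    have h1 : prob (fun ω : Fin N → ZMod (2 ^ h) => ∃ p ∈ κ.offDiag,
        linHash (padWords ω) t (3 * h) p.1 = linHash (padWords ω) t (3 * h) p.2) ≤
        κ.offDiag.card * (1 / 2 ^ h) := by
      refine (prob_exists_le _ _).trans
        ((Finset.sum_le_card_nsmul _ _ (1 / 2 ^ h) fun p hp => ?_).trans_eq (nsmul_eq_mul _ _))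
      rw [Finset.mem_offDiag] at hp
      exact prob_linHash_eq_linHash (by lia) (hκlt _ hp.1) (hκlt _ hp.2.1) hp.2.2
    have h2 : prob (fun ω : Fin N → ZMod (2 ^ h) => ∃ p ∈ κ ×ˢ F,
        (linHash (padWords ω) t (3 * h) p.1).val = p.2) ≤ (κ ×ˢ F).card * (1 / 2 ^ h) := by
      refine (prob_exists_le _ _).trans
        ((Finset.sum_le_card_nsmul _ _ (1 / 2 ^ h) fun p hp => ?_).trans_eq (nsmul_eq_mul _ _))
      exact prob_linHash_eq_const p.1 (by lia) p.2
    refine (add_le_add h1 h2).trans ?_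
    rw [← add_mul, mul_one_div]
    gcongr
    have h3 : κ.offDiag.card + (κ ×ˢ F).card ≤ (j + 2) * (x.length + 1) ^ 2 := by
      rw [Finset.offDiag_card, Finset.card_product]
      have h4 : κ.card * κ.card ≤ (x.length + 1) * (x.length + 1) := Nat.mul_le_mul hκc hκc
      have h5 : κ.card * F.card ≤ (x.length + 1) * ((j + 1) * (x.length + 1)) :=
        Nat.mul_le_mul hκc hFc
      have h6 := Nat.sub_le (κ.card * κ.card) κ.card
      nlinarith
    exact_mod_cast h3

end FreshNames

/-! ### Probability that blocks have few names -/

section FewNames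

variable {h K N D : ℕ} {x : List ℕ} {j : ℕ}

/-- The threshold `2 ^ h / D` splits a given segment with `D` different names except with
probability `(5 / 8) ^ K`, and there are at most `(|x| + 2) ^ 2` segments. -/
theorem prob_not_fewNames (hx : ∀ c ∈ x, c + 1 < 2 ^ h) (hD : 0 < D) (hDh : D ≤ 2 ^ h)
    (hN : (j + 1) * chunk h K ≤ N) :
    prob (fun ω : Fin N → ZMod (2 ^ h) => ¬ FewNames K (2 ^ h / D) D (padWords ω) x j) ≤
      (x.length + 2) ^ 2 * (5 / 8) ^ K := by
  set t := j * chunk h K + (3 * h + 1) with ht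
  have htN : t + K * (h + 1) ≤ N := by
    rw [Nat.succ_mul, chunk] at hN
    rw [ht, chunk]
    lia
  refine prob_le_of_splice t (fun T => ¬ FewNames K (2 ^ h / D) D T x j) _ fun T => ?_
  set L := (level K (2 ^ h / D) T x j).flatten with hL
  have hLl : L.length ≤ x.length + 1 := length_level_le j
  let seg : ℕ × ℕ → List Node := fun p => (L.drop p.1).take p.2
  -- A block with more than `D` names contains a segment with `D` names none of which splits.
  refine (prob_mono (F := fun ω : Fin N → ZMod (2 ^ h) =>
    ∃ p ∈ Finset.range (x.length + 2) ×ˢ Finset.range (x.length + 2),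
      D ≤ (nameSet (seg p)).card ∧
      ∀ v ∈ nameSet (seg p), isSplit K (2 ^ h / D) (padWords ω) t v = false) fun ω hω => ?_).trans ?_
  · simp only [FewNames, not_forall, not_le, splitLevel] at hω
    obtain ⟨b, hb, hcard⟩ := hω
    have hlow : level K (2 ^ h / D) (splice t T (padWords ω)) x j = level K (2 ^ h / D) T x j :=
      level_congr fun a ha => splice_of_lt _ _ ha
    rw [hlow, splitBlocks_congr (T' := padWords ω) _ fun a ha _ => splice_of_le _ _ ha] at hb
    simp only [splitBlocks, List.mem_flatMap] at hb
    obtain ⟨b₀, hb₀, hb⟩ := hb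
    obtain ⟨a, b, rfl⟩ := List.exists_cons_of_ne_nil (List.ne_nil_of_mem_splitBy hb)
    have hns : ∀ n ∈ b, isSplit K (2 ^ h / D) (padWords ω) t n.name = false := by
      have hch := List.isChain_of_mem_splitBy hb
      have : ∀ (b : List Node) (a : Node), (a :: b).IsChain
          (fun _ n => (!isSplit K (2 ^ h / D) (padWords ω) t n.name) = true) →
          ∀ n ∈ b, isSplit K (2 ^ h / D) (padWords ω) t n.name = false := by
        intro b
        induction b with
        | nil => simp
        | cons c b ih =>
          intro a hch n hn
          rw [List.isChain_cons_cons] at hch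
          rcases List.mem_cons.1 hn with rfl | hn
          · simpa using hch.1
          · exact ih c hch.2 n hn
      exact this b a hch
    have hinf : b <:+: L := by
      have h1 := List.infix_of_mem_flatten hb
      rw [List.flatten_splitBy] at h1
      exact ((List.suffix_cons a b).isInfix.trans h1).trans (List.infix_of_mem_flatten hb₀)
    obtain ⟨u, v, huv⟩ := hinf
    have hlen := congrArg List.length huv
    simp only [List.length_append] at hlen
    have hseg : seg (u.length, b.length) = b := by
      simp only [seg, ← huv, List.append_assoc, List.drop_left, List.take_left]
    refine ⟨(u.length, b.length), ?_, ?_, ?_⟩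
    · simp only [Finset.mem_product, Finset.mem_range]
      lia
    · rw [hseg]
      have h1 : (nameSet (a :: b)).card ≤ (nameSet b).card + 1 := by
        simp only [nameSet, List.map_cons, List.toFinset_cons]
        exact Finset.card_insert_le _ _
      lia
    · rw [hseg]
      intro v hv
      simp only [nameSet, List.mem_toFinset, List.mem_map] at hv
      obtain ⟨n, hn, rfl⟩ := hv
      exact hns n hn
  · refine (prob_exists_le _ _).trans ((Finset.sum_le_card_nsmul _ _ ((5 / 8) ^ K) fun p _ => ?_).trans_eq ?_)
    · by_cases hp : D ≤ (nameSet (seg p)).card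
      · obtain ⟨s, hs, hsD⟩ := Finset.exists_subset_card_eq hp
        refine (prob_mono fun ω hω v hv => hω.2 v (hs hv)).trans
          (prob_forall_not_isSplit hD hDh htN s hsD fun v hv => ?_)
        have hv := hs hv
        simp only [nameSet, List.mem_toFinset, List.mem_map] at hv
        obtain ⟨n, hn, rfl⟩ := hv
        exact name_lt hx (List.mem_of_mem_drop (List.mem_of_mem_take hn))
      · refine le_trans (le_of_eq ?_) (pow_nonneg (by norm_num) K)
        simp [prob, avg, hp]
    · rw [nsmul_eq_mul, Finset.card_product, Finset.card_range]
      push_cast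
      ring

end FewNames

/-! ### Probability that single edits stay local -/

section OneEdit

variable {h K N D : ℕ} {x y : List ℕ}

/-- A single edit stays local unless a name in the edited part is a splitting name at some level.
The part has at most `2 j + 2` nodes on each side at level `j`, and each of their names splits with
probability at most `K / D`. -/
theorem prob_not_oneEdit (hxy : EditOp x y) (J : ℕ) (hN : (J + 1) * chunk h K ≤ N) :
    prob (fun ω : Fin N → ZMod (2 ^ h) => ¬ ∃ A B, OneEdit (2 * J + 2)
      (level K (2 ^ h / D) (padWords ω) x J) (level K (2 ^ h / D) (padWords ω) y J) A B) ≤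
      (J * (4 * J + 4)) * (K / D) := by
  induction J with
  | zero =>
    obtain ⟨A, B, hAB⟩ := exists_oneEdit_leaves hxy
    refine avg_le fun ω => ?_
    rw [if_neg (not_not.2 ⟨A, B, hAB⟩)]
    simp
  | succ J ih =>
    have hc := Nat.succ_mul (J + 1) (chunk h K)
    have hc' : (J + 1) * chunk h K = J * chunk h K + (3 * h + 1) + K * (h + 1) := by
      rw [Nat.succ_mul, chunk]; lia
    set t := J * chunk h K + (3 * h + 1) with ht
    let E : (ℕ → ZMod (2 ^ h)) → ℕ → Prop := fun T J => ∃ A B, OneEdit (2 * J + 2)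
      (level K (2 ^ h / D) T x J) (level K (2 ^ h / D) T y J) A B
    have hstep : prob (fun ω : Fin N → ZMod (2 ^ h) => E (padWords ω) J ∧ ¬ E (padWords ω) (J + 1)) ≤
        (4 * J + 4) * (K / D) := by
      refine prob_le_of_splice t (fun T => E T J ∧ ¬ E T (J + 1)) _ fun T => ?_
      have hlow : ∀ (ω : Fin N → ZMod (2 ^ h)) x, level K (2 ^ h / D) (splice t T (padWords ω)) x J =
          level K (2 ^ h / D) T x J := fun ω x =>
        level_congr fun a ha => splice_of_lt _ _ ha
      by_cases hE : E T J
      · obtain ⟨A, B, hAB⟩ := hE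
        refine (prob_mono (F := fun ω : Fin N → ZMod (2 ^ h) => ∃ v ∈ nameSet (A ++ B),
          isSplit K (2 ^ h / D) (padWords ω) t v = true) fun ω hω => ?_).trans ?_
        · by_contra hcon
          push Not at hcon
          refine hω.2 ?_
          have h1 := (hAB.splitBlocks (T := padWords ω) (t := t) fun n hn => by
            simpa using hcon n.name (List.mem_toFinset.2 (List.mem_map_of_mem hn))).groupBlocks
              (T := splice t T (padWords ω)) (t := (J + 1) * chunk h K) (j := J)
          have hlev : ∀ z, level K (2 ^ h / D) (splice t T (padWords ω)) z (J + 1) =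
              groupBlocks (splice t T (padWords ω)) ((J + 1) * chunk h K) J
                (splitBlocks K (2 ^ h / D) (padWords ω) t (level K (2 ^ h / D) T z J)) := fun z => by
            rw [level_succ, splitLevel, hlow, ← ht]
            rw [splitBlocks_congr (T' := padWords ω) _ fun a ha _ => splice_of_le _ _ ha]
          obtain ⟨A', B', h2⟩ := h1
          exact ⟨A', B', by rw [hlev, hlev]; exact h2⟩
        · refine (prob_exists_le _ _).trans ((Finset.sum_le_card_nsmul _ _ ((K : ℝ) / D) fun v _ =>
            prob_isSplit_le v (by lia) D).trans ?_)
          rw [nsmul_eq_mul]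
          gcongr
          have h1 : (nameSet (A ++ B)).card ≤ 4 * J + 4 := by
            refine (List.toFinset_card_le _).trans ?_
            rw [List.length_map, List.length_append]
            have := hAB.2.2.1
            have := hAB.2.2.2.1
            lia
          exact_mod_cast h1
      · refine le_trans (le_of_eq ?_) (by positivity : (0 : ℝ) ≤ (4 * J + 4) * (K / D))
        have : ∀ ω : Fin N → ZMod (2 ^ h), ¬ (E (splice t T (padWords ω)) J) := fun ω => by
          simpa only [E, hlow] using hE
        simp [prob, avg, this]
    have hsum := (prob_mono fun ω (hω : ¬ E (padWords ω) (J + 1)) =>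
      show ¬ E (padWords ω) J ∨ (E (padWords ω) J ∧ ¬ E (padWords ω) (J + 1)) by tauto).trans
      ((prob_or_le _ _).trans (add_le_add (ih (by lia)) hstep))
    refine hsum.trans ?_
    have : (0 : ℝ) ≤ K / D := by positivity
    push_cast
    nlinarith

/-- Splitting and grouping keep strings at distance `m` aligned, except with small probability. -/
theorem prob_not_apartBy {m : ℕ} (hxy : EditsIn m x y) (J : ℕ) (hN : (J + 1) * chunk h K ≤ N) :
    prob (fun ω : Fin N → ZMod (2 ^ h) => ¬ ApartBy expand m
      (level K (2 ^ h / D) (padWords ω) x J) (level K (2 ^ h / D) (padWords ω) y J)) ≤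
      m * ((J * (4 * J + 4)) * (K / D)) := by
  induction hxy with
  | refl x =>
    refine avg_le fun ω => ?_
    rw [if_neg (not_not.2 (ApartBy.refl _))]
    simp
  | @step m x y z h1 _ ih =>
    refine (prob_mono (F := fun ω : Fin N → ZMod (2 ^ h) => (¬ ∃ A B, OneEdit (2 * J + 2)
      (level K (2 ^ h / D) (padWords ω) x J) (level K (2 ^ h / D) (padWords ω) y J) A B) ∨
      ¬ ApartBy expand m (level K (2 ^ h / D) (padWords ω) y J)
        (level K (2 ^ h / D) (padWords ω) z J)) fun ω hω => ?_).trans ?_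
    · by_contra hcon
      push Not at hcon
      obtain ⟨⟨A, B, hAB⟩, hyz⟩ := hcon
      refine hω ?_
      rw [add_comm]
      exact hAB.apartBy.trans hyz
    · refine (prob_or_le _ _).trans ((add_le_add (prob_not_oneEdit h1 J hN) ih).trans_eq ?_)
      push_cast
      ring

end OneEdit

/-! ### Probability that all blocks shrink to single nodes -/

section Progress

variable {h K θ N : ℕ} {x : List ℕ} {j : ℕ}

/-- The number of pairs of adjacent nodes in the same block. -/
def spread (bs : List (List Node)) : ℕ := (bs.map fun b => b.length - 1).sum

theorem cuts_const_false {α : Type*} (l : List α) : l.cuts (fun _ _ => false) = l.length - 1 := by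
  induction l with
  | nil => rfl
  | cons a l ih =>
    cases l with
    | nil => rfl
    | cons b l => simp [List.cuts, ih, add_comm]

theorem spread_splitBlocks_le (T : ℕ → ZMod (2 ^ h)) (t : ℕ) (bs : List (List Node)) :
    spread (splitBlocks K θ T t bs) ≤ spread bs := by
  induction bs with
  | nil => rfl
  | cons b bs ih =>
    simp only [spread, splitBlocks, List.flatMap_cons, List.map_append, List.sum_append,
      List.map_cons, List.sum_cons] at ih ⊢
    refine Nat.add_le_add ?_ ih
    have h1 := List.sum_cuts_le_cuts_flatten (fun _ _ => false)
      (b.splitBy fun _ n => !isSplit K θ T t n.name)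
    rw [List.flatten_splitBy, cuts_const_false] at h1
    simpa only [funext (cuts_const_false (α := Node))] using h1

/-- Splitting a block into pieces does not increase the number of unrelated adjacent nodes. -/
theorem spread_groupBlocks_splitBlocks_le (T T' : ℕ → ZMod (2 ^ h)) (t t' : ℕ)
    (bs : List (List Node)) :
    spread (groupBlocks T' t' j (splitBlocks K θ T t bs)) ≤
      (bs.map fun b => b.cuts (joins j)).sum := by
  induction bs with
  | nil => exact le_rfl
  | cons b bs ih =>
    simp only [spread, splitBlocks, groupBlocks, List.flatMap_cons, List.map_append,
      List.sum_append, List.map_cons, List.sum_cons, List.map_map] at ih ⊢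
    refine Nat.add_le_add ?_ ih
    have h1 := List.sum_cuts_le_cuts_flatten (joins j)
      (b.splitBy fun _ n => !isSplit K θ T t n.name)
    rw [List.flatten_splitBy] at h1
    refine le_trans (le_of_eq ?_) h1
    congr 1
    refine List.map_congr_left fun b' hb' => ?_
    simp [List.length_splitBy (joins j) (List.ne_nil_of_mem_splitBy hb')]

/-- Adjacent groups of a round of even number have different names, so that their parents are
joined in the next round with probability `1 / 4`. -/
theorem avg_cuts_le (hh : 0 < h) {t : ℕ} (hN : t + 3 * h < N) (hj : j % 2 = 0) :
    ∀ L : List (List Node), (∀ g ∈ L, IsSmallGroup h g) →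
    L.IsChain (fun g g' => firstName g ≠ firstName g') →
    (avg fun ω : Fin N → ZMod (2 ^ h) =>
      (((L.map (parentNode (padWords ω) t)).cuts (joins (j + 1)) : ℕ) : ℝ)) ≤
      3 / 4 * ((L.length - 1 : ℕ) : ℝ)
  | [], _, _ => by simp [List.cuts, avg]
  | [g], _, _ => by simp [List.cuts, avg]
  | g :: g' :: L, hL, hch => by
    rw [List.isChain_cons_cons] at hch
    have ih := avg_cuts_le hh hN hj (g' :: L) (fun g hg => hL g (by simp [hg])) hch.2
    have hj1 : (j + 1) % 2 ≠ 0 := by lia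
    have hkey : groupKey h g ≠ groupKey h g' := fun he =>
      hch.1 (groupKey_inj (hL g (by simp)) (hL g' (by simp)) he).1
    have hp := prob_not_parities hh hN (groupKey_lt (hL g (by simp)))
      (groupKey_lt (hL g' (by simp))) hkey
    rw [prob_eq_avg] at hp
    have hcuts : ∀ ω : Fin N → ZMod (2 ^ h),
        ((((g :: g' :: L).map (parentNode (padWords ω) t)).cuts (joins (j + 1)) : ℕ) : ℝ) =
        (if ¬ ((linHash (padWords ω) t (3 * h) (groupKey h g)).val % 2 = 0 ∧
          (linHash (padWords ω) t (3 * h) (groupKey h g')).val % 2 = 1) then (1 : ℝ) else 0) +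
        (((g' :: L).map (parentNode (padWords ω) t)).cuts (joins (j + 1)) : ℕ) := by
      intro ω
      simp only [List.map_cons, List.cuts, Nat.cast_add, joins, hj1, if_false, decide_eq_true_eq,
        parentNode, ite_not]
      congr 1
      split_ifs <;> simp
    simp only [hcuts]
    rw [avg_add, hp]
    simp only [List.length_cons, Nat.add_sub_cancel] at ih ⊢
    push_cast
    linarith

/-- Two rounds reduce the expected number of adjacent pairs in blocks to three quarters. -/
theorem avg_spread_le (hh : 0 < h) (hx : ∀ c ∈ x, c + 1 < 2 ^ h) (hxl : x.length + 1 < 2 ^ h)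
    (hj : j % 2 = 0) (hN : (j + 2) * chunk h K ≤ N) :
    (avg fun ω : Fin N → ZMod (2 ^ h) => (spread (level K θ (padWords ω) x (j + 2)) : ℝ)) ≤
      3 / 4 * avg fun ω : Fin N → ZMod (2 ^ h) => (spread (level K θ (padWords ω) x j) : ℝ) := by
  set t := (j + 1) * chunk h K with ht
  have htN : t + 3 * h < N := by
    have h1 : (j + 2) * chunk h K = t + chunk h K := by rw [ht]; ring
    have h2 : 3 * h < chunk h K := by rw [chunk]; lia
    lia
  rw [avg_splice t fun T => (spread (level K θ T x (j + 2)) : ℝ), ← avg_const_mul]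
  refine avg_mono fun ω => ?_
  set T := padWords ω with hT
  refine (avg_mono (g := fun ω' : Fin N → ZMod (2 ^ h) => ((splitLevel K θ T x j).map fun b =>
    ((((b.splitBy (joins j)).map (parentNode (padWords ω') t)).cuts (joins (j + 1)) : ℕ) : ℝ)).sum)
    fun ω' => ?_).trans ?_
  · set S := splice t T (padWords ω') with hS
    have h1 : spread (level K θ S x (j + 2)) ≤
        ((level K θ S x (j + 1)).map fun b => b.cuts (joins (j + 1))).sum :=
      spread_groupBlocks_splitBlocks_le _ _ _ _ _
    have h2 : level K θ S x (j + 1) = groupBlocks (padWords ω') t j (splitLevel K θ T x j) := by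
      rw [level_succ, ← ht, splitLevel_congr (T' := T) fun a ha => splice_of_lt _ _ ha]
      exact groupBlocks_congr _ fun a ha _ => splice_of_le _ _ ha
    rw [h2, groupBlocks, List.map_map] at h1
    have h3 : ((spread (level K θ S x (j + 2)) : ℕ) : ℝ) ≤ (((splitLevel K θ T x j).map
      fun b => ((b.splitBy (joins j)).map (parentNode (padWords ω') t)).cuts (joins (j + 1))).sum : ℕ) :=
      by exact_mod_cast h1
    refine h3.trans_eq ?_
    rw [Nat.cast_list_sum, List.map_map]
    rfl
  · rw [avg_list_sum]
    have h1 : ∀ b ∈ splitLevel K θ T x j, (avg fun ω' : Fin N → ZMod (2 ^ h) =>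
        ((((b.splitBy (joins j)).map (parentNode (padWords ω') t)).cuts (joins (j + 1)) : ℕ) : ℝ)) ≤
        3 / 4 * ((b.length - 1 : ℕ) : ℝ) := by
      intro b hb
      refine (avg_cuts_le hh htN hj _ (fun g hg => isSmallGroup hx hxl hb hg) ?_).trans ?_
      · have hch := List.isChain_getLast_head_splitBy (joins j) b
        refine (List.isChain_iff_forall_rel_of_append_cons_cons.2 fun {g g' l₁ l₂} heq => ?_)
        have hgm : g ∈ b.splitBy (joins j) := by rw [heq]; simp
        rw [heq, List.isChain_append] at hch
        obtain ⟨hg, hg', hr⟩ := (List.isChain_cons_cons.1 hch.2.1).1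
        have hnames := List.isChain_of_mem_splitBy hgm
        -- All names of a group are equal, and the next group starts with another name.
        have hl : ∀ (g : List Node) (hg : g ≠ []), g.IsChain (fun a b => joins j a b = true) →
            (g.getLast hg).name = firstName g := by
          intro g hg hch
          induction g with
          | nil => exact absurd rfl hg
          | cons a g ih =>
            cases g with
            | nil => rfl
            | cons b g =>
              rw [List.isChain_cons_cons] at hch
              rw [List.getLast_cons (by simp), ih (by simp) hch.2]
              have : a.name = b.name := by simpa [joins, hj] using hch.1
              exact this.symm
        have h2 := hl g hg hnames
        have h3 : (g'.head hg').name = firstName g' := by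
          obtain ⟨a, g', rfl⟩ := List.exists_cons_of_ne_nil hg'
          rfl
        rw [← h2, ← h3]
        simpa [joins, hj] using hr
      · have := length_splitBy_le (joins j) b
        gcongr
    refine (List.sum_le_sum h1).trans ?_
    rw [List.sum_map_mul_left]
    refine mul_le_mul_of_nonneg_left ?_ (by norm_num)
    have h2 := spread_splitBlocks_le (K := K) (θ := θ) T (j * chunk h K + (3 * h + 1))
      (level K θ T x j)
    have h3 : ((splitLevel K θ T x j).map fun b => ((b.length - 1 : ℕ) : ℝ)).sum =
        (spread (splitLevel K θ T x j) : ℕ) := by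
      rw [spread, Nat.cast_list_sum, List.map_map]
      rfl
    rw [h3]
    exact_mod_cast h2

/-- The expected number of adjacent pairs in blocks falls from `|x|` to at most `(3 / 4) ^ i |x|`
within `2 i` rounds; it bounds the probability that a pair is left. -/
theorem prob_exists_length_ne_one (hh : 0 < h) (hx : ∀ c ∈ x, c + 1 < 2 ^ h)
    (hxl : x.length + 1 < 2 ^ h) (i : ℕ) (hN : (2 * i + 1) * chunk h K ≤ N) :
    prob (fun ω : Fin N → ZMod (2 ^ h) =>
      ¬ ∀ b ∈ level K θ (padWords ω) x (2 * i), b.length = 1) ≤ (3 / 4) ^ i * x.length := by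
  have h1 : ∀ i, (2 * i + 1) * chunk h K ≤ N →
      (avg fun ω : Fin N → ZMod (2 ^ h) => (spread (level K θ (padWords ω) x (2 * i)) : ℝ)) ≤
        (3 / 4) ^ i * x.length := by
    intro i
    induction i with
    | zero =>
      intro _
      refine avg_le fun ω => le_of_eq ?_
      simp [spread, level, leaves]
    | succ i ih =>
      intro hN
      have h2 : (2 * i + 1) * chunk h K ≤ N := (Nat.mul_le_mul_right _ (by lia)).trans hN
      have h3 : (2 * i + 2) * chunk h K ≤ N := (Nat.mul_le_mul_right _ (by lia)).trans hN
      have h4 := avg_spread_le (θ := θ) hh hx hxl (j := 2 * i) (by lia) h3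
      rw [show 2 * (i + 1) = 2 * i + 2 by ring, pow_succ']
      have := ih h2
      linarith
  refine (prob_le_avg (fun ω => Nat.cast_nonneg _) fun ω hω => ?_).trans (h1 i hN)
  push Not at hω
  obtain ⟨b, hb, hb1⟩ := hω
  have hb0 : b ≠ [] := fun he => nil_notMem_level _ (he ▸ hb)
  have h2 := List.length_pos_of_ne_nil hb0
  have h3 : b.length - 1 ≤ spread (level K θ (padWords ω) x (2 * i)) :=
    List.single_le_sum (by simp) _ (List.mem_map_of_mem (f := fun b : List Node => b.length - 1) hb)
  have h4 : 1 ≤ spread (level K θ (padWords ω) x (2 * i)) := by lia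
  exact_mod_cast h4

end Progress


/-! ### Reasoning about machine programs -/

/-- Started in `s`, the program `p` halts after at most `B` steps in a state with property `Q`. -/
def Prog.Ends (w : ℕ) (p : Prog) (s : MState) (B : ℕ) (Q : MState → Prop) : Prop :=
  ∃ t s', p.Runs w s t s' ∧ t ≤ B ∧ Q s'

/-- `p.writes r`: the program `p` may write to register `r`. -/
def Prog.writes : Prog → ℕ → Bool
  | .lit i _, r => r == i
  | .op _ i _ _, r => r == i
  | .load i _, r => r == i
  | .coin i, r => r == i
  | .seq p q, r => p.writes r || q.writes r
  | .branch _ p q, r => p.writes r || q.writes r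
  | .loop _ p, r => p.writes r
  | _, _ => false

/-- The program may write to memory. -/
def Prog.stores : Prog → Bool
  | .store _ _ => true
  | .seq p q => p.stores || q.stores
  | .branch _ p q => p.stores || q.stores
  | .loop _ p => p.stores
  | _ => false

/-- The program may toss coins. -/
def Prog.tosses : Prog → Bool
  | .coin _ => true
  | .seq p q => p.tosses || q.tosses
  | .branch _ p q => p.tosses || q.tosses
  | .loop _ p => p.tosses
  | _ => false

/-- The program may append to the output. -/
def Prog.emits : Prog → Bool
  | .emit _ => true
  | .seq p q => p.emits || q.emits
  | .branch _ p q => p.emits || q.emits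
  | .loop _ p => p.emits
  | _ => false

/-- The parts of the state that `p` cannot change are the same in `s` and `s'`. -/
structure Frame (p : Prog) (s s' : MState) : Prop where
  reg : ∀ r, p.writes r = false → s'.reg r = s.reg r
  mem : p.stores = false → s'.mem = s.mem
  coins : p.tosses = false → s'.coins = s.coins
  out : p.emits = false → s'.out = s.out

theorem Frame.refl (p : Prog) (s : MState) : Frame p s s :=
  ⟨fun _ _ => rfl, fun _ => rfl, fun _ => rfl, fun _ => rfl⟩

theorem Frame.trans {p : Prog} {s s' s'' : MState} (h : Frame p s s') (h' : Frame p s' s'') :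
    Frame p s s'' :=
  ⟨fun r hr => (h'.reg r hr).trans (h.reg r hr), fun hp => (h'.mem hp).trans (h.mem hp),
    fun hp => (h'.coins hp).trans (h.coins hp), fun hp => (h'.out hp).trans (h.out hp)⟩

@[simp] theorem MState.reg_setReg (s : MState) (i v r : ℕ) :
    (s.setReg i v).reg r = if r = i then v else s.reg r := by
  simp [MState.setReg, Function.update_apply]

@[simp] theorem MState.mem_setReg (s : MState) (i v : ℕ) : (s.setReg i v).mem = s.mem := rfl

@[simp] theorem MState.coins_setReg (s : MState) (i v : ℕ) : (s.setReg i v).coins = s.coins := rfl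

@[simp] theorem MState.out_setReg (s : MState) (i v : ℕ) : (s.setReg i v).out = s.out := rfl

theorem Frame.left {p q : Prog} {s s' : MState} (h : Frame p s s') : Frame (p.seq q) s s' :=
  ⟨fun r hr => h.reg r (by simp_all [Prog.writes]), fun hp => h.mem (by simp_all [Prog.stores]),
    fun hp => h.coins (by simp_all [Prog.tosses]), fun hp => h.out (by simp_all [Prog.emits])⟩

theorem Frame.right {p q : Prog} {s s' : MState} (h : Frame q s s') : Frame (p.seq q) s s' :=
  ⟨fun r hr => h.reg r (by simp_all [Prog.writes]), fun hp => h.mem (by simp_all [Prog.stores]),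
    fun hp => h.coins (by simp_all [Prog.tosses]), fun hp => h.out (by simp_all [Prog.emits])⟩

/-- A run changes only what the text of the program can change. This lets every correctness lemma
speak only about the registers and cells that matter. -/
theorem Prog.Runs.frame {w : ℕ} {p : Prog} {s s' : MState} {t : ℕ} (h : p.Runs w s t s') :
    Frame p s s' := by
  induction h with
  | skip s => exact .refl _ _
  | lit s i v =>
    exact ⟨fun r hr => by simp_all [Prog.writes], fun _ => rfl, fun _ => rfl, fun _ => rfl⟩
  | op s o i j l =>
    exact ⟨fun r hr => by simp_all [Prog.writes], fun _ => rfl, fun _ => rfl, fun _ => rfl⟩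
  | load s i j =>
    exact ⟨fun r hr => by simp_all [Prog.writes], fun _ => rfl, fun _ => rfl, fun _ => rfl⟩
  | store s i j =>
    exact ⟨fun _ _ => rfl, fun hp => by simp [Prog.stores] at hp, fun _ => rfl, fun _ => rfl⟩
  | coin s i b bs h =>
    refine ⟨fun r hr => ?_, fun _ => rfl, fun hp => by simp [Prog.tosses] at hp, fun _ => rfl⟩
    change (s.setReg i _).reg r = _
    simp_all [Prog.writes]
  | emit s i =>
    exact ⟨fun _ _ => rfl, fun _ => rfl, fun _ => rfl, fun hp => by simp [Prog.emits] at hp⟩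
  | seq _ _ ih ih' => exact ih.left.trans ih'.right
  | branch_true _ _ ih =>
    exact ⟨fun r hr => ih.reg r (by simp_all [Prog.writes]),
      fun hp => ih.mem (by simp_all [Prog.stores]), fun hp => ih.coins (by simp_all [Prog.tosses]),
      fun hp => ih.out (by simp_all [Prog.emits])⟩
  | branch_false _ _ ih =>
    exact ⟨fun r hr => ih.reg r (by simp_all [Prog.writes]),
      fun hp => ih.mem (by simp_all [Prog.stores]), fun hp => ih.coins (by simp_all [Prog.tosses]),
      fun hp => ih.out (by simp_all [Prog.emits])⟩
  | loop_done _ => exact .refl _ _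
  | loop_step _ _ _ ih ih' =>
    exact Frame.trans ⟨ih.reg, ih.mem, ih.coins, ih.out⟩ ih'

namespace Prog.Ends

variable {w B B' : ℕ} {p q : Prog} {s : MState} {Q Q' : MState → Prop}

theorem mono (h : p.Ends w s B Q) (hB : B ≤ B') (hQ : ∀ s', Q s' → Frame p s s' → Q' s') :
    p.Ends w s B' Q' := by
  obtain ⟨t, s', hr, ht, h⟩ := h
  exact ⟨t, s', hr, ht.trans hB, hQ s' h hr.frame⟩

theorem seq (h : p.Ends w s B Q) (h' : ∀ s', Q s' → Frame p s s' → q.Ends w s' B' Q') :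
    (p.seq q).Ends w s (B + B') Q' := by
  obtain ⟨t, s', hr, ht, hQ⟩ := h
  obtain ⟨t', s'', hr', ht', hQ'⟩ := h' s' hQ hr.frame
  exact ⟨t + t', s'', .seq hr hr', by lia, hQ'⟩

theorem branch {i : ℕ} (h : s.reg i ≠ 0 → p.Ends w s B Q) (h' : s.reg i = 0 → q.Ends w s B Q) :
    (Prog.branch i p q).Ends w s (B + 1) Q := by
  by_cases hi : s.reg i = 0
  · obtain ⟨t, s', hr, ht, hQ⟩ := h' hi
    exact ⟨t + 1, s', .branch_false hi hr, by lia, hQ⟩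
  · obtain ⟨t, s', hr, ht, hQ⟩ := h hi
    exact ⟨t + 1, s', .branch_true hi hr, by lia, hQ⟩

/-- A loop with `N` iterations, the `i`-th of which takes at most `C i` steps. -/
theorem loop {c : ℕ} (N : ℕ) (C : ℕ → ℕ) (I : ℕ → MState → Prop) (h0 : I 0 s)
    (hstep : ∀ i s', i < N → I i s' → Frame p s s' → s'.reg c ≠ 0 ∧ p.Ends w s' (C i) (I (i + 1)))
    (hend : ∀ s', I N s' → s'.reg c = 0) :
    (Prog.loop c p).Ends w s (∑ i ∈ Finset.range N, (C i + 1) + 1) (I N) := by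
  have key : ∀ m i s', i + m = N → I i s' → Frame p s s' →
      (Prog.loop c p).Ends w s' (∑ a ∈ Finset.range m, (C (i + a) + 1) + 1) (I N) := by
    intro m
    induction m with
    | zero =>
      intro i s' hi hI _
      obtain rfl : i = N := by lia
      exact ⟨1, s', .loop_done (hend s' hI), by simp, hI⟩
    | succ m ih =>
      intro i s' hi hI hF
      obtain ⟨hc, t, s'', hr, ht, hI'⟩ := hstep i s' (by lia) hI hF
      obtain ⟨t', s₃, hr', ht', hQ⟩ := ih (i + 1) s'' (by lia) hI' (hF.trans hr.frame)
      refine ⟨t + t' + 1, s₃, .loop_step hc hr hr', ?_, hQ⟩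
      rw [Finset.sum_range_succ', Nat.add_zero]
      rw [Finset.sum_congr rfl (g := fun a => C (i + 1 + a) + 1) fun a _ => by
        rw [show i + (a + 1) = i + 1 + a by lia]]
      lia
  have h := key N 0 s (by lia) h0 (.refl _ _)
  simp only [Nat.zero_add] at h
  exact h

/-- A loop with `N` iterations, each of which takes at most `B` steps. -/
theorem loop_const {c : ℕ} (N : ℕ) (I : ℕ → MState → Prop) (h0 : I 0 s)
    (hstep : ∀ i s', i < N → I i s' → Frame p s s' → s'.reg c ≠ 0 ∧ p.Ends w s' B (I (i + 1)))
    (hend : ∀ s', I N s' → s'.reg c = 0) :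
    (Prog.loop c p).Ends w s (N * (B + 1) + 1) (I N) := by
  simpa using loop N (fun _ => B) I h0 hstep hend

end Prog.Ends

/-- The effect of a single instruction when no result exceeds the word size. -/
def Prog.step : Prog → MState → MState
  | .lit i v, s => s.setReg i v
  | .op o i j l, s => s.setReg i (o.eval (s.reg j) (s.reg l))
  | .load i j, s => s.setReg i (s.mem (s.reg j))
  | .store i j, s => { s with mem := Function.update s.mem (s.reg i) (s.reg j) }
  | .emit i, s => { s with out := s.out ++ [s.reg i] }
  | _, s => s

/-- The program is a single instruction, no coin toss, and its result does not exceed the word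
size. -/
def Prog.Safe (w : ℕ) : Prog → MState → Prop
  | .lit _ v, _ => v < 2 ^ w
  | .op o _ j l, s => o.eval (s.reg j) (s.reg l) < 2 ^ w
  | .load _ _, _ => True
  | .store _ _, _ => True
  | .emit _, _ => True
  | _, _ => False

/-- Sequential composition of a list of programs. -/
def Prog.seqs : List Prog → Prog
  | [] => .skip
  | p :: l => .seq p (seqs l)

/-- The effect of a list of instructions when no result exceeds the word size. -/
def Prog.steps : List Prog → MState → MState
  | [], s => s
  | p :: l, s => steps l (p.step s)

/-- All programs of the list are single instructions, and no result exceeds the word size. -/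
def Prog.SafeAll (w : ℕ) : List Prog → MState → Prop
  | [], _ => True
  | p :: l, s => p.Safe w s ∧ SafeAll w l (p.step s)

theorem Prog.Safe.runs {w : ℕ} {p : Prog} {s : MState} (h : p.Safe w s) :
    p.Runs w s 1 (p.step s) := by
  cases p with
  | lit i v => simpa [Prog.step, Nat.mod_eq_of_lt h] using Prog.Runs.lit (w := w) s i v
  | op o i j l => simpa [Prog.step, Nat.mod_eq_of_lt h] using Prog.Runs.op (w := w) s o i j l
  | load i j => exact .load s i j
  | store i j => exact .store s i j
  | emit i => exact .emit s i
  | _ => exact h.elim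

theorem Prog.SafeAll.ends {w : ℕ} : ∀ {l : List Prog} {s : MState}, Prog.SafeAll w l s →
    (Prog.seqs l).Ends w s (l.length + 1) fun s' => s' = Prog.steps l s
  | [], s, _ => ⟨1, s, .skip s, by simp, rfl⟩
  | p :: l, s, h => by
    obtain ⟨t, s', hr, ht, rfl⟩ := Prog.SafeAll.ends h.2
    exact ⟨1 + t, _, .seq h.1.runs hr, by simp; lia, rfl⟩

/-! ### Computing hash values -/

/-- Add to register 15 the words, from the address in register 14 on, at the nonzero bits of
register 13. -/
def absorbProg : Prog :=
  .seq (.seqs [.op .plus 16 6 4])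
    (.loop 16 (.seqs [.op .rem 17 13 5, .op .quot 13 13 5, .load 18 14, .op .times 18 18 17,
      .op .plus 15 15 18, .op .rem 15 15 7, .op .plus 14 14 3, .op .minus 16 16 3]))

/-- The parameters of a run: the word size `w`, the hash width `h`, the number `K` of rows of the
splitting test and its threshold `θ`, the size `S` of a row of memory, the number `J` of rounds and
the number `N` of random words. -/
structure Params where
  (w h K θ S J N : ℕ)

/-- The registers 3 to 12 hold the constants that the program uses, and the memory holds the random
words `T` from address `S` on. -/
structure Ready (π : Params) (T : ℕ → ZMod (2 ^ π.h)) (s : MState) : Prop where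
  one : s.reg 3 = 1
  zero : s.reg 4 = 0
  two : s.reg 5 = 2
  width : s.reg 6 = π.h
  modulus : s.reg 7 = 2 ^ π.h
  rows : s.reg 8 = π.K
  threshold : s.reg 9 = π.θ
  size : s.reg 10 = π.S
  words : s.reg 11 = π.N
  rounds : s.reg 12 = π.J
  table : ∀ t < π.N, s.mem (π.S + t) = (T t).val

/-- All numbers that occur fit into words. -/
structure Fits (π : Params) : Prop where
  modulus : 2 * 2 ^ π.h < 2 ^ π.w
  width : 3 * π.h < 2 ^ π.w
  rows : π.K + 2 < 2 ^ π.w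
  threshold : π.θ ≤ 2 ^ π.h
  memory : π.S + π.N + (3 * π.J + 4) * π.S < 2 ^ π.w
  size : 0 < π.S

theorem Ready.of_eq {π : Params} {T : ℕ → ZMod (2 ^ π.h)} {s s' : MState} (hs : Ready π T s)
    (hreg : ∀ r, 3 ≤ r → r < 13 → s'.reg r = s.reg r)
    (hmem : ∀ a, a < π.S + π.N → s'.mem a = s.mem a) : Ready π T s' where
  one := (hreg 3 (by lia) (by lia)).trans hs.one
  zero := (hreg 4 (by lia) (by lia)).trans hs.zero
  two := (hreg 5 (by lia) (by lia)).trans hs.two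
  width := (hreg 6 (by lia) (by lia)).trans hs.width
  modulus := (hreg 7 (by lia) (by lia)).trans hs.modulus
  rows := (hreg 8 (by lia) (by lia)).trans hs.rows
  threshold := (hreg 9 (by lia) (by lia)).trans hs.threshold
  size := (hreg 10 (by lia) (by lia)).trans hs.size
  words := (hreg 11 (by lia) (by lia)).trans hs.words
  rounds := (hreg 12 (by lia) (by lia)).trans hs.rounds
  table t ht := (hmem _ (by lia)).trans (hs.table t ht)

theorem Ready.of_frame {π : Params} {T : ℕ → ZMod (2 ^ π.h)} {p : Prog} {s s' : MState}
    (hs : Ready π T s) (hF : Frame p s s') (hw : ∀ r < 13, 3 ≤ r → p.writes r = false)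
    (hst : p.stores = false) : Ready π T s' :=
  hs.of_eq (fun r h1 h2 => hF.reg r (hw r h2 h1)) fun a _ => by rw [hF.mem hst]

theorem Nat.testBit_toNat_eq (v i : ℕ) : v / 2 ^ i % 2 = (v.testBit i).toNat := by
  rw [Nat.testBit_eq_decide_div_mod_eq]
  rcases Nat.mod_two_eq_zero_or_one (v / 2 ^ i) with h | h <;> simp [h]

theorem absorbProg_ends {π : Params} (hπ : Fits π) {T : ℕ → ZMod (2 ^ π.h)} {s : MState}
    (hs : Ready π T s) {v t : ℕ} {A : ZMod (2 ^ π.h)} (hv : s.reg 13 = v) (hvw : v < 2 ^ π.w)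
    (ht : s.reg 14 = π.S + t) (htN : t + π.h ≤ π.N) (hA : s.reg 15 = A.val) :
    absorbProg.Ends π.w s (10 * π.h + 3) fun s' =>
      s'.reg 14 = π.S + (t + π.h) ∧ s'.reg 15 = (A + bitSum T t π.h v).val := by
  have hmod := hπ.modulus
  have hwid := hπ.width
  have hmem := hπ.memory
  refine ((Prog.SafeAll.ends (l := [.op .plus 16 6 4]) ?_).seq (B' := π.h * (9 + 1) + 1) ?_).mono
    (B := 2 + (π.h * (9 + 1) + 1)) (by lia) fun _ h _ => h
  · simp [Prog.SafeAll, Prog.Safe, Op.eval, hs.width, hs.zero]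
    lia
  rintro _ rfl -
  refine (Prog.Ends.loop_const π.h (fun i s' => s'.reg 16 = π.h - i ∧ s'.reg 13 = v / 2 ^ i ∧
    s'.reg 14 = π.S + (t + i) ∧ s'.reg 15 = (A + bitSum T t i v).val) ?_ ?_ ?_).mono le_rfl ?_
  · simp [Prog.steps, Prog.step, Op.eval, hs.width, hs.zero, hv, ht, hA, bitSum]
  · rintro i s' hi ⟨h16, h13, h14, h15⟩ hF
    have hF2 : ∀ r < 13, s'.reg r = s.reg r := fun r hr => by
      rw [hF.reg r (by simp [Prog.writes, Prog.seqs]; lia)]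
      simp [Prog.steps, Prog.step]
      lia
    have hm : s'.mem = s.mem := hF.mem rfl
    have e3 : s'.reg 3 = 1 := (hF2 3 (by lia)).trans hs.one
    have e5 : s'.reg 5 = 2 := (hF2 5 (by lia)).trans hs.two
    have e7 : s'.reg 7 = 2 ^ π.h := (hF2 7 (by lia)).trans hs.modulus
    refine ⟨by lia, ?_⟩
    have hT : s'.mem (π.S + (t + i)) = (T (t + i)).val := by rw [hm, hs.table _ (by lia)]
    have hb : v / 2 ^ i % 2 = (v.testBit i).toNat := Nat.testBit_toNat_eq v i
    have hT2 := ZMod.val_lt (T (t + i))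
    have hA2 := ZMod.val_lt (A + bitSum T t i v)
    have hb2 : (v.testBit i).toNat ≤ 1 := Bool.toNat_le _
    have hprod : (T (t + i)).val * (v.testBit i).toNat ≤ (T (t + i)).val := by nlinarith
    have hdiv : v / 2 ^ i / 2 ≤ v := (Nat.div_le_self _ _).trans (Nat.div_le_self _ _)
    have hmodlt : (A + bitSum T t i v).val + (T (t + i)).val * (v.testBit i).toNat < 2 ^ π.w := by lia
    refine (Prog.SafeAll.ends ?_).mono (by simp) ?_
    · simp only [Prog.SafeAll, Prog.Safe, Op.eval, Prog.step, MState.reg_setReg, MState.mem_setReg]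
      simp [h16, h13, h14, h15, e3, e5, e7, hT, hb]
      have hrem := Nat.mod_le ((A + bitSum T t i v).val + (T (t + i)).val * (v.testBit i).toNat) (2 ^ π.h)
      refine ⟨?_, ?_, ?_, ?_, ?_, ?_, ?_⟩ <;> lia
    · rintro _ rfl -
      simp [Prog.steps, Prog.step, Op.eval, h16, h13, h14, h15, e3, e5, e7, hT, hb]
      refine ⟨by lia, by rw [Nat.div_div_eq_div_mul, pow_succ], by lia, ?_⟩
      rw [show bitSum T t (i + 1) v = bitSum T t i v + if v.testBit i then T (t + i) else 0 from
        Finset.sum_range_succ _ _, ← add_assoc, ZMod.val_add (A + bitSum T t i v)]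
      cases v.testBit i
      · simp only [Bool.toNat_false, mul_zero, Bool.false_eq_true, if_false, ZMod.val_zero]
      · simp only [Bool.toNat_true, mul_one, if_true]
  · rintro s' ⟨h16, -⟩
    rw [h16, Nat.sub_self]
  · rintro s' ⟨_, _, h14, h15⟩ -
    exact ⟨h14, h15⟩


/-- Compute the name of a group into register 19.  The first name, the last name and the length of
the group are in the registers 42, 34 and 37, the address of the random words in register 40. -/
def nameProg : Prog :=
  .seq (.seqs [.load 15 40, .op .plus 14 40 3, .op .plus 13 42 4]) <|
  .seq absorbProg <| .seq (.seqs [.op .plus 13 34 4]) <|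
  .seq absorbProg <| .seq (.seqs [.op .plus 13 37 4]) <|
  .seq absorbProg (.seqs [.op .plus 19 15 4])

theorem linHash_groupKey {Z : Type*} [AddCommGroup Z] (T : ℕ → Z) (t h a b r : ℕ) (ha : a < 2 ^ h)
    (hb : b < 2 ^ h) : linHash T t (3 * h) (a + 2 ^ h * (b + 2 ^ h * r)) =
      T t + bitSum T (t + 1) h a + bitSum T (t + 1 + h) h b + bitSum T (t + 1 + h + h) h r := by
  rw [linHash, show 3 * h = h + (h + h) by ring, bitSum_add _ _ _ _ _ _ ha, bitSum_add _ _ _ _ _ _ hb]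
  simp only [add_assoc]

theorem nameProg_ends {π : Params} (hπ : Fits π) {T : ℕ → ZMod (2 ^ π.h)} {s : MState}
    (hs : Ready π T s) {a b r t : ℕ} (ha : s.reg 42 = a) (hb : s.reg 34 = b) (hr : s.reg 37 = r)
    (hah : a < 2 ^ π.h) (hbh : b < 2 ^ π.h) (hrh : r < 2 ^ π.h)
    (ht : s.reg 40 = π.S + t) (htN : t + (3 * π.h + 1) ≤ π.N) :
    nameProg.Ends π.w s (30 * π.h + 20) fun s' =>
      s'.reg 14 = π.S + (t + (3 * π.h + 1)) ∧
      s'.reg 19 = (linHash T t (3 * π.h) (a + 2 ^ π.h * (b + 2 ^ π.h * r))).val := by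
  have hmod := hπ.modulus
  have hmem := hπ.memory
  have hw : 2 ^ π.h ≤ 2 ^ π.w := by lia
  rw [linHash_groupKey T t π.h a b r hah hbh]
  refine ((Prog.SafeAll.ends (l := [.load 15 40, .op .plus 14 40 3, .op .plus 13 42 4]) ?_).seq
    (B' := (10 * π.h + 3) + (2 + ((10 * π.h + 3) + (2 + ((10 * π.h + 3) + 2))))) ?_).mono
    (by simp; lia) fun _ h _ => h
  · simp [Prog.SafeAll, Prog.Safe, Prog.step, Op.eval, hs.one, hs.zero, ht, ha]
    lia
  rintro _ rfl -
  set s₁ := Prog.steps [.load 15 40, .op .plus 14 40 3, .op .plus 13 42 4] s with hs₁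
  have hR₁ : Ready π T s₁ := hs.of_eq (fun r _ hr => by simp [hs₁, Prog.steps, Prog.step]; lia)
    fun _ _ => rfl
  have e₁ : s₁.reg 13 = a ∧ s₁.reg 14 = π.S + (t + 1) ∧ s₁.reg 15 = (T t).val ∧ s₁.reg 34 = b ∧
      s₁.reg 37 = r := by
    simp [hs₁, Prog.steps, Prog.step, Op.eval, hs.one, hs.zero, ht, ha, hb, hr,
      hs.table t (by lia), add_assoc]
  refine (absorbProg_ends hπ hR₁ e₁.1 (by lia) e₁.2.1 (by lia) e₁.2.2.1).seq ?_
  rintro s₂ ⟨h14, h15⟩ hF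
  have hR₂ := hR₁.of_frame hF (by decide) rfl
  have e34 : s₂.reg 34 = b := (hF.reg 34 rfl).trans e₁.2.2.2.1
  have e37 : s₂.reg 37 = r := (hF.reg 37 rfl).trans e₁.2.2.2.2
  refine (Prog.SafeAll.ends (l := [.op .plus 13 34 4]) ?_).seq ?_
  · simp [Prog.SafeAll, Prog.Safe, Op.eval, hR₂.zero, e34]
    lia
  rintro _ rfl -
  set s₃ := Prog.steps [.op .plus 13 34 4] s₂ with hs₃
  have hR₃ : Ready π T s₃ := hR₂.of_eq (fun r _ hr => by simp [hs₃, Prog.steps, Prog.step]; lia)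
    fun _ _ => rfl
  refine (absorbProg_ends hπ hR₃ (v := b) (t := t + 1 + π.h) (by
    simp [hs₃, Prog.steps, Prog.step, Op.eval, hR₂.zero, e34]) (by lia) (by
    simp [hs₃, Prog.steps, Prog.step, h14]) (by lia) (A := _) (by
    simp only [hs₃, Prog.steps, Prog.step, MState.reg_setReg]; exact h15)).seq ?_
  rintro s₄ ⟨h14, h15⟩ hF
  have hR₄ := hR₃.of_frame hF (by decide) rfl
  have e37 : s₄.reg 37 = r := (hF.reg 37 rfl).trans (by simp [hs₃, Prog.steps, Prog.step, e37])
  refine (Prog.SafeAll.ends (l := [.op .plus 13 37 4]) ?_).seq ?_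
  · simp [Prog.SafeAll, Prog.Safe, Op.eval, hR₄.zero, e37]
    lia
  rintro _ rfl -
  set s₅ := Prog.steps [.op .plus 13 37 4] s₄ with hs₅
  have hR₅ : Ready π T s₅ := hR₄.of_eq (fun r _ hr => by simp [hs₅, Prog.steps, Prog.step]; lia)
    fun _ _ => rfl
  refine (absorbProg_ends hπ hR₅ (v := r) (t := t + 1 + π.h + π.h) (by
    simp [hs₅, Prog.steps, Prog.step, Op.eval, hR₄.zero, e37]) (by lia) (by
    simp [hs₅, Prog.steps, Prog.step, h14]) (by lia) (A := _) (by
    simp only [hs₅, Prog.steps, Prog.step, MState.reg_setReg]; exact h15)).seq ?_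
  rintro s₆ ⟨h14, h15⟩ hF
  have hR₆ := hR₅.of_frame hF (by decide) rfl
  refine (Prog.SafeAll.ends (l := [.op .plus 19 15 4]) ?_).mono le_rfl ?_
  · have := ZMod.val_lt (T t + bitSum T (t + 1) π.h a + bitSum T (t + 1 + π.h) π.h b +
      bitSum T (t + 1 + π.h + π.h) π.h r)
    simp [Prog.SafeAll, Prog.Safe, Op.eval, hR₆.zero, h15]
    lia
  · rintro _ rfl -
    simp [Prog.steps, Prog.step, Op.eval, hR₆.zero, h15, h14]
    lia

/-- Set register 20 to `1` if it is not zero or the name in register 19 is a splitting name for the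
random words at the address in register 14, and to `0` otherwise. -/
def splitProg : Prog :=
  .seq (.seqs [.op .plus 21 8 4]) <|
  .seq (.loop 21 <|
    .seq (.seqs [.load 15 14, .op .plus 14 14 3, .op .plus 13 19 4]) <|
    .seq absorbProg (.seqs [.op .less 22 15 9, .op .plus 20 20 22, .op .minus 21 21 3]))
    (.seqs [.op .less 20 4 20])

theorem splitProg_ends {π : Params} (hπ : Fits π) {T : ℕ → ZMod (2 ^ π.h)} {s : MState}
    (hs : Ready π T s) {v t f : ℕ} (hv : s.reg 19 = v) (hvw : v < 2 ^ π.w) (hf : s.reg 20 = f)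
    (hf1 : f ≤ 1) (ht : s.reg 14 = π.S + t) (htN : t + π.K * (π.h + 1) ≤ π.N) :
    splitProg.Ends π.w s (π.K * (10 * π.h + 12) + 5) fun s' =>
      s'.reg 20 = if f ≠ 0 ∨ isSplit π.K π.θ T t v = true then 1 else 0 := by
  have hmod := hπ.modulus
  have hmem := hπ.memory
  have hrows := hπ.rows
  have hθ := hπ.threshold
  refine ((Prog.SafeAll.ends (l := [.op .plus 21 8 4]) ?_).seq
    (B' := (π.K * ((4 + ((10 * π.h + 3) + 4)) + 1) + 1) + 2) ?_).mono (by simp; lia) fun _ h _ => h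
  · simp [Prog.SafeAll, Prog.Safe, Op.eval, hs.rows, hs.zero]
    lia
  rintro _ rfl -
  set s₁ := Prog.steps [.op .plus 21 8 4] s with hs₁
  have hR₁ : Ready π T s₁ := hs.of_eq (fun r _ hr => by simp [hs₁, Prog.steps, Prog.step]; lia)
    fun _ _ => rfl
  refine (Prog.Ends.loop_const π.K (fun i s' => s'.reg 21 = π.K - i ∧
    s'.reg 14 = π.S + (t + i * (π.h + 1)) ∧ s'.reg 20 ≤ 1 + i ∧ (s'.reg 20 ≠ 0 ↔
      f ≠ 0 ∨ ∃ a ∈ Finset.range i, (linHash T (t + a * (π.h + 1)) π.h v).val < π.θ)) ?_ ?_ ?_).seq ?_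
  · simp [hs₁, Prog.steps, Prog.step, Op.eval, hs.rows, hs.zero, ht, hf, hf1]
  · rintro i s' hi ⟨h21, h14, h20, hiff⟩ hF
    refine ⟨by lia, ?_⟩
    have hR' := hR₁.of_frame hF (by decide) rfl
    have h19 : s'.reg 19 = v := (hF.reg 19 rfl).trans (by simp [hs₁, Prog.steps, Prog.step, hv])
    have htab : t + i * (π.h + 1) + (π.h + 1) ≤ π.N := by
      have : (i + 1) * (π.h + 1) ≤ π.K * (π.h + 1) := Nat.mul_le_mul_right _ hi
      lia
    refine (Prog.SafeAll.ends (l := [.load 15 14, .op .plus 14 14 3, .op .plus 13 19 4]) ?_).seq ?_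
    · simp [Prog.SafeAll, Prog.Safe, Prog.step, Op.eval, hR'.one, hR'.zero, h14, h19]
      lia
    rintro _ rfl -
    set s₂ := Prog.steps [.load 15 14, .op .plus 14 14 3, .op .plus 13 19 4] s' with hs₂
    have hR₂ : Ready π T s₂ := hR'.of_eq (fun r _ hr => by simp [hs₂, Prog.steps, Prog.step]; lia)
      fun _ _ => rfl
    have e : s₂.reg 13 = v ∧ s₂.reg 14 = π.S + (t + i * (π.h + 1) + 1) ∧
        s₂.reg 15 = (T (t + i * (π.h + 1))).val ∧ s₂.reg 20 = s'.reg 20 ∧ s₂.reg 21 = s'.reg 21 := by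
      simp [hs₂, Prog.steps, Prog.step, Op.eval, hR'.one, hR'.zero, h14, h19,
        hR'.table (t + i * (π.h + 1)) (by lia), add_assoc]
    refine (absorbProg_ends hπ hR₂ e.1 hvw e.2.1 (by lia) e.2.2.1).seq ?_
    rintro s₃ ⟨g14, g15⟩ hF₃
    have hR₃ := hR₂.of_frame hF₃ (by decide) rfl
    have g20 : s₃.reg 20 = s'.reg 20 := (hF₃.reg 20 rfl).trans e.2.2.2.1
    have g21 : s₃.reg 21 = π.K - i := ((hF₃.reg 21 rfl).trans e.2.2.2.2).trans h21
    change s₃.reg 15 = (linHash T (t + i * (π.h + 1)) π.h v).val at g15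
    refine (Prog.SafeAll.ends ?_).mono le_rfl ?_
    · simp [Prog.SafeAll, Prog.Safe, Prog.step, Op.eval, hR₃.one, hR₃.threshold, g20, g21, g15]
      refine ⟨by split_ifs <;> lia, by split_ifs <;> lia, by lia⟩
    · rintro _ rfl -
      have hmul : (i + 1) * (π.h + 1) = i * (π.h + 1) + (π.h + 1) := by ring
      simp only [Prog.steps, Prog.step, Op.eval, MState.reg_setReg, Finset.range_add_one,
        Finset.exists_mem_insert]
      simp [hR₃.one, hR₃.threshold, g20, g21, g15, g14]
      refine ⟨by lia, by lia, by split_ifs <;> lia, ?_⟩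
      by_cases hlt : (linHash T (t + i * (π.h + 1)) π.h v).val < π.θ
      · simp [hlt]
      · simp only [hlt, false_or]
        simp only [Finset.mem_range] at hiff
        tauto
  · rintro s' ⟨h21, -⟩
    rw [h21, Nat.sub_self]
  · rintro s' ⟨-, -, h20, hiff⟩ hF
    have hR' := hR₁.of_frame hF (by decide) rfl
    refine (Prog.SafeAll.ends ?_).mono le_rfl ?_
    · simp [Prog.SafeAll, Prog.Safe, Op.eval, hR'.zero]
      split_ifs <;> lia
    · rintro _ rfl -
      simp only [Prog.steps, Prog.step, Op.eval, MState.reg_setReg, hR'.zero, if_true, isSplit,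
        decide_eq_true_eq, ← hiff, Nat.pos_iff_ne_zero]

/-- Append a node with the name in register 19 to the level under construction.  Register 20 tells
if it is the first of its block before the splitting. -/
def nodeProg : Prog :=
  .seq splitProg (.seqs [.op .plus 38 27 31, .store 38 19, .op .plus 38 28 31, .store 38 20,
    .op .plus 31 31 3])

theorem nodeProg_ends {π : Params} (hπ : Fits π) {T : ℕ → ZMod (2 ^ π.h)} {s : MState}
    (hs : Ready π T s) {v t f nb fb o : ℕ} (hv : s.reg 19 = v) (hvw : v < 2 ^ π.w) (hf : s.reg 20 = f)
    (hf1 : f ≤ 1) (ht : s.reg 14 = π.S + t) (htN : t + π.K * (π.h + 1) ≤ π.N)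
    (hnb : s.reg 27 = nb) (hfb : s.reg 28 = fb) (ho : s.reg 31 = o)
    (hw : nb + o < 2 ^ π.w) (hw' : fb + o < 2 ^ π.w) (hw1 : o + 1 < 2 ^ π.w) :
    nodeProg.Ends π.w s (π.K * (10 * π.h + 12) + 11) fun s' =>
      s'.reg 31 = o + 1 ∧ s'.mem = Function.update (Function.update s.mem (nb + o) v) (fb + o)
        (if f ≠ 0 ∨ isSplit π.K π.θ T t v = true then 1 else 0) := by
  refine ((splitProg_ends hπ hs hv hvw hf hf1 ht htN).seq (B' := 6) ?_).mono (by lia) fun _ h _ => h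
  intro s' h20 hF
  have hR' := hs.of_frame hF (by decide) rfl
  have g27 : s'.reg 27 = nb := (hF.reg 27 rfl).trans hnb
  have g28 : s'.reg 28 = fb := (hF.reg 28 rfl).trans hfb
  have g31 : s'.reg 31 = o := (hF.reg 31 rfl).trans ho
  have g19 : s'.reg 19 = v := (hF.reg 19 rfl).trans hv
  refine (Prog.SafeAll.ends ?_).mono le_rfl ?_
  · simp [Prog.SafeAll, Prog.Safe, Prog.step, Op.eval, hR'.one, g27, g28, g31]
    exact ⟨hw, hw', hw1⟩
  · rintro _ rfl -
    simp [Prog.steps, Prog.step, Op.eval, hR'.one, g27, g28, g31, g19, h20, hF.mem rfl]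


/-! ### Blocks as a list of marked nodes -/

/-- The nodes of a block; the first one is marked. -/
def markBlock : List Node → List (Node × Bool)
  | [] => []
  | n :: b => (n, true) :: b.map fun n => (n, false)

/-- The nodes of a sequence of blocks; the first node of every block is marked. -/
def markBlocks (bs : List (List Node)) : List (Node × Bool) := bs.flatMap markBlock

/-- The rule for joining marked nodes: a marked node starts a group. -/
def joinsMarked (j : ℕ) (c c' : Node × Bool) : Bool := joins j c.1 c'.1 && !c'.2

/-- The marked parent of a group of marked nodes: the mark is inherited from the first node, or is
set because the name of the parent is a splitting name. -/
def parentMarked {h : ℕ} (K θ : ℕ) (T : ℕ → ZMod (2 ^ h)) (t : ℕ) (g : List (Node × Bool)) :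
    Node × Bool :=
  (parentNode T t (g.map Prod.fst), (g.map Prod.snd).headD false ||
    isSplit K θ T (t + (3 * h + 1)) (parentNode T t (g.map Prod.fst)).name)

/-- The marked nodes of level `j`, after the splitting at this level. -/
def markedLevel {h : ℕ} (K θ : ℕ) (T : ℕ → ZMod (2 ^ h)) (x : List ℕ) (j : ℕ) :
    List (Node × Bool) := markBlocks (splitLevel K θ T x j)

/-- The groups of the marked nodes of level `j`. -/
def markedGroups {h : ℕ} (K θ : ℕ) (T : ℕ → ZMod (2 ^ h)) (x : List ℕ) (j : ℕ) :
    List (List (Node × Bool)) := (markedLevel K θ T x j).splitBy (joinsMarked j)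

section Marked

variable {h K θ : ℕ} {T : ℕ → ZMod (2 ^ h)} {x : List ℕ} {j : ℕ}

theorem map_fst_markBlock (b : List Node) : (markBlock b).map Prod.fst = b := by
  cases b with
  | nil => rfl
  | cons n b => simp [markBlock, Function.comp_def]

theorem map_fst_markBlocks (bs : List (List Node)) : (markBlocks bs).map Prod.fst = bs.flatten := by
  induction bs with
  | nil => rfl
  | cons b bs ih => simpa [markBlocks, map_fst_markBlock] using ih

theorem map_fst_markedLevel : (markedLevel K θ T x j).map Prod.fst = (level K θ T x j).flatten := by
  rw [markedLevel, map_fst_markBlocks, flatten_splitLevel]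

theorem List.splitBy_map {α β : Type*} (f : α → β) (R : β → β → Bool) : ∀ l : List α,
    (l.map f).splitBy R = (l.splitBy fun a b => R (f a) (f b)).map (List.map f)
  | [] => rfl
  | [a] => by simp [splitBy_of_isChain]
  | a :: b :: l => by
    have ih := List.splitBy_map f R (b :: l)
    simp only [map_cons] at ih ⊢
    cases h : R (f a) (f b)
    · rw [splitBy_cons_of_not_rel h, splitBy_cons_of_not_rel (R := fun a b => R (f a) (f b)) h, ih]
      simp
    · obtain ⟨g, gs, hg⟩ := exists_cons_of_ne_nil
        (splitBy_ne_nil (r := fun a b => R (f a) (f b)).2 (cons_ne_nil b l))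
      rw [hg] at ih
      rw [splitBy_cons_of_rel (R := fun a b => R (f a) (f b)) h hg, splitBy_cons_of_rel h ih]
      simp

theorem splitBy_joinsMarked_false (l : List Node) :
    (l.map fun n => (n, false)).splitBy (joinsMarked j) =
      (l.splitBy (joins j)).map (List.map fun n => (n, false)) := by
  rw [List.splitBy_map]
  simp [joinsMarked]

theorem splitBy_markBlock (b : List Node) : ∃ gs : List (List (Node × Bool)),
    (markBlock b).splitBy (joinsMarked j) = gs ∧
    gs.map (List.map Prod.fst) = b.splitBy (joins j) ∧
    gs.map (fun g => (g.map Prod.snd).headD false) = ((markBlock (List.replicate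
      (b.splitBy (joins j)).length (leafNode 0))).map Prod.snd) := by
  have hid : ∀ gs : List (List Node),
      (gs.map (List.map fun n => (n, false))).map (List.map Prod.fst) = gs := fun gs => by
    simp [Function.comp_def]
  have hfalse : ∀ gs : List (List Node), (gs.map (List.map fun n => (n, false))).map
      (fun g => (g.map Prod.snd).headD false) = List.replicate gs.length false := fun gs => by
    rw [List.map_map, List.eq_replicate_iff]
    refine ⟨by simp, fun f hf => ?_⟩
    obtain ⟨g, -, rfl⟩ := List.mem_map.1 hf
    cases g <;> simp
  have hrep : ∀ m, (markBlock (List.replicate (m + 1) (leafNode 0))).map Prod.snd =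
      true :: List.replicate m false := fun m => by
    simp [List.replicate_succ, markBlock]
  rcases b with _ | ⟨n, _ | ⟨m, b⟩⟩
  · exact ⟨[], rfl, rfl, rfl⟩
  · refine ⟨[[(n, true)]], ?_, ?_, ?_⟩
    · simp [markBlock, List.splitBy_of_isChain]
    · simp [List.splitBy_of_isChain]
    · simp [List.splitBy_of_isChain, markBlock]
  · have h1 := splitBy_joinsMarked_false (j := j) (m :: b)
    simp only [markBlock, List.map_cons] at h1 ⊢
    cases h : joins j n m
    · have h2 : joinsMarked j (n, true) (m, false) = false := by simp [joinsMarked, h]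
      refine ⟨_, rfl, ?_, ?_⟩
      · rw [List.splitBy_cons_of_not_rel h2, List.splitBy_cons_of_not_rel h, h1, List.map_cons, hid]
        rfl
      · rw [List.splitBy_cons_of_not_rel h2, List.splitBy_cons_of_not_rel h, h1, List.map_cons,
          hfalse, List.length_cons]
        exact (hrep _).symm
    · have h2 : joinsMarked j (n, true) (m, false) = true := by simp [joinsMarked, h]
      obtain ⟨g, gs, hg⟩ := List.exists_cons_of_ne_nil
        (List.splitBy_ne_nil (r := joins j).2 (List.cons_ne_nil m b))
      rw [hg, List.map_cons] at h1
      refine ⟨_, rfl, ?_, ?_⟩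
      · rw [List.splitBy_cons_of_rel h2 h1, List.splitBy_cons_of_rel h hg, List.map_cons, hid]
        simp [Function.comp_def]
      · rw [List.splitBy_cons_of_rel h2 h1, List.splitBy_cons_of_rel h hg, List.map_cons, hfalse,
          List.length_cons]
        exact (hrep _).symm

theorem markBlock_eq_zip (b : List Node) : markBlock b =
    b.zip ((markBlock (List.replicate b.length (leafNode 0))).map Prod.snd) := by
  rcases b with _ | ⟨n, b⟩
  · rfl
  · simp only [markBlock, List.length_cons, List.replicate_succ, List.map_cons, List.zip_cons_cons,
      List.map_replicate, List.cons.injEq, true_and]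
    induction b with
    | nil => rfl
    | cons m b ih => simpa [List.replicate_succ] using ih

/-- Marking commutes with grouping. -/
theorem markBlocks_groupBlocks (t : ℕ) (bs : List (List Node)) :
    markBlocks (groupBlocks T t j bs) = ((markBlocks bs).splitBy (joinsMarked j)).map fun g =>
      (parentNode T t (g.map Prod.fst), (g.map Prod.snd).headD false) := by
  induction bs with
  | nil => rfl
  | cons b bs ih =>
    have hsplit : (markBlocks (b :: bs)).splitBy (joinsMarked j) =
        (markBlock b).splitBy (joinsMarked j) ++ (markBlocks bs).splitBy (joinsMarked j) := by
      rw [markBlocks, List.flatMap_cons]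
      refine List.splitBy_append fun c _ c' hc' => ?_
      have : c'.2 = true := by
        clear ih
        induction bs with
        | nil => simp at hc'
        | cons b' bs ih =>
          rcases b' with _ | ⟨n, b'⟩
          · exact ih (by simpa [markBlock] using hc')
          · simp only [List.flatMap_cons, markBlock, List.cons_append, List.head?_cons,
              Option.mem_some_iff] at hc'
            rw [← hc']
      simp [joinsMarked, this]
    have hblock : markBlock ((b.splitBy (joins j)).map (parentNode T t)) =
        ((markBlock b).splitBy (joinsMarked j)).map fun g =>
          (parentNode T t (g.map Prod.fst), (g.map Prod.snd).headD false) := by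
      obtain ⟨gs, h1, h2, h3⟩ := splitBy_markBlock (j := j) b
      rw [h1, markBlock_eq_zip, List.length_map, ← h3, ← h2, List.map_map]
      clear h1 h2 h3
      induction gs with
      | nil => rfl
      | cons g gs ih => simpa using ih
    rw [hsplit, List.map_append, ← ih, ← hblock]
    rfl

/-- Marking commutes with splitting. -/
theorem markBlocks_splitBlocks (t : ℕ) {bs : List (List Node)} (hbs : [] ∉ bs) :
    markBlocks (splitBlocks K θ T t bs) =
      (markBlocks bs).map fun c => (c.1, c.2 || isSplit K θ T t c.1.name) := by
  induction bs with
  | nil => rfl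
  | cons b bs ih =>
    have hblock : ∀ b : List Node, b ≠ [] →
        markBlocks (b.splitBy fun _ n => !isSplit K θ T t n.name) =
        (markBlock b).map fun c => (c.1, c.2 || isSplit K θ T t c.1.name) := by
      intro b hb
      set R : Node → Node → Bool := fun _ n => !isSplit K θ T t n.name with hR
      induction b with
      | nil => exact absurd rfl hb
      | cons n b ih =>
        rcases b with _ | ⟨m, b⟩
        · simp [List.splitBy_of_isChain, markBlocks, markBlock]
        · have ih := ih (by simp)
          cases hm : isSplit K θ T t m.name
          · have hr : R n m = true := by simp [hR, hm]
            obtain ⟨g, gs, hg⟩ := List.exists_cons_of_ne_nil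
              (List.splitBy_ne_nil (r := R).2 (List.cons_ne_nil m b))
            obtain ⟨a, g, rfl⟩ := List.exists_cons_of_ne_nil
              (List.ne_nil_of_mem_splitBy (r := R) (l := m :: b) (hg ▸ List.mem_cons_self))
            rw [List.splitBy_cons_of_rel hr hg]
            rw [hg] at ih
            simp only [markBlocks, List.flatMap_cons, markBlock, List.map_cons, List.cons_append,
              List.cons.injEq, Prod.mk.injEq, Bool.true_or, and_true, true_and, hm,
              Bool.or_false] at ih ⊢
            exact ⟨ih.1, ih.2⟩
          · have hr : R n m = false := by simp [hR, hm]
            rw [List.splitBy_cons_of_not_rel hr]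
            simp only [markBlocks, List.flatMap_cons, markBlock, List.map_cons, List.map_nil] at ih ⊢
            rw [ih]
            simp [hm]
    have hb : b ≠ [] := fun h => hbs (by simp [h])
    have h1 : markBlocks (splitBlocks K θ T t (b :: bs)) =
        markBlocks (b.splitBy fun _ n => !isSplit K θ T t n.name) ++
          markBlocks (splitBlocks K θ T t bs) := by
      simp only [markBlocks, splitBlocks, List.flatMap_cons, List.flatMap_append]
    rw [h1, hblock b hb, ih fun h => hbs (by simp [h]), ← List.map_append]
    rfl

theorem markedLevel_succ : markedLevel K θ T x (j + 1) =
    (markedGroups K θ T x j).map (parentMarked K θ T ((j + 1) * chunk h K)) := by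
  rw [markedLevel, splitLevel, markBlocks_splitBlocks _ (nil_notMem_level _), level_succ,
    markBlocks_groupBlocks, List.map_map]
  rfl

theorem markedLevel_zero : markedLevel K θ T x 0 =
    (markBlock (leaves x)).map fun c => (c.1, c.2 || isSplit K θ T (3 * h + 1) c.1.name) := by
  rw [markedLevel, splitLevel, markBlocks_splitBlocks _ (nil_notMem_level _)]
  simp [level, markBlocks]

theorem length_markedLevel_le : (markedLevel K θ T x j).length ≤ x.length + 1 := by
  have := length_level_le (K := K) (θ := θ) (T := T) (x := x) j
  rwa [← map_fst_markedLevel, List.length_map] at this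

end Marked


/-! ### One parsing round of the program -/

/-- The nodes of a level are in memory: their names in the row at address `nb`, their marks in the
row at address `fb`. -/
def NodesAt (mem : ℕ → ℕ) (nb fb : ℕ) (F : List (Node × Bool)) : Prop :=
  ∀ i c, F[i]? = some c → mem (nb + i) = c.1.name ∧ mem (fb + i) = c.2.toNat

/-- The starting positions of the first `m` groups are in the row of memory at address `sb`. -/
def StartsAt (mem : ℕ → ℕ) (sb m : ℕ) (G : List (List (Node × Bool))) : Prop :=
  ∀ i < m, mem (sb + i) = (G.take i).flatten.length

theorem NodesAt.congr {mem mem' : ℕ → ℕ} {nb fb : ℕ} {F : List (Node × Bool)}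
    (h : NodesAt mem nb fb F) (hn : ∀ i < F.length, mem' (nb + i) = mem (nb + i))
    (hf : ∀ i < F.length, mem' (fb + i) = mem (fb + i)) : NodesAt mem' nb fb F := fun i c hc => by
  have hi := (List.getElem?_eq_some_iff.1 hc).1
  rw [hn i hi, hf i hi]
  exact h i c hc

theorem StartsAt.congr {mem mem' : ℕ → ℕ} {sb m : ℕ} {G : List (List (Node × Bool))}
    (h : StartsAt mem sb m G) (hs : ∀ i < m, mem' (sb + i) = mem (sb + i)) :
    StartsAt mem' sb m G := fun i hi => (hs i hi).trans (h i hi)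

theorem NodesAt.concat {mem : ℕ → ℕ} {nb fb : ℕ} {F : List (Node × Bool)} {c : Node × Bool}
    (h : NodesAt mem nb fb F) (hn : mem (nb + F.length) = c.1.name)
    (hf : mem (fb + F.length) = c.2.toNat) : NodesAt mem nb fb (F ++ [c]) := fun i c' hc => by
  rcases lt_trichotomy i F.length with hi | rfl | hi
  · exact h i c' (by rwa [List.getElem?_append_left hi] at hc)
  · obtain rfl : c = c' := by simpa using hc
    exact ⟨hn, hf⟩
  · rw [List.getElem?_eq_none (by simp; lia)] at hc
    cases hc

/-- Append the parent of a group to the next level.  The group starts at the index in register 32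
and ends before the index in register 30; register 34 holds its last name. -/
def closeGroupProg : Prog :=
  .seq (.seqs [.op .plus 38 24 32, .load 42 38, .op .minus 37 30 32, .op .plus 38 25 32, .load 20 38,
    .op .plus 38 26 31, .store 38 32, .op .plus 32 30 4]) <|
  .seq nameProg nodeProg

theorem closeGroupProg_ends {π : Params} (hπ : Fits π) {T : ℕ → ZMod (2 ^ π.h)} {s : MState}
    (hs : Ready π T s) {t B s0 o : ℕ} {g : List (Node × Bool)} (hg : g ≠ [])
    (hgn : ∀ c ∈ g, c.1.name < 2 ^ π.h) (hgl : g.length < 2 ^ π.h)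
    (hB : π.S + π.N ≤ B) (hBw : B + 6 * π.S < 2 ^ π.w) (hlen : s0 + g.length < π.S) (ho : o < π.S)
    (h24 : s.reg 24 = B + π.S) (h25 : s.reg 25 = B + 2 * π.S) (h26 : s.reg 26 = B + 3 * π.S)
    (h27 : s.reg 27 = B + 4 * π.S) (h28 : s.reg 28 = B + 5 * π.S)
    (h30 : s.reg 30 = s0 + g.length) (h31 : s.reg 31 = o) (h32 : s.reg 32 = s0)
    (h34 : s.reg 34 = lastName (g.map Prod.fst))
    (hfirst : s.mem (B + π.S + s0) = firstName (g.map Prod.fst))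
    (hflag : s.mem (B + 2 * π.S + s0) = ((g.map Prod.snd).headD false).toNat)
    (h40 : s.reg 40 = π.S + t) (ht : t + chunk π.h π.K ≤ π.N) :
    closeGroupProg.Ends π.w s (30 * π.h + 20 + (π.K * (10 * π.h + 12) + 11) + 9) fun s' =>
      s'.reg 31 = o + 1 ∧ s'.reg 32 = s0 + g.length ∧
      s'.mem = Function.update (Function.update (Function.update s.mem (B + 3 * π.S + o) s0)
        (B + 4 * π.S + o) (parentMarked π.K π.θ T t g).1.name)
        (B + 5 * π.S + o) (parentMarked π.K π.θ T t g).2.toNat := by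
  have hmod := hπ.modulus
  have hmem := hπ.memory
  rw [chunk] at ht
  have hne : g.map Prod.fst ≠ [] := by simpa using hg
  have hlt : firstName (g.map Prod.fst) < 2 ^ π.h ∧ lastName (g.map Prod.fst) < 2 ^ π.h := by
    obtain ⟨n, hn, hn1⟩ := firstName_mem hne
    obtain ⟨m, hm, hm1⟩ := lastName_mem hne
    obtain ⟨c, hc, rfl⟩ := List.mem_map.1 hn
    obtain ⟨d, hd, rfl⟩ := List.mem_map.1 hm
    exact ⟨hn1 ▸ hgn _ hc, hm1 ▸ hgn _ hd⟩
  have hflag1 : ((g.map Prod.snd).headD false).toNat ≤ 1 := Bool.toNat_le _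
  refine ((Prog.SafeAll.ends (l := [.op .plus 38 24 32, .load 42 38, .op .minus 37 30 32,
    .op .plus 38 25 32, .load 20 38, .op .plus 38 26 31, .store 38 32, .op .plus 32 30 4]) ?_).seq
    (B' := 30 * π.h + 20 + (π.K * (10 * π.h + 12) + 11)) ?_).mono (by simp; lia) fun _ h _ => h
  · simp [Prog.SafeAll, Prog.Safe, Prog.step, Op.eval, hs.zero, h24, h25, h26, h30, h31, h32]
    lia
  rintro _ rfl -
  set s₁ := Prog.steps [.op .plus 38 24 32, .load 42 38, .op .minus 37 30 32,
    .op .plus 38 25 32, .load 20 38, .op .plus 38 26 31, .store 38 32, .op .plus 32 30 4] s with hs₁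
  have hm₁ : s₁.mem = Function.update s.mem (B + 3 * π.S + o) s0 := by
    simp [hs₁, Prog.steps, Prog.step, Op.eval, h26, h31, h32]
  have hR₁ : Ready π T s₁ := hs.of_eq (fun r _ hr => by simp [hs₁, Prog.steps, Prog.step]; lia)
    fun a ha => by rw [hm₁, Function.update_of_ne (by lia)]
  have e₁ : s₁.reg 42 = firstName (g.map Prod.fst) ∧ s₁.reg 37 = g.length ∧
      s₁.reg 20 = ((g.map Prod.snd).headD false).toNat ∧ s₁.reg 32 = s0 + g.length := by
    simp [hs₁, Prog.steps, Prog.step, Op.eval, hs.zero, h24, h25, h30, h32, hfirst, hflag]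
  have k₁ : ∀ r, r = 27 ∨ r = 28 ∨ r = 31 ∨ r = 34 ∨ r = 40 → s₁.reg r = s.reg r := by
    rintro r (rfl | rfl | rfl | rfl | rfl) <;> simp [hs₁, Prog.steps, Prog.step]
  refine (nameProg_ends hπ hR₁ e₁.1 ((k₁ 34 (by simp)).trans h34) e₁.2.1 hlt.1 hlt.2 hgl
    ((k₁ 40 (by simp)).trans h40) (by lia)).seq ?_
  rintro s₂ ⟨h14, h19⟩ hF
  have hR₂ := hR₁.of_frame hF (by decide) rfl
  have hval : s₂.reg 19 = (parentMarked π.K π.θ T t g).1.name := by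
    rw [h19]
    simp [parentMarked, parentNode, groupKey]
  have hvlt : (parentMarked π.K π.θ T t g).1.name < 2 ^ π.h := by
    simp only [parentMarked, parentNode]
    exact ZMod.val_lt _
  refine (nodeProg_ends hπ hR₂ hval (by lia) ((hF.reg 20 rfl).trans e₁.2.2.1) hflag1 h14
    (by lia) (nb := B + 4 * π.S) (fb := B + 5 * π.S) (o := o)
    ((hF.reg 27 rfl).trans ((k₁ 27 (by simp)).trans h27))
    ((hF.reg 28 rfl).trans ((k₁ 28 (by simp)).trans h28))
    ((hF.reg 31 rfl).trans ((k₁ 31 (by simp)).trans h31)) (by lia) (by lia) (by lia)).mono le_rfl ?_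
  rintro s₃ ⟨h31, hm₃⟩ hF₃
  refine ⟨h31, ?_, ?_⟩
  · rw [hF₃.reg 32 rfl, hF.reg 32 rfl, e₁.2.2.2]
  · rw [hm₃, hF.mem rfl, hm₁]
    congr 1
    rw [parentMarked]
    cases (g.map Prod.snd).headD false <;>
      cases isSplit π.K π.θ T (t + (3 * π.h + 1)) (parentNode T t (g.map Prod.fst)).name <;> simp

/-- Set register 36 to a nonzero value if the node at the index before the one in register 30 is the
last one of its group, and put its name into register 34.  Register 39 holds the parity of the
round; the node is the last of its group if the next one is marked or the two names do not join. -/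
def testCutProg : List Prog :=
  [.op .plus 38 24 30, .load 34 38, .op .plus 30 30 3, .op .plus 38 24 30, .load 35 38,
    .op .plus 38 25 30, .load 36 38, .op .equal 33 34 35, .op .rem 44 34 5, .op .minus 44 3 44,
    .op .rem 45 35 5, .op .times 44 44 45, .op .times 44 39 44, .op .minus 45 3 39,
    .op .times 33 45 33, .op .plus 33 33 44, .op .minus 33 3 33, .op .plus 36 36 33]

/-- One parsing round: group the nodes of a level and write their parents to the next level.
Registers 24 and 25 hold the addresses of the names and the marks of the level, registers 26, 27
and 28 those of the starting positions, the names and the marks of the next one; register 29 holds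
the number of nodes, register 30 the current index, register 31 the number of finished groups and
register 32 the start of the current group.  A marked cell behind the last node closes the last
group. -/
def roundProg : Prog :=
  .seq (.seqs [.op .plus 24 23 10, .op .plus 25 24 10, .op .plus 26 25 10, .op .plus 27 26 10,
    .op .plus 28 27 10, .op .plus 30 4 4, .op .plus 31 4 4, .op .plus 32 4 4, .op .less 33 30 29]) <|
  .seq (.loop 33 <| .seq (.seqs testCutProg) <| .seq (.branch 36 closeGroupProg .skip) <|
    .seqs [.op .less 33 30 29])
  (.seqs [.op .plus 38 26 31, .store 38 30, .op .plus 38 28 31, .store 38 3, .op .plus 29 31 4])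

theorem joins_value (j : ℕ) (n n' : Node) {a b : ℕ} (ha : n.name = a) (hb : n'.name = b) :
    (if a = b then 1 - j % 2 else 0) + j % 2 * ((1 - a % 2) * (b % 2)) = (joins j n n').toNat := by
  subst ha hb
  rcases Nat.mod_two_eq_zero_or_one j with hj | hj
  · simp only [hj, joins, if_true]
    by_cases h : n.name = n'.name <;> simp [h]
  · simp only [hj, joins]
    rcases Nat.mod_two_eq_zero_or_one n.name with h | h <;>
      rcases Nat.mod_two_eq_zero_or_one n'.name with h' | h' <;> simp [h, h']

theorem testCutProg_ends {π : Params} (hπ : Fits π) {T : ℕ → ZMod (2 ^ π.h)} {s : MState}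
    (hs : Ready π T s) {B i j : ℕ} {F : List (Node × Bool)}
    (hFn : ∀ c ∈ F, c.1.name < 2 ^ π.h) (hBw : B + 6 * π.S < 2 ^ π.w) (hlen : F.length < π.S)
    (hF : NodesAt s.mem (B + π.S) (B + 2 * π.S) F) (hend : s.mem (B + 2 * π.S + F.length) = 1)
    (h24 : s.reg 24 = B + π.S) (h25 : s.reg 25 = B + 2 * π.S) (h30 : s.reg 30 = i)
    (h39 : s.reg 39 = j % 2) (hi : i < F.length) :
    (Prog.seqs testCutProg).Ends π.w s 19 fun s' => s'.reg 30 = i + 1 ∧ s'.reg 34 = F[i].1.name ∧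
      (s'.reg 36 = 0 ↔ ∃ c ∈ F[i + 1]?, joinsMarked j F[i] c = true) := by
  have hmod := hπ.modulus
  have hmem := hπ.memory
  have h1 := hF i F[i] (by simp)
  have ha := hFn F[i] (List.getElem_mem hi)
  have hj2 : j % 2 < 2 := Nat.mod_lt _ (by lia)
  have hw4 : 4 ≤ 2 ^ π.w := by
    have := Nat.one_le_two_pow (n := π.h)
    have : 2 ^ 1 < 2 ^ π.w := by lia
    calc 4 = 2 ^ 2 := rfl
      _ ≤ 2 ^ π.w := Nat.pow_le_pow_right (by lia) ((Nat.pow_lt_pow_iff_right (by lia)).1 this)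
  -- The value that the tests produce, whatever the memory holds at the index `i + 1`.
  set b := s.mem (B + π.S + (i + 1)) with hb
  set f := s.mem (B + 2 * π.S + (i + 1)) with hf
  have hf1 : f ≤ 1 := by
    rcases (Nat.succ_le_of_lt hi).lt_or_eq with h | h
    · rw [hf, (hF (i + 1) F[i + 1] (by simp)).2]
      exact Bool.toNat_le _
    · rw [hf, show i + 1 = F.length from h, hend]
  obtain ⟨v, hv, hv1⟩ : ∃ v, (if F[i].1.name = b then 1 - j % 2 else 0) +
      j % 2 * ((1 - F[i].1.name % 2) * (b % 2)) = v ∧ v ≤ 1 :=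
    ⟨_, joins_value j F[i].1 (leafNode b) rfl rfl, Bool.toNat_le _⟩
  have p1 : (1 - F[i].1.name % 2) * (b % 2) ≤ 1 := by
    calc _ ≤ 1 * 1 := Nat.mul_le_mul (by lia) (by lia)
      _ = 1 := rfl
  have p2 : j % 2 * ((1 - F[i].1.name % 2) * (b % 2)) ≤ 1 := by lia
  have p3 : (if F[i].1.name = b then 1 - j % 2 else 0) ≤ 1 := by lia
  refine (Prog.SafeAll.ends ?_).mono (by simp [testCutProg]) ?_
  · simp only [testCutProg, Prog.SafeAll, Prog.Safe, Prog.step, Op.eval, MState.reg_setReg,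
      MState.mem_setReg]
    simp [hs.one, hs.two, h24, h25, h30, h39, h1.1, ← hb, ← hf, hv]
    clear hv
    generalize j % 2 * ((1 - F[i].1.name % 2) * (b % 2)) = p at p2 ⊢
    generalize (1 - F[i].1.name % 2) * (b % 2) = p at p1 ⊢
    generalize (if F[i].1.name = b then 1 - j % 2 else 0) = p at p3 ⊢
    refine ⟨by lia, by lia, by lia, by lia, by split_ifs <;> lia, by lia, by lia, by lia, by lia,
      by lia, by lia, by lia, by lia, by lia, by lia⟩
  · rintro _ rfl -
    simp only [testCutProg, Prog.steps, Prog.step, Op.eval, MState.reg_setReg, MState.mem_setReg]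
    simp [hs.one, hs.two, h24, h25, h30, h39, h1.1, ← hb, ← hf, hv, joinsMarked, -Prod.exists]
    rcases (Nat.succ_le_of_lt hi).lt_or_eq with h | h
    · have h2 := hF (i + 1) F[i + 1] (by simp)
      rw [← hb, ← hf] at h2
      have h3 := joins_value j F[i].1 F[i + 1].1 rfl h2.1.symm
      rw [hv] at h3
      rw [h3, h2.2, List.getElem?_eq_getElem (h : i + 1 < F.length)]
      obtain ⟨n, f'⟩ := F[i + 1]
      cases hj : joins j F[i].1 n <;> cases f' <;> simp [hj]
    · have h2 : f = 1 := by rw [hf, show i + 1 = F.length from h, hend]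
      rw [List.getElem?_eq_none (by lia)]
      simp [h2]

/-- The number of steps for one node of a round. -/
def nodeCost (π : Params) : ℕ := 30 * π.h + π.K * (10 * π.h + 12) + 63

/-- The state of the machine before the node with index `i` of a level is grouped: `A` is the part
of the level whose groups are complete, and `g` is the part of the current group before `i`. -/
structure Grouping (π : Params) (T : ℕ → ZMod (2 ^ π.h)) (B t j : ℕ) (F : List (Node × Bool))
    (m₀ : ℕ → ℕ) (i : ℕ) (s : MState) (A g : List (Node × Bool)) : Prop where
  ready : Ready π T s
  take : F.take i = A ++ g
  cut : ∀ c ∈ A.getLast?, ∀ c' ∈ F[A.length]?, joinsMarked j c c' = false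
  chain : (g ++ F[i]?.toList).IsChain fun c c' => joinsMarked j c c' = true
  done : i = F.length → g = []
  mem : ∀ a < B + 3 * π.S, s.mem a = m₀ a
  starts : StartsAt s.mem (B + 3 * π.S) (A.splitBy (joinsMarked j)).length
    (A.splitBy (joinsMarked j))
  nodes : NodesAt s.mem (B + 4 * π.S) (B + 5 * π.S)
    ((A.splitBy (joinsMarked j)).map (parentMarked π.K π.θ T t))
  index : s.reg 30 = i
  count : s.reg 31 = (A.splitBy (joinsMarked j)).length
  start : s.reg 32 = A.length
  test : s.reg 33 = if i < F.length then 1 else 0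

theorem roundProg_ends {π : Params} (hπ : Fits π) {T : ℕ → ZMod (2 ^ π.h)} {s : MState}
    (hs : Ready π T s) {B t j : ℕ} {F : List (Node × Bool)}
    (hFn : ∀ c ∈ F, c.1.name < 2 ^ π.h) (hFl : F.length < 2 ^ π.h)
    (hB : π.S + π.N ≤ B) (hBw : B + 6 * π.S < 2 ^ π.w) (hlen : F.length < π.S)
    (hF : NodesAt s.mem (B + π.S) (B + 2 * π.S) F) (hend : s.mem (B + 2 * π.S + F.length) = 1)
    (h23 : s.reg 23 = B) (h29 : s.reg 29 = F.length) (h39 : s.reg 39 = j % 2)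
    (h40 : s.reg 40 = π.S + t) (ht : t + chunk π.h π.K ≤ π.N) :
    roundProg.Ends π.w s (F.length * (nodeCost π + 1) + 17) fun s' =>
      Ready π T s' ∧ s'.reg 26 = B + 3 * π.S ∧
      s'.reg 29 = (F.splitBy (joinsMarked j)).length ∧ (∀ a < B + 3 * π.S, s'.mem a = s.mem a) ∧
      StartsAt s'.mem (B + 3 * π.S) ((F.splitBy (joinsMarked j)).length + 1)
        (F.splitBy (joinsMarked j)) ∧
      NodesAt s'.mem (B + 4 * π.S) (B + 5 * π.S)
        ((F.splitBy (joinsMarked j)).map (parentMarked π.K π.θ T t)) ∧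
      s'.mem (B + 5 * π.S + (F.splitBy (joinsMarked j)).length) = 1 := by
  have hmod := hπ.modulus
  have hmem := hπ.memory
  have hpow := Nat.one_le_two_pow (n := π.h)
  refine ((Prog.SafeAll.ends (l := [.op .plus 24 23 10, .op .plus 25 24 10, .op .plus 26 25 10,
    .op .plus 27 26 10, .op .plus 28 27 10, .op .plus 30 4 4, .op .plus 31 4 4, .op .plus 32 4 4,
    .op .less 33 30 29]) ?_).seq (B' := (F.length * (nodeCost π + 1) + 1) + 6) ?_).mono
    (by simp; lia) fun _ h _ => h
  · simp [Prog.SafeAll, Prog.Safe, Prog.step, Op.eval, hs.zero, hs.size, h23]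
    split_ifs <;> lia
  rintro _ rfl -
  set s₁ := Prog.steps [.op .plus 24 23 10, .op .plus 25 24 10, .op .plus 26 25 10,
    .op .plus 27 26 10, .op .plus 28 27 10, .op .plus 30 4 4, .op .plus 31 4 4, .op .plus 32 4 4,
    .op .less 33 30 29] s with hs₁
  have hm₁ : s₁.mem = s.mem := rfl
  have hR₁ : Ready π T s₁ := hs.of_eq (fun r _ hr => by simp [hs₁, Prog.steps, Prog.step]; lia)
    fun _ _ => rfl
  have e : s₁.reg 24 = B + π.S ∧ s₁.reg 25 = B + 2 * π.S ∧ s₁.reg 26 = B + 3 * π.S ∧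
      s₁.reg 27 = B + 4 * π.S ∧ s₁.reg 28 = B + 5 * π.S ∧ s₁.reg 29 = F.length ∧
      s₁.reg 30 = 0 ∧ s₁.reg 31 = 0 ∧ s₁.reg 32 = 0 ∧ s₁.reg 39 = j % 2 ∧ s₁.reg 40 = π.S + t ∧
      s₁.reg 33 = if 0 < F.length then 1 else 0 := by
    simp [hs₁, Prog.steps, Prog.step, Op.eval, hs.zero, hs.size, h23, h29, h39, h40]
    lia
  obtain ⟨e24, e25, e26, e27, e28, e29, e30, e31, e32, e39, e40, e33⟩ := e
  refine (Prog.Ends.loop_const F.length (fun i s' => ∃ A g, Grouping π T B t j F s.mem i s' A g)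
    ?_ ?_ ?_).seq ?_
  · refine ⟨[], [], hR₁, by simp, by simp, ?_, by simp, fun a _ => rfl, by simp [StartsAt],
      by simp [NodesAt], e30, by simpa using e31, by simpa using e32, e33⟩
    cases F[0]? <;> simp
  · rintro i s₂ hi ⟨A, g, hG⟩ hfr
    have k : ∀ r, r = 24 ∨ r = 25 ∨ r = 26 ∨ r = 27 ∨ r = 28 ∨ r = 29 ∨ r = 39 ∨ r = 40 →
        s₂.reg r = s₁.reg r := by
      rintro r (rfl | rfl | rfl | rfl | rfl | rfl | rfl | rfl) <;> exact hfr.reg _ rfl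
    refine ⟨by rw [hG.test, if_pos hi]; lia, ?_⟩
    have hAg : A.length + g.length = i := by
      have := congrArg List.length hG.take
      simp at this
      lia
    have hFi : F[i]?.toList = [F[i]] := by simp [hi]
    have hF₂ : NodesAt s₂.mem (B + π.S) (B + 2 * π.S) F :=
      hF.congr (fun a ha => hG.mem _ (by lia)) fun a ha => hG.mem _ (by lia)
    refine ((testCutProg_ends hπ hG.ready hFn hBw hlen hF₂ (by rw [hG.mem _ (by lia), hend])
      ((k 24 (by simp)).trans e24) ((k 25 (by simp)).trans e25) hG.index
      ((k 39 (by simp)).trans e39) hi).seq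
      (B' := ((30 * π.h + 20 + (π.K * (10 * π.h + 12) + 11) + 9) + 1) + 2) ?_).mono
      (by rw [nodeCost]; lia) fun _ h _ => h
    rintro s₃ ⟨h30, h34, h36⟩ hF₃
    have hR₃ := hG.ready.of_frame hF₃ (by decide) rfl
    have hm₃ : s₃.mem = s₂.mem := hF₃.mem rfl
    have k₃ : ∀ r, r = 24 ∨ r = 25 ∨ r = 26 ∨ r = 27 ∨ r = 28 ∨ r = 29 ∨ r = 39 ∨ r = 40 ∨
        r = 31 ∨ r = 32 → s₃.reg r = s₂.reg r := by
      rintro r (rfl | rfl | rfl | rfl | rfl | rfl | rfl | rfl | rfl | rfl) <;>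
        exact hF₃.reg _ rfl
    have htake : F.take (i + 1) = A ++ (g ++ [F[i]]) := by
      rw [List.take_add_one, hG.take, List.append_assoc]
      simp [hi]
    have hFdrop : F = A ++ (g ++ [F[i]] ++ F.drop (i + 1)) := by
      conv_lhs => rw [← List.take_append_drop (i + 1) F, htake]
      simp
    have hget : ∀ m, F[A.length + m]? = (g ++ [F[i]] ++ F.drop (i + 1))[m]? := fun m => by
      conv_lhs => rw [hFdrop]
      rw [List.getElem?_append_right (by lia)]
      congr 1
      lia
    have hchain : (g ++ [F[i]]).IsChain fun c c' => joinsMarked j c c' = true := by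
      have := hG.chain
      rwa [hFi] at this
    have hlast : (g ++ [F[i]]).getLast? = some F[i] := by simp
    -- After the branch all parts of the invariant hold except for the loop test.
    refine (Prog.Ends.branch (Q := fun s' => ∃ A' g', Grouping π T B t j F s.mem (i + 1)
      (s'.setReg 33 (if i + 1 < F.length then 1 else 0)) A' g') ?_ ?_).seq ?_
    · intro hne
      set G := A.splitBy (joinsMarked j) with hGdef
      have hsplit : (A ++ (g ++ [F[i]])).splitBy (joinsMarked j) = G ++ [g ++ [F[i]]] := by
        rw [List.splitBy_append, List.splitBy_of_isChain (by simp) hchain]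
        intro c hc c' hc'
        refine hG.cut c hc c' ?_
        have := hget 0
        rw [Nat.add_zero] at this
        rw [this]
        cases g <;> simpa [hi] using hc'
      have hGfl : G.flatten = A := List.flatten_splitBy _ _
      have hGl : G.length ≤ A.length := length_splitBy_le _ _
      have hgF : ∀ c ∈ g ++ [F[i]], c ∈ F := fun c hc => by
        rw [hFdrop]
        simp only [List.mem_append] at hc ⊢
        tauto
      have hhead : F[A.length]? = (g ++ [F[i]])[0]? := by
        have := hget 0
        rw [Nat.add_zero] at this
        rw [this]
        cases g <;> simp
      obtain ⟨c₀, g₀, hc₀⟩ := List.exists_cons_of_ne_nil (l := g ++ [F[i]]) (by simp)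
      rw [hc₀, List.getElem?_cons_zero] at hhead
      have hA := hF₂ _ _ hhead
      refine (closeGroupProg_ends hπ hR₃ (g := g ++ [F[i]]) (t := t) (B := B) (s0 := A.length)
        (o := G.length) (by simp) (fun c hc => hFn c (hgF c hc)) (by simp; lia) hB hBw
        (by simp; lia) (by lia)
        ((k₃ 24 (by simp)).trans ((k 24 (by simp)).trans e24))
        ((k₃ 25 (by simp)).trans ((k 25 (by simp)).trans e25))
        ((k₃ 26 (by simp)).trans ((k 26 (by simp)).trans e26))
        ((k₃ 27 (by simp)).trans ((k 27 (by simp)).trans e27))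
        ((k₃ 28 (by simp)).trans ((k 28 (by simp)).trans e28))
        (by rw [h30]; simp; lia) ((k₃ 31 (by simp)).trans hG.count)
        ((k₃ 32 (by simp)).trans hG.start) (by simp [h34, lastName])
        (by rw [hm₃, hA.1, hc₀]; rfl) (by rw [hm₃, hA.2, hc₀]; rfl)
        ((k₃ 40 (by simp)).trans ((k 40 (by simp)).trans e40)) ht).mono le_rfl ?_
      rintro s₄ ⟨h31, h32, hm₄⟩ hF₄
      have hother : ∀ a, a ≠ B + 3 * π.S + G.length → a ≠ B + 4 * π.S + G.length →
          a ≠ B + 5 * π.S + G.length → s₄.mem a = s₂.mem a := fun a h1 h2 h3 => by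
        rw [hm₄, Function.update_of_ne h3, Function.update_of_ne h2, Function.update_of_ne h1, hm₃]
      refine ⟨A ++ (g ++ [F[i]]), [], ?_⟩
      refine ⟨hR₃.of_eq (fun r h1 h2 => ?_) fun a ha => ?_, by simpa using htake, ?_, ?_,
        fun _ => rfl, fun a ha => ?_, ?_, ?_, ?_, ?_, ?_, by simp⟩
      · have : closeGroupProg.writes r = false := by interval_cases r <;> rfl
        simp only [MState.reg_setReg, if_neg (show r ≠ 33 by lia), hF₄.reg r this]
      · rw [MState.mem_setReg, hother a (by lia) (by lia) (by lia), hm₃]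
      · intro c hc c' hc'
        have hlen' : (A ++ (g ++ [F[i]])).length = i + 1 := by simp; lia
        rw [hlen'] at hc'
        rw [List.getLast?_append, hlast] at hc
        obtain rfl : F[i] = c := by simpa using hc
        by_contra hj
        exact hne (h36.2 ⟨c', hc', by simpa using hj⟩)
      · cases F[i + 1]? <;> simp
      · rw [MState.mem_setReg, hother a (by lia) (by lia) (by lia), hG.mem a ha]
      · rw [MState.mem_setReg, hsplit]
        intro m hm
        rw [List.length_append, List.length_singleton] at hm
        rcases (Nat.lt_succ_iff.1 hm).lt_or_eq with h | rfl
        · rw [hother _ (by lia) (by lia) (by lia), hG.starts m h, List.take_append_of_le_length h.le]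
        · rw [hm₄, Function.update_of_ne (by lia), Function.update_of_ne (by lia),
            Function.update_self, List.take_left, hGfl]
      · rw [MState.mem_setReg, hsplit, List.map_append, List.map_singleton]
        refine NodesAt.concat (hG.nodes.congr (fun m hm => ?_) fun m hm => ?_) ?_ ?_
        · rw [List.length_map] at hm
          exact hother _ (by lia) (by lia) (by lia)
        · rw [List.length_map] at hm
          exact hother _ (by lia) (by lia) (by lia)
        · rw [List.length_map, hm₄, Function.update_of_ne (by lia), Function.update_self]
        · rw [List.length_map, hm₄, Function.update_self]
      · simp only [MState.reg_setReg]
        exact (hF₄.reg 30 rfl).trans h30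
      · simp [hsplit, h31]
      · simp [h32]
    · intro hzero
      obtain ⟨c', hc', hj⟩ := h36.1 hzero
      have hlt : i + 1 < F.length := (List.getElem?_eq_some_iff.1 hc').1
      refine ⟨1, s₃, .skip s₃, by lia, A, g ++ [F[i]], ?_⟩
      refine ⟨hR₃.of_eq (fun r h1 h2 => by simp; lia) fun a ha => rfl, htake, hG.cut, ?_,
        fun h => by lia, fun a ha => ?_, ?_, ?_, ?_, ?_, ?_, by simp⟩
      · obtain rfl : c' = F[i + 1] := by
          rw [List.getElem?_eq_getElem hlt] at hc'
          exact (Option.some.inj hc').symm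
        rw [List.getElem?_eq_getElem hlt, Option.toList_some, List.isChain_append]
        refine ⟨hchain, by simp, fun c hc d hd => ?_⟩
        rw [hlast] at hc
        obtain rfl : F[i] = c := by simpa using hc
        obtain rfl : F[i + 1] = d := by simpa using hd
        exact hj
      · rw [MState.mem_setReg, hm₃, hG.mem a ha]
      · rw [MState.mem_setReg, hm₃]
        exact hG.starts
      · rw [MState.mem_setReg, hm₃]
        exact hG.nodes
      · simpa using h30
      · simpa using (k₃ 31 (by simp)).trans hG.count
      · simpa using (k₃ 32 (by simp)).trans hG.start
    · rintro s₄ ⟨A', g', hG'⟩ hF₄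
      have h30' : s₄.reg 30 = i + 1 := by simpa using hG'.index
      have h29' : s₄.reg 29 = F.length :=
        (hF₄.reg 29 rfl).trans ((k₃ 29 (by simp)).trans ((k 29 (by simp)).trans e29))
      refine (Prog.SafeAll.ends (l := [.op .less 33 30 29]) ?_).mono le_rfl ?_
      · simp [Prog.SafeAll, Prog.Safe, Op.eval]
        split_ifs <;> lia
      · rintro _ rfl -
        refine ⟨A', g', ?_⟩
        simpa [Prog.steps, Prog.step, Op.eval, h30', h29'] using hG'
  · rintro s' ⟨A, g, hG⟩
    simp [hG.test]
  · rintro s₂ ⟨A, g, hG⟩ hfr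
    obtain rfl := hG.done rfl
    obtain rfl : F = A := by simpa using hG.take
    have hR := hG.ready
    have k26 : s₂.reg 26 = B + 3 * π.S := (hfr.reg 26 rfl).trans e26
    have k28 : s₂.reg 28 = B + 5 * π.S := (hfr.reg 28 rfl).trans e28
    have hGl : (F.splitBy (joinsMarked j)).length ≤ F.length := length_splitBy_le _ _
    refine (Prog.SafeAll.ends ?_).mono le_rfl ?_
    · simp [Prog.SafeAll, Prog.Safe, Prog.step, Op.eval, hR.zero, k26, k28, hG.count]
      lia
    · rintro _ rfl -
      set G := F.splitBy (joinsMarked j) with hGdef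
      have hcount : s₂.reg 31 = G.length := hG.count
      have hm : ∀ s', s' = Prog.steps [.op .plus 38 26 31, .store 38 30, .op .plus 38 28 31,
          .store 38 3, .op .plus 29 31 4] s₂ → s'.mem = Function.update (Function.update s₂.mem
            (B + 3 * π.S + G.length) F.length) (B + 5 * π.S + G.length) 1 := by
        rintro _ rfl
        simp [Prog.steps, Prog.step, Op.eval, hR.one, k26, k28, hcount, hG.index]
      rw [hm _ rfl]
      have hother : ∀ a, a ≠ B + 3 * π.S + G.length → a ≠ B + 5 * π.S + G.length →
          Function.update (Function.update s₂.mem (B + 3 * π.S + G.length) F.length)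
            (B + 5 * π.S + G.length) 1 a = s₂.mem a := fun a h1 h2 => by
        rw [Function.update_of_ne h2, Function.update_of_ne h1]
      refine ⟨hR.of_eq (fun r h1 h2 => ?_) fun a ha => ?_, ?_, ?_, fun a ha => ?_, fun m hm' => ?_,
        hG.nodes.congr (fun m hm' => ?_) fun m hm' => ?_, ?_⟩
      · simp [Prog.steps, Prog.step]
        lia
      · rw [hm _ rfl, hother a (by lia) (by lia)]
      · simpa [Prog.steps, Prog.step] using k26
      · simpa [Prog.steps, Prog.step, Op.eval, hR.zero] using hcount
      · rw [hother a (by lia) (by lia), hG.mem a ha]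
      · rcases (Nat.lt_succ_iff.1 hm').lt_or_eq with h | rfl
        · rw [hother _ (by lia) (by lia), hG.starts m h]
        · rw [Function.update_of_ne (by lia), Function.update_self, List.take_length,
            List.flatten_splitBy]
      · rw [List.length_map] at hm'
        exact hother _ (by lia) (by lia)
      · rw [List.length_map] at hm'
        exact hother _ (by lia) (by lia)
      · rw [Function.update_self]


/-! ### All parsing rounds of the program -/

/-- The address of the rows of level `j`: the starting positions of the groups below, the names and
the marks. -/
def Params.base (π : Params) (j : ℕ) : ℕ := π.S + π.N + 3 * j * π.S

/-- The levels `0, …, i` of the derivation forest above `x` are in memory. -/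
structure LevelsAt (π : Params) (T : ℕ → ZMod (2 ^ π.h)) (x : List ℕ) (mem : ℕ → ℕ) (i : ℕ) :
    Prop where
  nodes : ∀ j ≤ i, NodesAt mem (π.base j + π.S) (π.base j + 2 * π.S) (markedLevel π.K π.θ T x j)
  starts : ∀ j < i, StartsAt mem (π.base (j + 1)) ((markedGroups π.K π.θ T x j).length + 1)
    (markedGroups π.K π.θ T x j)

/-- Write the first level: a sentinel, and a leaf for every letter. -/
def leavesProg : Prog :=
  .seq (.seqs [.op .plus 23 10 11, .op .plus 27 23 10, .op .plus 28 27 10, .op .plus 31 4 4,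
    .op .plus 47 10 43, .op .plus 19 4 4, .op .plus 20 3 4, .op .plus 14 47 4]) <|
  .seq nodeProg <|
  .seq (.seqs [.op .plus 30 4 4, .op .less 33 30 2]) <|
  .seq (.loop 33 <|
    .seq (.seqs [.load 19 30, .op .plus 19 19 3, .op .plus 20 4 4, .op .plus 14 47 4]) <|
    .seq nodeProg (.seqs [.op .plus 30 30 3, .op .less 33 30 2]))
  (.seqs [.op .plus 38 28 31, .store 38 3, .op .plus 29 31 4, .op .plus 39 4 4, .op .plus 41 12 4,
    .op .plus 40 10 46])

/-- Write all levels. -/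
def levelsProg : Prog :=
  .seq leavesProg <| .loop 41 <| .seq roundProg <|
    .seqs [.op .plus 23 26 4, .op .minus 39 3 39, .op .minus 41 41 3, .op .plus 40 40 46]

theorem markedLevel_zero_eq {h K θ : ℕ} {T : ℕ → ZMod (2 ^ h)} {x : List ℕ} :
    markedLevel K θ T x 0 = (leafNode 0, true) :: x.map fun c =>
      (leafNode (c + 1), isSplit K θ T (3 * h + 1) (c + 1)) := by
  rw [markedLevel_zero]
  simp [leaves, markBlock, leafNode]

theorem leavesProg_ends {π : Params} (hπ : Fits π) {T : ℕ → ZMod (2 ^ π.h)} {s : MState}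
    (hs : Ready π T s) {x : List ℕ} (hx : ∀ c ∈ x, c + 1 < 2 ^ π.h) (hxS : x.length + 1 < π.S)
    (hN : chunk π.h π.K ≤ π.N) (h2 : s.reg 2 = x.length) (h43 : s.reg 43 = 3 * π.h + 1)
    (h46 : s.reg 46 = chunk π.h π.K) (hmx : ∀ i c, x[i]? = some c → s.mem i = c) :
    leavesProg.Ends π.w s ((x.length + 1) * (nodeCost π + 1) + 26) fun s' =>
      Ready π T s' ∧ LevelsAt π T x s'.mem 0 ∧
      s'.mem (π.base 0 + 2 * π.S + (x.length + 1)) = 1 ∧ s'.reg 23 = π.base 0 ∧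
      s'.reg 29 = x.length + 1 ∧ s'.reg 39 = 0 ∧ s'.reg 41 = π.J ∧
      s'.reg 40 = π.S + chunk π.h π.K := by
  have hmod := hπ.modulus
  have hmem := hπ.memory
  have hpow := Nat.one_le_two_pow (n := π.h)
  have hB : π.base 0 = π.S + π.N := by simp [Params.base]
  rw [hB]
  set B := π.S + π.N with hBdef
  have hBw : B + 4 * π.S < 2 ^ π.w := by
    have : (3 * π.J + 4) * π.S = 3 * π.J * π.S + 4 * π.S := by ring
    lia
  have hJ : π.J < 2 ^ π.w := by
    have : π.J * 1 ≤ π.J * π.S := Nat.mul_le_mul_left _ hπ.size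
    have : (3 * π.J + 4) * π.S = 3 * (π.J * π.S) + 4 * π.S := by ring
    lia
  have hck : chunk π.h π.K = 3 * π.h + 1 + π.K * (π.h + 1) := rfl
  refine ((Prog.SafeAll.ends (l := [.op .plus 23 10 11, .op .plus 27 23 10, .op .plus 28 27 10,
    .op .plus 31 4 4, .op .plus 47 10 43, .op .plus 19 4 4, .op .plus 20 3 4, .op .plus 14 47 4])
    ?_).seq (B' := (π.K * (10 * π.h + 12) + 11) + (3 + ((x.length * (nodeCost π + 1) + 1) + 7)))
    ?_).mono (by rw [nodeCost]; simp; lia) fun _ h _ => h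
  · simp [Prog.SafeAll, Prog.Safe, Prog.step, Op.eval, hs.zero, hs.one, hs.size, hs.words, h43]
    lia
  rintro _ rfl -
  set s₁ := Prog.steps [.op .plus 23 10 11, .op .plus 27 23 10, .op .plus 28 27 10,
    .op .plus 31 4 4, .op .plus 47 10 43, .op .plus 19 4 4, .op .plus 20 3 4, .op .plus 14 47 4] s
    with hs₁
  have hm₁ : s₁.mem = s.mem := rfl
  have hR₁ : Ready π T s₁ := hs.of_eq (fun r _ hr => by simp [hs₁, Prog.steps, Prog.step]; lia)
    fun _ _ => rfl
  have e : s₁.reg 23 = B ∧ s₁.reg 27 = B + π.S ∧ s₁.reg 28 = B + 2 * π.S ∧ s₁.reg 31 = 0 ∧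
      s₁.reg 47 = π.S + (3 * π.h + 1) ∧ s₁.reg 19 = 0 ∧ s₁.reg 20 = 1 ∧
      s₁.reg 14 = π.S + (3 * π.h + 1) ∧ s₁.reg 2 = x.length ∧ s₁.reg 46 = chunk π.h π.K := by
    simp [hs₁, Prog.steps, Prog.step, Op.eval, hs.zero, hs.one, hs.size, hs.words, h43, h2, h46]
    lia
  obtain ⟨e23, e27, e28, e31, e47, e19, e20, e14, e2, e46⟩ := e
  refine (nodeProg_ends hπ hR₁ e19 (by lia) e20 le_rfl e14 (by lia) e27 e28 e31 (by lia) (by lia)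
    (by lia)).seq ?_
  rintro s₂ ⟨h31, hm₂⟩ hF₂
  have k₂ : ∀ r, r < 13 ∨ r = 23 ∨ r = 27 ∨ r = 28 ∨ r = 46 ∨ r = 47 → s₂.reg r = s₁.reg r := by
    rintro r (hr | rfl | rfl | rfl | rfl | rfl)
    · exact hF₂.reg r (by interval_cases r <;> rfl)
    all_goals exact hF₂.reg _ rfl
  have hR₂ : Ready π T s₂ := hR₁.of_eq (fun r _ hr => k₂ r (.inl hr)) fun a ha => by
    rw [hm₂, Function.update_of_ne (by lia), Function.update_of_ne (by lia)]
  refine (Prog.SafeAll.ends (l := [.op .plus 30 4 4, .op .less 33 30 2]) ?_).seq ?_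
  · simp [Prog.SafeAll, Prog.Safe, Prog.step, Op.eval, hR₂.zero]
    split_ifs <;> lia
  rintro _ rfl -
  set s₃ := Prog.steps [.op .plus 30 4 4, .op .less 33 30 2] s₂ with hs₃
  have k₃ : ∀ r, r ≠ 30 → r ≠ 33 → s₃.reg r = s₂.reg r := fun r h1 h2 => by
    simp [hs₃, Prog.steps, Prog.step, h1, h2]
  have hR₃ : Ready π T s₃ := hR₂.of_eq (fun r _ hr => k₃ r (by lia) (by lia)) fun _ _ => rfl
  have e30 : s₃.reg 30 = 0 ∧ s₃.reg 33 = if 0 < x.length then 1 else 0 := by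
    simp [hs₃, Prog.steps, Prog.step, Op.eval, hR₂.zero, k₂ 2 (by simp), e2]
  have hother₁ : ∀ a < B, s₃.mem a = s.mem a := fun a ha => by
    change s₂.mem a = _
    rw [hm₂, Function.update_of_ne (by lia), Function.update_of_ne (by lia), hm₁]
  set F := markedLevel π.K π.θ T x 0 with hFdef
  have hFl : F.length = x.length + 1 := by rw [hFdef, markedLevel_zero_eq]; simp
  refine (Prog.Ends.loop_const x.length (fun i s' => Ready π T s' ∧ s'.reg 30 = i ∧
    s'.reg 31 = i + 1 ∧ (s'.reg 33 = if i < x.length then 1 else 0) ∧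
    (∀ a < B, s'.mem a = s.mem a) ∧ NodesAt s'.mem (B + π.S) (B + 2 * π.S) (F.take (i + 1)))
    ?_ ?_ ?_).seq ?_
  · refine ⟨hR₃, e30.1, (k₃ 31 (by lia) (by lia)).trans h31, e30.2, hother₁, ?_⟩
    have hF1 : F.take (0 + 1) = [] ++ [(leafNode 0, true)] := by rw [hFdef, markedLevel_zero_eq]; rfl
    rw [hF1]
    refine NodesAt.concat (by simp [NodesAt]) ?_ ?_
    · change s₂.mem _ = _
      rw [hm₂, Function.update_of_ne (by simp; lia)]
      simp [leafNode]
    · change s₂.mem _ = _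
      rw [hm₂]
      simp
  · rintro i s₄ hi ⟨hR₄, h30, h31, h33, hmem₄, hnodes⟩ hfr
    refine ⟨by rw [h33, if_pos hi]; lia, ?_⟩
    have k₄ : ∀ r, r = 2 ∨ r = 27 ∨ r = 28 ∨ r = 47 → s₄.reg r = s₁.reg r := by
      rintro r (rfl | rfl | rfl | rfl) <;> rw [hfr.reg _ rfl, k₃ _ (by lia) (by lia), k₂ _ (by simp)]
    have hxi : s₄.mem i = x[i] := by rw [hmem₄ i (by lia), hmx i x[i] (by simp)]
    have hxi' := hx x[i] (List.getElem_mem hi)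
    refine ((Prog.SafeAll.ends (l := [.load 19 30, .op .plus 19 19 3, .op .plus 20 4 4,
      .op .plus 14 47 4]) ?_).seq (B' := (π.K * (10 * π.h + 12) + 11) + 3) ?_).mono
      (by rw [nodeCost]; simp; lia) fun _ h _ => h
    · simp [Prog.SafeAll, Prog.Safe, Prog.step, Op.eval, hR₄.zero, hR₄.one, h30, hxi,
        k₄ 47 (by simp), e47]
      lia
    rintro _ rfl -
    set s₅ := Prog.steps [.load 19 30, .op .plus 19 19 3, .op .plus 20 4 4, .op .plus 14 47 4] s₄
      with hs₅
    have k₅ : ∀ r, r ≠ 14 → r ≠ 19 → r ≠ 20 → s₅.reg r = s₄.reg r := fun r h1 h2 h3 => by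
      simp [hs₅, Prog.steps, Prog.step, h1, h2, h3]
    have hR₅ : Ready π T s₅ := hR₄.of_eq (fun r _ hr => k₅ r (by lia) (by lia) (by lia))
      fun _ _ => rfl
    have e₅ : s₅.reg 19 = x[i] + 1 ∧ s₅.reg 20 = 0 ∧ s₅.reg 14 = π.S + (3 * π.h + 1) := by
      simp [hs₅, Prog.steps, Prog.step, Op.eval, hR₄.zero, hR₄.one, h30, hxi, k₄ 47 (by simp), e47]
    refine (nodeProg_ends hπ hR₅ e₅.1 (by lia) e₅.2.1 (by lia) e₅.2.2 (by lia)
      ((k₅ 27 (by lia) (by lia) (by lia)).trans ((k₄ 27 (by simp)).trans e27))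
      ((k₅ 28 (by lia) (by lia) (by lia)).trans ((k₄ 28 (by simp)).trans e28))
      ((k₅ 31 (by lia) (by lia) (by lia)).trans h31) (by lia) (by lia) (by lia)).seq ?_
    rintro s₆ ⟨h31', hm₆⟩ hF₆
    have k₆ : ∀ r, r < 13 ∨ r = 30 → s₆.reg r = s₄.reg r := by
      rintro r (hr | rfl)
      · rw [hF₆.reg r (by interval_cases r <;> rfl), k₅ r (by lia) (by lia) (by lia)]
      · rw [hF₆.reg 30 rfl, k₅ 30 (by lia) (by lia) (by lia)]
    have hother : ∀ a, a ≠ B + π.S + (i + 1) → a ≠ B + 2 * π.S + (i + 1) →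
        s₆.mem a = s₄.mem a := fun a h1 h2 => by
      rw [hm₆, Function.update_of_ne h2, Function.update_of_ne h1]
      rfl
    have h30' : s₆.reg 30 = i := (k₆ 30 (by simp)).trans h30
    have h2' : s₆.reg 2 = x.length := by rw [k₆ 2 (by simp), k₄ 2 (by simp), e2]
    have h3' : s₆.reg 3 = 1 := by rw [k₆ 3 (by simp), hR₄.one]
    refine (Prog.SafeAll.ends (l := [.op .plus 30 30 3, .op .less 33 30 2]) ?_).mono le_rfl ?_
    · simp [Prog.SafeAll, Prog.Safe, Prog.step, Op.eval, h30', h3']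
      split_ifs <;> lia
    rintro _ rfl -
    refine ⟨hR₄.of_eq (fun r h1 h2 => ?_) fun a ha => hother a (by lia) (by lia), ?_, ?_, ?_,
      fun a ha => (hother a (by lia) (by lia)).trans (hmem₄ a ha), ?_⟩
    · rw [← k₆ r (.inl h2)]
      simp [Prog.steps, Prog.step]
      lia
    · simp [Prog.steps, Prog.step, Op.eval, h30', h3']
    · simpa [Prog.steps, Prog.step] using h31'
    · simp [Prog.steps, Prog.step, Op.eval, h30', h3', h2']
    · have hFi : F[i + 1]? = some (leafNode (x[i] + 1), isSplit π.K π.θ T (3 * π.h + 1) (x[i] + 1)) := by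
        rw [hFdef, markedLevel_zero_eq]
        simp [hi]
      rw [List.take_add_one, hFi, Option.toList_some]
      have hl : (F.take (i + 1)).length = i + 1 := by simp; lia
      refine NodesAt.concat (hnodes.congr (fun m hm => ?_) fun m hm => ?_) ?_ ?_
      · exact hother _ (by lia) (by lia)
      · exact hother _ (by lia) (by lia)
      · change s₆.mem _ = _
        rw [hl, hm₆, Function.update_of_ne (by lia), Function.update_self]
        rfl
      · change s₆.mem _ = _
        rw [hl, hm₆, Function.update_self]
        cases isSplit π.K π.θ T (3 * π.h + 1) (x[i] + 1) <;> rfl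
  · rintro s' ⟨-, -, -, h33, -⟩
    simp [h33]
  · rintro s₄ ⟨hR₄, h30, h31, -, hmem₄, hnodes⟩ hfr
    rw [List.take_of_length_le (by lia)] at hnodes
    have k₄ : ∀ r, r = 23 ∨ r = 28 ∨ r = 46 → s₄.reg r = s₁.reg r := by
      rintro r (rfl | rfl | rfl) <;> rw [hfr.reg _ rfl, k₃ _ (by lia) (by lia), k₂ _ (by simp)]
    have e28' := (k₄ 28 (by simp)).trans e28
    have e46' := (k₄ 46 (by simp)).trans e46
    refine (Prog.SafeAll.ends ?_).mono le_rfl ?_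
    · simp [Prog.SafeAll, Prog.Safe, Prog.step, Op.eval, hR₄.zero, hR₄.rounds, hR₄.size, e28', e46',
        h31]
      lia
    · rintro s' hs' -
      have hms : s'.mem = Function.update s₄.mem (B + 2 * π.S + (x.length + 1)) 1 := by
        simp [hs', Prog.steps, Prog.step, Op.eval, hR₄.one, e28', h31]
      refine ⟨hR₄.of_eq (fun r h1 h2 => ?_) fun a ha => ?_, ⟨fun j hj => ?_, by simp⟩, ?_, ?_, ?_,
        ?_, ?_, ?_⟩
      · simp [hs', Prog.steps, Prog.step]
        lia
      · rw [hms, Function.update_of_ne (by lia)]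
      · obtain rfl : j = 0 := by lia
        rw [hB]
        refine hnodes.congr (fun m hm => ?_) fun m hm => ?_ <;>
          rw [hms, Function.update_of_ne (by lia)]
      · rw [hms, Function.update_self]
      · simpa [hs', Prog.steps, Prog.step] using (k₄ 23 (by simp)).trans e23
      · simp [hs', Prog.steps, Prog.step, Op.eval, h31, hR₄.zero]
      · simp [hs', Prog.steps, Prog.step, Op.eval, hR₄.zero]
      · simp [hs', Prog.steps, Prog.step, Op.eval, hR₄.zero, hR₄.rounds]
      · simp [hs', Prog.steps, Prog.step, Op.eval, hR₄.size, e46']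

theorem Params.base_succ (π : Params) (j : ℕ) : π.base (j + 1) = π.base j + 3 * π.S := by
  simp only [Params.base]
  ring

theorem Params.base_le (π : Params) {i j : ℕ} (hij : i ≤ j) : π.base i ≤ π.base j :=
  Nat.add_le_add_left (Nat.mul_le_mul_right _ (Nat.mul_le_mul_left 3 hij)) _

theorem Fits.base_lt {π : Params} (hπ : Fits π) {j : ℕ} (hj : j ≤ π.J) :
    π.base j + 4 * π.S < 2 ^ π.w := by
  have h1 := π.base_le hj
  have h2 := hπ.memory
  have h3 : (3 * π.J + 4) * π.S = 3 * π.J * π.S + 4 * π.S := by ring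
  have h4 : π.base π.J = π.S + π.N + 3 * π.J * π.S := rfl
  lia

theorem levelsProg_ends {π : Params} (hπ : Fits π) {T : ℕ → ZMod (2 ^ π.h)} {s : MState}
    (hs : Ready π T s) {x : List ℕ} (hx : ∀ c ∈ x, c + 1 < 2 ^ π.h)
    (hxl : x.length + 1 < 2 ^ π.h) (hxS : x.length + 1 < π.S)
    (hN : (π.J + 1) * chunk π.h π.K ≤ π.N) (h2 : s.reg 2 = x.length) (h43 : s.reg 43 = 3 * π.h + 1)
    (h46 : s.reg 46 = chunk π.h π.K) (hmx : ∀ i c, x[i]? = some c → s.mem i = c) :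
    levelsProg.Ends π.w s ((π.J + 1) * ((x.length + 1) * (nodeCost π + 1) + 27)) fun s' =>
      Ready π T s' ∧ LevelsAt π T x s'.mem π.J ∧ s'.reg 23 = π.base π.J ∧
      s'.reg 29 = (markedLevel π.K π.θ T x π.J).length := by
  have hmod := hπ.modulus
  have hmem := hπ.memory
  have hpow := Nat.one_le_two_pow (n := π.h)
  have hck : ∀ j, (j + 1) * chunk π.h π.K = j * chunk π.h π.K + chunk π.h π.K :=
    fun j => Nat.succ_mul j _
  have hck' : ∀ j ≤ π.J, (j + 1) * chunk π.h π.K ≤ π.N := fun j hj =>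
    (Nat.mul_le_mul_right _ (by lia)).trans hN
  refine ((leavesProg_ends hπ hs hx hxS (by simpa using hck' 0 (by lia)) h2 h43 h46 hmx).seq
    (B' := π.J * ((((x.length + 1) * (nodeCost π + 1) + 17) + 5) + 1) + 1) ?_).mono ?_
      fun _ h _ => h
  · rintro s₁ ⟨hR₁, hL₁, ht₁, e23, e29, e39, e41, e40⟩ hF₁
    have e46 : s₁.reg 46 = chunk π.h π.K := (hF₁.reg 46 rfl).trans h46
    refine (Prog.Ends.loop_const π.J (fun i s' => Ready π T s' ∧ LevelsAt π T x s'.mem i ∧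
      s'.mem (π.base i + 2 * π.S + (markedLevel π.K π.θ T x i).length) = 1 ∧
      s'.reg 23 = π.base i ∧ s'.reg 29 = (markedLevel π.K π.θ T x i).length ∧
      s'.reg 39 = i % 2 ∧ s'.reg 41 = π.J - i ∧ s'.reg 40 = π.S + (i + 1) * chunk π.h π.K)
      ?_ ?_ ?_).mono le_rfl ?_
    · have : (markedLevel π.K π.θ T x 0).length = x.length + 1 := by
        rw [markedLevel_zero_eq]
        simp
      rw [this]
      exact ⟨hR₁, hL₁, ht₁, e23, e29, e39, by simpa using e41, by simpa using e40⟩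
    · rintro i s₂ hi ⟨hR₂, hL₂, ht₂, h23, h29, h39, h41, h40⟩ hfr
      refine ⟨by lia, ?_⟩
      set F := markedLevel π.K π.θ T x i with hF
      have hFl : F.length ≤ x.length + 1 := length_markedLevel_le
      have hFn : ∀ c ∈ F, c.1.name < 2 ^ π.h := fun c hc => name_lt hx (by
        rw [← map_fst_markedLevel (K := π.K)]
        exact List.mem_map_of_mem hc)
      have hbw := hπ.base_lt (j := i + 1) (by lia)
      rw [π.base_succ] at hbw
      have hi2 := hck' (i + 1) (by lia)
      have hi3 := hck (i + 1)
      have h46' : s₂.reg 46 = chunk π.h π.K := (hfr.reg 46 rfl).trans e46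
      refine ((roundProg_ends hπ hR₂ (B := π.base i) (t := (i + 1) * chunk π.h π.K) (j := i) hFn
        (by lia) (by simp [Params.base]) (by lia) (by lia) (hL₂.nodes i le_rfl) ht₂ h23 h29 h39 h40
        (by lia)).seq (B' := 5) ?_).mono ?_ fun _ h _ => h
      · rintro s₃ ⟨hR₃, h26, h29', hm₃, hst, hnd, hend⟩ hF₃
        have k₃ : ∀ r, r = 39 ∨ r = 40 ∨ r = 41 ∨ r = 46 → s₃.reg r = s₂.reg r := by
          rintro r (rfl | rfl | rfl | rfl) <;> exact hF₃.reg _ rfl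
        have g39 := (k₃ 39 (by simp)).trans h39
        have g40 := (k₃ 40 (by simp)).trans h40
        have g41 := (k₃ 41 (by simp)).trans h41
        have g46 := (k₃ 46 (by simp)).trans h46'
        have hJ : π.J < 2 ^ π.w := by
          have := Nat.mul_le_mul_left π.J hπ.size
          have : (3 * π.J + 4) * π.S = 3 * (π.J * π.S) + 4 * π.S := by ring
          lia
        refine (Prog.SafeAll.ends ?_).mono le_rfl ?_
        · simp [Prog.SafeAll, Prog.Safe, Prog.step, Op.eval, hR₃.zero, hR₃.one, h26, g39, g40, g41,
            g46]
          lia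
        · rintro s' hs' -
          have hms : s'.mem = s₃.mem := by rw [hs']; rfl
          have hFF : (markedGroups π.K π.θ T x i).map (parentMarked π.K π.θ T
              ((i + 1) * chunk π.h π.K)) = markedLevel π.K π.θ T x (i + 1) := markedLevel_succ.symm
          have hll : (markedLevel π.K π.θ T x (i + 1)).length =
              (F.splitBy (joinsMarked i)).length := by rw [← hFF, List.length_map]; rfl
          refine ⟨hR₃.of_eq (fun r h1 h2 => ?_) fun a ha => by rw [hms], ⟨fun j hj => ?_,
            fun j hj => ?_⟩, ?_, ?_, ?_, ?_, ?_, ?_⟩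
          · simp [hs', Prog.steps, Prog.step]
            lia
          · rw [hms]
            rcases hj.lt_or_eq with h | rfl
            · have hb := π.base_le (Nat.le_of_lt_succ h)
              have hl : (markedLevel π.K π.θ T x j).length ≤ x.length + 1 := length_markedLevel_le
              exact (hL₂.nodes j (by lia)).congr (fun m hm => hm₃ _ (by lia))
                fun m hm => hm₃ _ (by lia)
            · rw [← hFF, π.base_succ]
              have a1 : π.base i + 3 * π.S + π.S = π.base i + 4 * π.S := by ring
              have a2 : π.base i + 3 * π.S + 2 * π.S = π.base i + 5 * π.S := by ring
              rw [a1, a2]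
              exact hnd
          · rw [hms]
            rcases (Nat.lt_succ_iff.1 hj).lt_or_eq with h | rfl
            · have hb := π.base_le (Nat.succ_le_of_lt h)
              have hl : (markedLevel π.K π.θ T x j).length ≤ x.length + 1 := length_markedLevel_le
              have hl' : (markedGroups π.K π.θ T x j).length ≤ x.length + 1 :=
                (length_splitBy_le _ _).trans hl
              exact (hL₂.starts j h).congr fun m hm => hm₃ _ (by lia)
            · rw [π.base_succ]
              exact hst
          · rw [hms, hll, π.base_succ, show π.base i + 3 * π.S + 2 * π.S = π.base i + 5 * π.S by ring]
            exact hend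
          · simp [hs', Prog.steps, Prog.step, Op.eval, hR₃.zero, h26, π.base_succ]
          · rw [hll, ← h29']
            simp [hs', Prog.steps, Prog.step]
          · simp [hs', Prog.steps, Prog.step, Op.eval, hR₃.one, g39]
            lia
          · simp [hs', Prog.steps, Prog.step, Op.eval, hR₃.one, g41]
            lia
          · simp [hs', Prog.steps, Prog.step, Op.eval, g40, g46]
            lia
      · have := Nat.mul_le_mul_right (nodeCost π + 1) hFl
        lia
    · rintro s' ⟨-, -, -, -, -, -, h41, -⟩
      rw [h41, Nat.sub_self]
    · rintro s' ⟨hR, hL, -, h23, h29, -⟩ -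
      exact ⟨hR, hL, h23, h29⟩
  · ring_nf
    lia


/-! ### The grammars in terms of positions -/

/-- The entries of a list with an index from `a` to `b - 1`. -/
def List.segment {α : Type*} (l : List α) (a b : ℕ) : List α := (l.take b).drop a

theorem List.segment_succ {α : Type*} {l : List α} {a b : ℕ} (hab : a ≤ b) (hb : b < l.length) :
    l.segment a (b + 1) = l.segment a b ++ [l[b]] := by
  rw [segment, take_add_one, drop_append_of_le_length (by simp; lia), getElem?_eq_getElem hb]
  rfl

theorem List.segment_self {α : Type*} (l : List α) (a : ℕ) : l.segment a a = [] := by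
  simp [segment]

theorem List.segment_map {α β : Type*} (f : α → β) (l : List α) (a b : ℕ) :
    (l.map f).segment a b = (l.segment a b).map f := by
  simp [segment]

theorem List.segment_flatten {α : Type*} (G : List (List α)) {a b : ℕ} (hab : a ≤ b) :
    G.flatten.segment (G.take a).flatten.length (G.take b).flatten.length =
      (G.segment a b).flatten := by
  have h1 : G.flatten = (G.take b).flatten ++ (G.drop b).flatten := by
    rw [← flatten_append, take_append_drop]
  have h2 : (G.take b).flatten = (G.take a).flatten ++ (G.segment a b).flatten := by
    rw [← flatten_append, segment, show G.take a = (G.take b).take a by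
      rw [take_take, Nat.min_eq_left hab], take_append_drop]
  rw [segment, h1, take_left, h2, drop_left]

theorem List.getElem?_flatten_take {α : Type*} {G : List (List α)} {a m : ℕ} (ha : a < G.length)
    (hm : m < G[a].length) : G.flatten[(G.take a).flatten.length + m]? = G[a][m]? := by
  have h1 : G.flatten = (G.take a).flatten ++ (G[a] ++ (G.drop (a + 1)).flatten) := by
    rw [← flatten_cons, ← drop_eq_getElem_cons ha, ← flatten_append, take_append_drop]
  conv_lhs => rw [h1]
  rw [getElem?_append_right (by lia), Nat.add_sub_cancel_left, getElem?_append_left hm]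

section Positions

variable {h : ℕ} (K θ : ℕ) (T : ℕ → ZMod (2 ^ h)) (x : List ℕ) (J : ℕ)

/-- The number of nodes of level `J - i` below the first `p` nodes of level `J`. -/
def nodesBelow (p : ℕ) : ℕ → ℕ
  | 0 => p
  | i + 1 => ((markedGroups K θ T x (J - 1 - i)).take (nodesBelow p i)).flatten.length

/-- The rules of the nodes of level `J - i` below the node with index `p` of level `J`. -/
def rulesBelow (p i : ℕ) : List Rule :=
  ((markedLevel K θ T x (J - i)).segment (nodesBelow K θ T x J p i)
    (nodesBelow K θ T x J (p + 1) i)).map fun c => c.1.rule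

/-- The rules of the grammar of the node with index `p` of level `J`, in the order in which the
program writes them. -/
def grammarRules (p : ℕ) (n : Node) : List Rule :=
  ⟨none, .power (.nonterminal n.name) 1⟩ :: (List.range (J + 1)).flatMap (rulesBelow K θ T x J p)

variable {K θ T x J}

theorem nodesBelow_mono {p p' : ℕ} (hp : p ≤ p') :
    ∀ i, nodesBelow K θ T x J p i ≤ nodesBelow K θ T x J p' i
  | 0 => hp
  | i + 1 => by
    have h1 : (markedGroups K θ T x (J - 1 - i)).take (nodesBelow K θ T x J p i) <+:
        (markedGroups K θ T x (J - 1 - i)).take (nodesBelow K θ T x J p' i) :=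
      List.take_prefix_take_left (nodesBelow_mono hp i)
    exact (List.IsPrefix.flatten h1).length_le

theorem nodesBelow_le {p : ℕ} (hp : p ≤ (markedLevel K θ T x J).length) :
    ∀ i ≤ J, nodesBelow K θ T x J p i ≤ (markedLevel K θ T x (J - i)).length
  | 0, _ => hp
  | i + 1, hi => by
    have h1 := (List.IsPrefix.flatten (List.take_prefix (nodesBelow K θ T x J p i)
      (markedGroups K θ T x (J - 1 - i)))).length_le
    rw [markedGroups, List.flatten_splitBy] at h1
    rw [nodesBelow, ← show J - 1 - i = J - (i + 1) by lia]
    exact h1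

theorem length_rulesBelow {p : ℕ} (hp : p < (markedLevel K θ T x J).length) {i : ℕ} (hi : i ≤ J) :
    (rulesBelow K θ T x J p i).length =
      nodesBelow K θ T x J (p + 1) i - nodesBelow K θ T x J p i := by
  have := nodesBelow_le (K := K) (θ := θ) (T := T) (p := p + 1) hp i hi
  simp [rulesBelow, List.segment]
  lia

/-- The rules at and below a segment of level `j + 1` are the rules of this segment, and those at
and below the segment of level `j` that it covers. -/
theorem mem_allRules_segment {j a b : ℕ} (hab : a ≤ b) (ρ : Rule) :
    ρ ∈ allRules (((markedLevel K θ T x (j + 1)).segment a b).map Prod.fst) ↔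
      ρ ∈ ((markedLevel K θ T x (j + 1)).segment a b).map (fun c => c.1.rule) ∨
      ρ ∈ allRules (((markedLevel K θ T x j).segment
        ((markedGroups K θ T x j).take a).flatten.length
        ((markedGroups K θ T x j).take b).flatten.length).map Prod.fst) := by
  have h1 : markedLevel K θ T x j = (markedGroups K θ T x j).flatten := by
    rw [markedGroups, List.flatten_splitBy]
  rw [h1, List.segment_flatten _ hab, markedLevel_succ, List.segment_map]
  induction (markedGroups K θ T x j).segment a b with
  | nil => simp [allRules]
  | cons g gs ih =>
    have h2 : ∀ l l' : List Node, allRules (l ++ l') = allRules l ++ allRules l' :=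
      fun l l' => List.flatMap_append
    have h3 : ∀ n (l : List Node), allRules (n :: l) = n.rule :: (n.sub ++ allRules l) :=
      fun n l => rfl
    simp only [List.map_cons, List.flatten_cons, List.map_append, h2, h3, List.mem_cons,
      List.mem_append] at ih ⊢
    simp only [parentMarked, parentNode] at ih ⊢
    tauto

/-- Following the starting positions of the groups down the levels reaches exactly the nodes below a
node, so the rules that the program writes are those of the grammar of the node. -/
theorem toFinset_grammarRules {p : ℕ} (hp : p < (markedLevel K θ T x J).length) :
    (grammarRules K θ T x J p (markedLevel K θ T x J)[p].1).toFinset =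
      nodeGrammar (markedLevel K θ T x J)[p].1 := by
  have key : ∀ i ≤ J, ∀ ρ, ρ ∈ allRules [(markedLevel K θ T x J)[p].1] ↔
      ρ ∈ (List.range i).flatMap (rulesBelow K θ T x J p) ∨
      ρ ∈ allRules (((markedLevel K θ T x (J - i)).segment (nodesBelow K θ T x J p i)
        (nodesBelow K θ T x J (p + 1) i)).map Prod.fst) := by
    intro i
    induction i with
    | zero =>
      intro _ ρ
      simp [nodesBelow, List.segment_succ le_rfl hp, List.segment_self]
    | succ i ih =>
      intro hi ρ
      obtain ⟨j, hj⟩ : ∃ j, J - i = j + 1 := ⟨J - i - 1, by lia⟩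
      have hj' : J - (i + 1) = j ∧ J - 1 - i = j := by lia
      rw [ih (by lia), List.range_succ, List.flatMap_append, List.flatMap_singleton, rulesBelow, hj,
        mem_allRules_segment (nodesBelow_mono (by lia) i), List.mem_append, or_assoc]
      simp only [nodesBelow, hj'.1, hj'.2]
  have hsub : ∀ n ∈ (level K θ T x 0).flatten, n.sub = [] := fun n hn => by
    simp only [level, List.flatten_singleton, leaves, List.mem_cons, List.mem_map] at hn
    rcases hn with rfl | ⟨c, _, rfl⟩ <;> rfl
  ext ρ
  have h1 := key J le_rfl ρ
  rw [Nat.sub_self] at h1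
  have h2 : ρ ∈ allRules (((markedLevel K θ T x 0).segment (nodesBelow K θ T x J p J)
      (nodesBelow K θ T x J (p + 1) J)).map Prod.fst) ↔ ρ ∈ rulesBelow K θ T x J p J := by
    have hmem : ∀ c ∈ (markedLevel K θ T x 0).segment (nodesBelow K θ T x J p J)
        (nodesBelow K θ T x J (p + 1) J), c.1.sub = [] := fun c hc => by
      refine hsub _ ?_
      rw [← map_fst_markedLevel]
      exact List.mem_map_of_mem (List.mem_of_mem_take (List.mem_of_mem_drop hc))
    simp only [rulesBelow, Nat.sub_self, allRules, List.mem_flatMap, List.mem_map, List.mem_cons]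
    constructor
    · rintro ⟨_, ⟨c, hc, rfl⟩, rfl | hρ⟩
      · exact ⟨c, hc, rfl⟩
      · rw [hmem c hc] at hρ
        cases hρ
    · rintro ⟨c, hc, rfl⟩
      exact ⟨_, ⟨c, hc, rfl⟩, .inl rfl⟩
  rw [h2] at h1
  have h3 : ρ ∈ allRules [(markedLevel K θ T x J)[p].1] ↔ ρ = (markedLevel K θ T x J)[p].1.rule ∨
      ρ ∈ (markedLevel K θ T x J)[p].1.sub := by
    simp [allRules]
  rw [h3] at h1
  rw [grammarRules, nodeGrammar, List.mem_toFinset, List.mem_toFinset, List.mem_cons, List.mem_cons,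
    List.mem_cons, h1, List.range_succ, List.flatMap_append, List.flatMap_singleton, List.mem_append]

end Positions

/-! ### Writing the output -/

/-- The words that encode a rule. -/
def encodeRule (ρ : Rule) : List ℕ := encodeLhs ρ.lhs ++ encodeRhs ρ.rhs

/-- Write the rule of the node of a positive level with the index in register 48. -/
def emitNodeProg : Prog :=
  .seq (.seqs [.op .plus 38 24 48, .load 52 38, .emit 3, .emit 52, .op .plus 38 23 48, .load 34 38,
    .op .plus 48 48 3, .op .plus 38 23 48, .load 35 38, .op .minus 37 35 34, .op .plus 38 55 34,
    .load 42 38, .op .plus 38 55 35, .op .minus 38 38 3, .load 34 38, .op .equal 44 42 34]) <|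
  .branch 44 (.seqs [.emit 3, .emit 3, .emit 42, .emit 37])
    (.seqs [.emit 4, .emit 3, .emit 42, .emit 3, .emit 34])

/-- Write the rules of the nodes of a positive level whose indices start with the one in register 48
and end before the one in register 49. -/
def emitNodesProg : Prog :=
  .seq (.seqs [.op .plus 24 23 10, .op .plus 44 10 10, .op .minus 55 23 44, .op .less 56 48 49]) <|
  .loop 56 (.seq emitNodeProg (.seqs [.op .less 56 48 49]))

/-- Write the rules of the leaves whose indices start with the one in register 48 and end before the
one in register 49. -/
def emitLeavesProg : Prog :=
  .seq (.seqs [.op .plus 24 23 10, .op .less 56 48 49]) <|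
  .loop 56 (.seqs [.op .plus 38 24 48, .load 52 38, .emit 3, .emit 52, .emit 3, .emit 4,
    .op .minus 44 52 3, .emit 44, .op .less 44 4 52, .emit 44, .op .plus 48 48 3,
    .op .less 56 48 49])

/-- Replace the segment from register 48 to register 49 by the one that it covers on the level
below, and add its length to register 50. -/
def descendProg : List Prog :=
  [.op .minus 58 49 48, .op .plus 50 50 58, .op .plus 38 23 48, .load 48 38, .op .plus 38 23 49,
    .load 49 38, .op .plus 44 10 10, .op .plus 44 44 10, .op .minus 23 23 44, .op .minus 51 51 3]

/-- Write the number of rules of the grammar of the node with the index in register 47, and its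
starting rule. -/
def emitStartProg : Prog :=
  .seq (.seqs [.op .plus 23 57 4, .op .plus 48 47 4, .op .plus 49 47 3, .op .plus 50 3 4,
    .op .plus 51 12 4]) <|
  .seq (.loop 51 (.seqs descendProg)) <|
  .seqs [.op .minus 58 49 48, .op .plus 50 50 58, .emit 50, .emit 4, .emit 4, .emit 3, .emit 3,
    .op .plus 44 57 10, .op .plus 38 44 47, .load 52 38, .emit 52, .emit 3, .op .plus 23 57 4,
    .op .plus 48 47 4, .op .plus 49 47 3, .op .plus 51 12 4]

/-- Write the grammar of the node with the index in register 47.  Register 23 holds the address of the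
current level, registers 48 and 49 delimit its segment of nodes below the given one, register 51
counts the levels down, and register 57 holds the address of the last level. -/
def emitGrammarProg : Prog :=
  .seq emitStartProg <|
  .seq (.loop 51 <|
    .seq (.seqs [.op .plus 38 23 48, .load 53 38, .op .plus 38 23 49, .load 54 38]) <|
    .seq emitNodesProg <|
    .seqs [.op .plus 48 53 4, .op .plus 49 54 4, .op .plus 44 10 10, .op .plus 44 44 10,
      .op .minus 23 23 44, .op .minus 51 51 3])
  emitLeavesProg

/-- Write the grammars of all nodes of the last level. -/
def outputProg : Prog :=
  .seq (.seqs [.op .plus 57 23 4, .op .plus 47 4 4, .op .less 33 47 29]) <|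
  .loop 33 (.seq emitGrammarProg (.seqs [.op .plus 47 47 3, .op .less 33 47 29]))

section Output

variable {π : Params} {T : ℕ → ZMod (2 ^ π.h)} {s : MState} {x : List ℕ}

theorem emitNodeProg_ends (hπ : Fits π) (hs : Ready π T s) (hxS : x.length + 1 < π.S)
    (hL : LevelsAt π T x s.mem π.J) {j a : ℕ} (hj : j < π.J)
    (ha : a < (markedLevel π.K π.θ T x (j + 1)).length)
    (h23 : s.reg 23 = π.base (j + 1)) (h24 : s.reg 24 = π.base (j + 1) + π.S)
    (h55 : s.reg 55 = π.base j + π.S) (h48 : s.reg 48 = a) :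
    emitNodeProg.Ends π.w s 24 fun s' => s'.reg 48 = a + 1 ∧
      s'.out = s.out ++ encodeRule (markedLevel π.K π.θ T x (j + 1))[a].1.rule := by
  have hbw := hπ.base_lt (j := j + 1) (by lia)
  have hbs := π.base_succ j
  set G := markedGroups π.K π.θ T x j with hG
  have hGF : markedLevel π.K π.θ T x (j + 1) =
      G.map (parentMarked π.K π.θ T ((j + 1) * chunk π.h π.K)) := markedLevel_succ
  have hGl : (markedLevel π.K π.θ T x (j + 1)).length = G.length := by rw [hGF, List.length_map]
  have haG : a < G.length := hGl ▸ ha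
  have hGle : (markedLevel π.K π.θ T x (j + 1)).length ≤ x.length + 1 := length_markedLevel_le
  have hname := (hL.nodes (j + 1) hj a _ (List.getElem?_eq_getElem ha)).1
  have hrule : (markedLevel π.K π.θ T x (j + 1))[a].1 =
      parentNode T ((j + 1) * chunk π.h π.K) (G[a].map Prod.fst) := by
    simp [hGF, parentMarked]
  have hst := hL.starts j hj a (by rw [← hG]; lia)
  have hst' := hL.starts j hj (a + 1) (by rw [← hG]; lia)
  rw [← hG] at hst hst'
  set lo := (G.take a).flatten.length with hlo
  have hga : G[a] ≠ [] := List.ne_nil_of_mem_splitBy (List.getElem_mem haG)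
  have hhi : (G.take (a + 1)).flatten.length = lo + G[a].length := by
    rw [List.take_add_one, List.flatten_append, List.length_append, List.getElem?_eq_getElem haG]
    simp [hlo]
  rw [hhi] at hst'
  have hpos : 0 < G[a].length := List.length_pos_iff.2 hga
  have hfl : G.flatten = markedLevel π.K π.θ T x j := List.flatten_splitBy _ _
  have hlolen : lo + G[a].length ≤ x.length + 1 := by
    rw [← hhi]
    refine (List.IsPrefix.flatten (List.take_prefix (a + 1) G)).length_le.trans ?_
    rw [hfl]
    exact length_markedLevel_le
  have hnames : ∀ m (hm : m < G[a].length), s.mem (π.base j + π.S + (lo + m)) = G[a][m].1.name := by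
    intro m hm
    have h1 := List.getElem?_flatten_take haG hm
    rw [hfl, List.getElem?_eq_getElem hm] at h1
    exact (hL.nodes j hj.le _ _ h1).1
  have hfirst : s.mem (π.base j + π.S + lo) = firstName (G[a].map Prod.fst) := by
    have := hnames 0 hpos
    rw [Nat.add_zero] at this
    rw [this, firstName]
    obtain ⟨c, g, hcg⟩ := List.exists_cons_of_ne_nil hga
    simp [hcg]
  have hlast : s.mem (π.base j + π.S + (lo + G[a].length) - 1) = lastName (G[a].map Prod.fst) := by
    have := hnames (G[a].length - 1) (by lia)
    rw [show π.base j + π.S + (lo + G[a].length) - 1 = π.base j + π.S + (lo + (G[a].length - 1)) by lia,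
      this, lastName, List.getLastD_eq_getLast?, List.getLast?_map, List.getLast?_map,
      List.getLast?_eq_getElem?, List.getElem?_eq_getElem (by lia)]
    rfl
  rw [hrule] at hname ⊢
  refine ((Prog.SafeAll.ends (l := [.op .plus 38 24 48, .load 52 38, .emit 3, .emit 52,
    .op .plus 38 23 48, .load 34 38, .op .plus 48 48 3, .op .plus 38 23 48, .load 35 38,
    .op .minus 37 35 34, .op .plus 38 55 34, .load 42 38, .op .plus 38 55 35, .op .minus 38 38 3,
    .load 34 38, .op .equal 44 42 34]) ?_).seq (B' := 7) ?_).mono (by simp) fun _ h _ => h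
  · simp only [Prog.SafeAll, Prog.Safe, Prog.step, Op.eval, MState.reg_setReg, MState.mem_setReg]
    simp [hs.one, h23, h24, h48, h55, hst, hst', hfirst, hlast]
    refine ⟨by lia, by lia, by lia, by lia, by lia, by lia, by lia, by lia, by split_ifs <;> lia⟩
  rintro s₁ hs₁ -
  have e : s₁.reg 3 = 1 ∧ s₁.reg 4 = 0 ∧ s₁.reg 34 = lastName (G[a].map Prod.fst) ∧
      s₁.reg 42 = firstName (G[a].map Prod.fst) ∧ s₁.reg 37 = G[a].length ∧ s₁.reg 48 = a + 1 ∧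
      s₁.reg 44 = (if firstName (G[a].map Prod.fst) = lastName (G[a].map Prod.fst) then 1 else 0) ∧
      s₁.out = s.out ++ [1, (parentNode T ((j + 1) * chunk π.h π.K) (G[a].map Prod.fst)).name] := by
    rw [hs₁]
    simp only [Prog.steps, Prog.step, Op.eval, MState.reg_setReg, MState.mem_setReg,
      MState.out_setReg]
    simp [hs.one, hs.zero, h23, h24, h48, h55, hst, hst', hfirst, hlast, hname]
  obtain ⟨e3, e4, e34, e42, e37, e48, e44, eout⟩ := e
  refine Prog.Ends.branch (fun hne => ?_) fun hz => ?_
  · have heq : firstName (G[a].map Prod.fst) = lastName (G[a].map Prod.fst) := by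
      by_contra h
      simp [e44, h] at hne
    refine (Prog.SafeAll.ends ?_).mono (by simp) ?_
    · simp [Prog.SafeAll, Prog.Safe]
    · rintro _ rfl -
      simp [Prog.steps, Prog.step, e48, e3, e42, e37, eout, parentNode, encodeRule, encodeLhs,
        groupRhs, heq, encodeRhs, encodeSymbol]
  · have hne : firstName (G[a].map Prod.fst) ≠ lastName (G[a].map Prod.fst) := fun h => by
      simp [e44, h] at hz
    refine (Prog.SafeAll.ends ?_).mono le_rfl ?_
    · simp [Prog.SafeAll, Prog.Safe]
    · rintro _ rfl -
      simp [Prog.steps, Prog.step, e48, e3, e4, e42, e34, eout, parentNode, encodeRule, encodeLhs,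
        groupRhs, hne, encodeRhs, encodeSymbol]

theorem emitNodesProg_ends (hπ : Fits π) (hs : Ready π T s) (hxS : x.length + 1 < π.S)
    (hL : LevelsAt π T x s.mem π.J) {j a b : ℕ} (hj : j < π.J) (hab : a ≤ b)
    (hb : b ≤ (markedLevel π.K π.θ T x (j + 1)).length)
    (h23 : s.reg 23 = π.base (j + 1)) (h48 : s.reg 48 = a) (h49 : s.reg 49 = b) :
    emitNodesProg.Ends π.w s (27 * (b - a) + 6) fun s' =>
      s'.out = s.out ++ (((markedLevel π.K π.θ T x (j + 1)).segment a b).map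
        fun c => c.1.rule).flatMap encodeRule := by
  have hbw := hπ.base_lt (j := j + 1) (by lia)
  have hbs := π.base_succ j
  set F := markedLevel π.K π.θ T x (j + 1) with hF
  have hFl : F.length ≤ x.length + 1 := length_markedLevel_le
  refine ((Prog.SafeAll.ends (l := [.op .plus 24 23 10, .op .plus 44 10 10, .op .minus 55 23 44,
    .op .less 56 48 49]) ?_).seq (B' := (b - a) * ((24 + 2) + 1) + 1) ?_).mono (by simp; lia)
    fun _ h _ => h
  · simp [Prog.SafeAll, Prog.Safe, Prog.step, Op.eval, hs.size, h23]
    refine ⟨by lia, by lia, by lia, by split_ifs <;> lia⟩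
  rintro s₁ hs₁ -
  have hR₁ : Ready π T s₁ := hs.of_eq (fun r _ hr => by simp [hs₁, Prog.steps, Prog.step]; lia)
    fun _ _ => by rw [hs₁]; rfl
  have hm₁ : s₁.mem = s.mem := by rw [hs₁]; rfl
  have e : s₁.reg 23 = π.base (j + 1) ∧ s₁.reg 24 = π.base (j + 1) + π.S ∧
      s₁.reg 55 = π.base j + π.S ∧ s₁.reg 48 = a ∧ s₁.reg 49 = b ∧ s₁.out = s.out ∧
      s₁.reg 56 = if a < b then 1 else 0 := by
    simp [hs₁, Prog.steps, Prog.step, Op.eval, hs.size, h23, h48, h49]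
    lia
  obtain ⟨e23, e24, e55, e48, e49, eout, e56⟩ := e
  refine (Prog.Ends.loop_const (b - a) (fun i s' => s'.reg 48 = a + i ∧
    (s'.reg 56 = if a + i < b then 1 else 0) ∧
    s'.out = s.out ++ ((F.segment a (a + i)).map fun c => c.1.rule).flatMap encodeRule)
    ?_ ?_ ?_).mono le_rfl ?_
  · exact ⟨e48, e56, by simp [List.segment_self, eout]⟩
  · rintro i s₂ hi ⟨h48, h56, hout⟩ hfr
    have hlt : a + i < b := by lia
    refine ⟨by rw [h56, if_pos hlt]; lia, ?_⟩
    have hR₂ := hR₁.of_frame hfr (by decide) rfl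
    have hm₂ : s₂.mem = s.mem := (hfr.mem rfl).trans hm₁
    refine (emitNodeProg_ends hπ hR₂ hxS (by rw [hm₂]; exact hL) hj (a := a + i) (by lia)
      ((hfr.reg 23 rfl).trans e23) ((hfr.reg 24 rfl).trans e24) ((hfr.reg 55 rfl).trans e55) h48).seq ?_
    rintro s₃ ⟨h48', hout'⟩ hF₃
    have h49' : s₃.reg 49 = b := (hF₃.reg 49 rfl).trans ((hfr.reg 49 rfl).trans e49)
    refine (Prog.SafeAll.ends ?_).mono le_rfl ?_
    · simp [Prog.SafeAll, Prog.Safe, Op.eval]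
      split_ifs <;> lia
    · rintro _ rfl -
      refine ⟨by simpa [Prog.steps, Prog.step, add_assoc] using h48', ?_, ?_⟩
      · simp [Prog.steps, Prog.step, Op.eval, h48', h49', add_assoc]
      · rw [← add_assoc, List.segment_succ (by lia) (by lia)]
        simp [Prog.steps, Prog.step, hout', hout, hF]
  · rintro s' ⟨-, h56, -⟩
    rw [h56, if_neg (by lia)]
  · rintro s' ⟨-, -, hout⟩ -
    rwa [Nat.add_sub_cancel' hab] at hout

theorem emitLeavesProg_ends (hπ : Fits π) (hs : Ready π T s) (hx : ∀ c ∈ x, c + 1 < 2 ^ π.h)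
    (hxS : x.length + 1 < π.S) (hL : LevelsAt π T x s.mem π.J) {a b : ℕ} (hab : a ≤ b)
    (hb : b ≤ (markedLevel π.K π.θ T x 0).length)
    (h23 : s.reg 23 = π.base 0) (h48 : s.reg 48 = a) (h49 : s.reg 49 = b) :
    emitLeavesProg.Ends π.w s (27 * (b - a) + 6) fun s' =>
      s'.out = s.out ++ (((markedLevel π.K π.θ T x 0).segment a b).map
        fun c => c.1.rule).flatMap encodeRule := by
  have hbw := hπ.base_lt (j := 0) (by lia)
  have hmod := hπ.modulus
  set F := markedLevel π.K π.θ T x 0 with hF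
  have hFl : F.length ≤ x.length + 1 := length_markedLevel_le
  have hleaf : ∀ c ∈ F, c.1 = leafNode c.1.name ∧ c.1.name < 2 ^ π.h := fun c hc => by
    rw [hF, markedLevel_zero_eq] at hc
    rcases List.mem_cons.1 hc with rfl | hc
    · exact ⟨rfl, Nat.two_pow_pos _⟩
    · obtain ⟨d, hd, rfl⟩ := List.mem_map.1 hc
      exact ⟨rfl, hx d hd⟩
  refine ((Prog.SafeAll.ends (l := [.op .plus 24 23 10, .op .less 56 48 49]) ?_).seq
    (B' := (b - a) * (13 + 1) + 1) ?_).mono (by simp; lia) fun _ h _ => h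
  · simp [Prog.SafeAll, Prog.Safe, Prog.step, Op.eval, hs.size, h23]
    refine ⟨by lia, by split_ifs <;> lia⟩
  rintro s₁ hs₁ -
  have hR₁ : Ready π T s₁ := hs.of_eq (fun r _ hr => by simp [hs₁, Prog.steps, Prog.step]; lia)
    fun _ _ => by rw [hs₁]; rfl
  have hm₁ : s₁.mem = s.mem := by rw [hs₁]; rfl
  have e : s₁.reg 24 = π.base 0 + π.S ∧ s₁.reg 48 = a ∧ s₁.reg 49 = b ∧ s₁.out = s.out ∧
      s₁.reg 56 = if a < b then 1 else 0 := by
    simp [hs₁, Prog.steps, Prog.step, Op.eval, hs.size, h23, h48, h49]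
  obtain ⟨e24, e48, e49, eout, e56⟩ := e
  refine (Prog.Ends.loop_const (b - a) (fun i s' => s'.reg 48 = a + i ∧
    (s'.reg 56 = if a + i < b then 1 else 0) ∧
    s'.out = s.out ++ ((F.segment a (a + i)).map fun c => c.1.rule).flatMap encodeRule)
    ?_ ?_ ?_).mono le_rfl ?_
  · exact ⟨e48, e56, by simp [List.segment_self, eout]⟩
  · rintro i s₂ hi ⟨h48, h56, hout⟩ hfr
    have hlt : a + i < b := by lia
    refine ⟨by rw [h56, if_pos hlt]; lia, ?_⟩
    have hR₂ := hR₁.of_frame hfr (by decide) rfl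
    have hm₂ : s₂.mem = s.mem := (hfr.mem rfl).trans hm₁
    have h24' : s₂.reg 24 = π.base 0 + π.S := (hfr.reg 24 rfl).trans e24
    have h49' : s₂.reg 49 = b := (hfr.reg 49 rfl).trans e49
    have hname : s₂.mem (π.base 0 + π.S + (a + i)) = F[a + i].1.name := by
      rw [hm₂]
      exact (hL.nodes 0 (by lia) _ _ (List.getElem?_eq_getElem (by lia))).1
    obtain ⟨hl, hlt'⟩ := hleaf F[a + i] (List.getElem_mem (by lia))
    generalize hv : F[a + i].1.name = v at *
    refine (Prog.SafeAll.ends ?_).mono (by simp) ?_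
    · simp [Prog.SafeAll, Prog.Safe, Prog.step, Op.eval, hR₂.one, hR₂.zero, h24', h48, h49', hname]
      refine ⟨by lia, by lia, by split_ifs <;> lia, by lia, by split_ifs <;> lia⟩
    · rintro _ rfl -
      refine ⟨?_, ?_, ?_⟩
      · simp [Prog.steps, Prog.step, Op.eval, hR₂.one, h48, add_assoc]
      · simp [Prog.steps, Prog.step, Op.eval, hR₂.one, h48, h49', add_assoc]
      · rw [← add_assoc, List.segment_succ (by lia) (by lia), List.map_append, List.map_singleton,
          List.flatMap_append, List.flatMap_singleton, hl]
        by_cases h0 : v = 0 <;> simp [Prog.steps, Prog.step, Op.eval, hR₂.one, hR₂.zero, h24', h48,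
          hname, hout, encodeRule, leafNode, encodeLhs, encodeRhs, encodeSymbol, h0,
          Nat.pos_iff_ne_zero]
  · rintro s' ⟨-, h56, -⟩
    rw [h56, if_neg (by lia)]
  · rintro s' ⟨-, -, hout⟩ -
    rwa [Nat.add_sub_cancel' hab] at hout

/-- The starting positions of the groups of a level lead from a segment to the one below. -/
theorem LevelsAt.mem_nodesBelow {mem : ℕ → ℕ} (hL : LevelsAt π T x mem π.J) {p i : ℕ} (hi : i < π.J)
    (hp : p ≤ (markedLevel π.K π.θ T x π.J).length) :
    mem (π.base (π.J - i) + nodesBelow π.K π.θ T x π.J p i) =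
      nodesBelow π.K π.θ T x π.J p (i + 1) := by
  obtain ⟨j, hj⟩ : ∃ j, π.J - i = j + 1 := ⟨π.J - i - 1, by lia⟩
  have h1 : nodesBelow π.K π.θ T x π.J p i ≤ (markedGroups π.K π.θ T x j).length := by
    have := nodesBelow_le hp i hi.le
    rwa [hj, markedLevel_succ, List.length_map] at this
  rw [hj, hL.starts j (by lia) _ (by lia), nodesBelow, show π.J - 1 - i = j by lia]

theorem emitStartProg_ends (hπ : Fits π) (hs : Ready π T s) (hxS : x.length + 1 < π.S)
    (hL : LevelsAt π T x s.mem π.J) {p : ℕ} (hp : p < (markedLevel π.K π.θ T x π.J).length)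
    (h57 : s.reg 57 = π.base π.J) (h47 : s.reg 47 = p) :
    emitStartProg.Ends π.w s (12 * π.J + 24) fun s' =>
      s'.reg 23 = π.base π.J ∧ s'.reg 48 = p ∧ s'.reg 49 = p + 1 ∧ s'.reg 51 = π.J ∧
      s'.out = s.out ++ ((grammarRules π.K π.θ T x π.J p
        (markedLevel π.K π.θ T x π.J)[p].1).length :: encodeRule ⟨none, .power
          (.nonterminal (markedLevel π.K π.θ T x π.J)[p].1.name) 1⟩) := by
  have hbw := hπ.base_lt (j := π.J) le_rfl
  have hmem := hπ.memory
  set F := markedLevel π.K π.θ T x π.J with hF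
  have hFl : F.length ≤ x.length + 1 := length_markedLevel_le
  set W : ℕ → ℕ := fun i => nodesBelow π.K π.θ T x π.J (p + 1) i - nodesBelow π.K π.θ T x π.J p i
    with hW
  have hlow : ∀ p ≤ F.length, ∀ i ≤ π.J, nodesBelow π.K π.θ T x π.J p i ≤ x.length + 1 :=
    fun p hp i hi => (nodesBelow_le hp i hi).trans length_markedLevel_le
  have hWsum : ∀ i ≤ π.J + 1, ∑ a ∈ Finset.range i, W a ≤ (π.J + 1) * π.S := fun i hi => by
    calc ∑ a ∈ Finset.range i, W a ≤ ∑ a ∈ Finset.range i, π.S := by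
          refine Finset.sum_le_sum fun a ha => ?_
          have := hlow (p + 1) hp a (by have := Finset.mem_range.1 ha; lia)
          simp only [hW]
          lia
      _ = i * π.S := by simp
      _ ≤ (π.J + 1) * π.S := Nat.mul_le_mul_right _ hi
  have hbig : 3 * π.S + (π.J + 1) * π.S < 2 ^ π.w := by
    have : (3 * π.J + 4) * π.S = 2 * π.J * π.S + (3 * π.S + (π.J + 1) * π.S) := by ring
    lia
  have hJ : π.J < 2 ^ π.w := by
    have := Nat.mul_le_mul_left (π.J + 1) hπ.size
    lia
  refine ((Prog.SafeAll.ends (l := [.op .plus 23 57 4, .op .plus 48 47 4, .op .plus 49 47 3,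
    .op .plus 50 3 4, .op .plus 51 12 4]) ?_).seq (B' := (π.J * (11 + 1) + 1) + 17) ?_).mono
    (by simp; lia) fun _ h _ => h
  · simp [Prog.SafeAll, Prog.Safe, Prog.step, Op.eval, hs.one, hs.zero, hs.rounds, h57, h47]
    lia
  rintro s₁ hs₁ -
  have hR₁ : Ready π T s₁ := hs.of_eq (fun r _ hr => by simp [hs₁, Prog.steps, Prog.step]; lia)
    fun _ _ => by rw [hs₁]; rfl
  have hm₁ : s₁.mem = s.mem := by rw [hs₁]; rfl
  have e : s₁.reg 23 = π.base π.J ∧ s₁.reg 48 = p ∧ s₁.reg 49 = p + 1 ∧ s₁.reg 50 = 1 ∧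
      s₁.reg 51 = π.J ∧ s₁.reg 57 = π.base π.J ∧ s₁.reg 47 = p ∧ s₁.out = s.out := by
    simp [hs₁, Prog.steps, Prog.step, Op.eval, hs.one, hs.zero, hs.rounds, h57, h47]
  obtain ⟨e23, e48, e49, e50, e51, e57, e47, eout⟩ := e
  refine (Prog.Ends.loop_const π.J (fun i s' => s'.reg 23 = π.base (π.J - i) ∧
    s'.reg 48 = nodesBelow π.K π.θ T x π.J p i ∧ s'.reg 49 = nodesBelow π.K π.θ T x π.J (p + 1) i ∧
    s'.reg 50 = 1 + ∑ a ∈ Finset.range i, W a ∧ s'.reg 51 = π.J - i) ?_ ?_ ?_).seq ?_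
  · exact ⟨e23, e48, e49, by simpa using e50, e51⟩
  · rintro i s₂ hi ⟨h23, h48, h49, h50, h51⟩ hfr
    refine ⟨by lia, ?_⟩
    have hR₂ := hR₁.of_frame hfr (by decide) rfl
    have hm₂ : s₂.mem = s.mem := (hfr.mem rfl).trans hm₁
    have hl1 := hL.mem_nodesBelow hi (p := p) hp.le
    have hl2 := hL.mem_nodesBelow hi (p := p + 1) hp
    have b1 := hlow p hp.le i hi.le
    have b2 := hlow (p + 1) hp i hi.le
    have b3 := hWsum (i + 1) (by lia)
    rw [Finset.sum_range_succ] at b3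
    have b4 := hπ.base_lt (j := π.J - i) (by lia)
    have hWi : nodesBelow π.K π.θ T x π.J (p + 1) i - nodesBelow π.K π.θ T x π.J p i = W i := rfl
    have b5 : π.base (π.J - i) = π.base (π.J - (i + 1)) + 3 * π.S := by
      rw [← π.base_succ, show π.J - (i + 1) + 1 = π.J - i by lia]
    refine (Prog.SafeAll.ends ?_).mono (by simp [descendProg]) ?_
    · simp [descendProg, Prog.SafeAll, Prog.Safe, Prog.step, Op.eval, hR₂.one, hR₂.size, h23, h48,
        h49, h50, h51, hm₂, hl1, hl2, hWi]
      lia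
    · rintro _ rfl -
      simp [descendProg, Prog.steps, Prog.step, Op.eval, hR₂.one, hR₂.size, h23, h48, h49, h50, h51,
        hm₂, hl1, hl2, hWi, Finset.sum_range_succ]
      lia
  · rintro s' ⟨-, -, -, -, h51⟩
    rw [h51, Nat.sub_self]
  · rintro s₂ ⟨h23, h48, h49, h50, h51⟩ hfr
    have hR₂ := hR₁.of_frame hfr (by decide) rfl
    have hm₂ : s₂.mem = s.mem := (hfr.mem rfl).trans hm₁
    have hout₂ : s₂.out = s.out := (hfr.out rfl).trans eout
    have g57 : s₂.reg 57 = π.base π.J := (hfr.reg 57 rfl).trans e57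
    have g47 : s₂.reg 47 = p := (hfr.reg 47 rfl).trans e47
    have hname := (hL.nodes π.J le_rfl p F[p] (by simp [← hF])).1
    have b3 := hWsum (π.J + 1) le_rfl
    have hlen : (grammarRules π.K π.θ T x π.J p F[p].1).length =
        1 + (∑ a ∈ Finset.range π.J, W a + W π.J) := by
      have h1 : ((List.range (π.J + 1)).flatMap (rulesBelow π.K π.θ T x π.J p)).length =
          ∑ a ∈ Finset.range (π.J + 1), W a := by
        rw [List.length_flatMap, Finset.sum_range, ← List.sum_ofFn, ← List.map_coe_finRange_eq_range,
          List.map_map, List.ofFn_eq_map]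
        congr 1
        refine List.map_congr_left fun a _ => ?_
        exact length_rulesBelow hp (Nat.lt_succ_iff.1 a.2)
      rw [grammarRules, List.length_cons, h1, Finset.sum_range_succ, add_comm]
    rw [Finset.sum_range_succ] at b3
    have hWi : nodesBelow π.K π.θ T x π.J (p + 1) π.J - nodesBelow π.K π.θ T x π.J p π.J = W π.J := rfl
    refine (Prog.SafeAll.ends ?_).mono (by simp) ?_
    · simp [Prog.SafeAll, Prog.Safe, Prog.step, Op.eval, hR₂.one, hR₂.zero, hR₂.size, hR₂.rounds,
        h48, h49, h50, g57, g47, hWi]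
      lia
    · rintro _ rfl -
      simp [Prog.steps, Prog.step, Op.eval, hR₂.one, hR₂.zero, hR₂.size, hR₂.rounds, h48, h49, h50,
        g57, g47, hWi, hm₂, hout₂, encodeRule, encodeLhs, encodeRhs, encodeSymbol]
      exact ⟨by rw [add_assoc]; exact hlen.symm, hname⟩

theorem emitGrammarProg_ends (hπ : Fits π) (hs : Ready π T s) (hx : ∀ c ∈ x, c + 1 < 2 ^ π.h)
    (hxS : x.length + 1 < π.S) (hL : LevelsAt π T x s.mem π.J) {p : ℕ}
    (hp : p < (markedLevel π.K π.θ T x π.J).length)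
    (h57 : s.reg 57 = π.base π.J) (h47 : s.reg 47 = p) :
    emitGrammarProg.Ends π.w s (31 * π.J + 31 + 27 * ∑ i ∈ Finset.range (π.J + 1),
      (nodesBelow π.K π.θ T x π.J (p + 1) i - nodesBelow π.K π.θ T x π.J p i)) fun s' =>
      s'.out = s.out ++ encodeRules (grammarRules π.K π.θ T x π.J p
        (markedLevel π.K π.θ T x π.J)[p].1) := by
  set W : ℕ → ℕ := fun i => nodesBelow π.K π.θ T x π.J (p + 1) i - nodesBelow π.K π.θ T x π.J p i
    with hW
  have hlow : ∀ p ≤ (markedLevel π.K π.θ T x π.J).length, ∀ i ≤ π.J,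
      nodesBelow π.K π.θ T x π.J p i ≤ x.length + 1 :=
    fun p hp i hi => (nodesBelow_le hp i hi).trans length_markedLevel_le
  set ρ₀ : Rule := ⟨none, .power (.nonterminal (markedLevel π.K π.θ T x π.J)[p].1.name) 1⟩ with hρ₀
  set l := (grammarRules π.K π.θ T x π.J p (markedLevel π.K π.θ T x π.J)[p].1).length with hl
  refine ((emitStartProg_ends hπ hs hxS hL hp h57 h47).seq (B' := (∑ i ∈ Finset.range π.J,
    ((27 * W i + 18) + 1) + 1) + (27 * W π.J + 6)) ?_).mono ?_ fun _ h _ => h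
  swap
  · rw [Finset.sum_range_succ, Finset.sum_add_distrib, Finset.sum_add_distrib, ← Finset.mul_sum]
    simp
    lia
  rintro s₁ ⟨e23, e48, e49, e51, eout⟩ hF₁
  have hR₁ := hs.of_frame hF₁ (by decide) rfl
  have hm₁ : s₁.mem = s.mem := hF₁.mem rfl
  refine (Prog.Ends.loop π.J (fun i => 27 * W i + 18) (fun i s' => s'.reg 23 = π.base (π.J - i) ∧
    s'.reg 48 = nodesBelow π.K π.θ T x π.J p i ∧ s'.reg 49 = nodesBelow π.K π.θ T x π.J (p + 1) i ∧
    s'.reg 51 = π.J - i ∧ s'.out = s.out ++ (l :: (ρ₀ ::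
      (List.range i).flatMap (rulesBelow π.K π.θ T x π.J p)).flatMap encodeRule)) ?_ ?_ ?_).seq ?_
  · exact ⟨e23, e48, e49, e51, by simpa using eout⟩
  · rintro i s₂ hi ⟨h23, h48, h49, h51, hout⟩ hfr
    refine ⟨by lia, ?_⟩
    have hR₂ := hR₁.of_frame hfr (by decide) rfl
    have hm₂ : s₂.mem = s.mem := (hfr.mem rfl).trans hm₁
    have hl1 := hL.mem_nodesBelow hi (p := p) hp.le
    have hl2 := hL.mem_nodesBelow hi (p := p + 1) hp
    have b1 := hlow p hp.le i hi.le
    have b2 := hlow (p + 1) hp i hi.le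
    have b1' := hlow p hp.le (i + 1) hi
    have b2' := hlow (p + 1) hp (i + 1) hi
    have b4 := hπ.base_lt (j := π.J - i) (by lia)
    obtain ⟨j, hj⟩ : ∃ j, π.J - i = j + 1 := ⟨π.J - i - 1, by lia⟩
    have hj' : π.J - (i + 1) = j := by lia
    have b5 := π.base_succ j
    have b6 := nodesBelow_le (K := π.K) (θ := π.θ) (T := T) (x := x) (p := p + 1) hp i hi.le
    rw [hj] at h23 hl1 hl2 b4 b6
    refine ((Prog.SafeAll.ends (l := [.op .plus 38 23 48, .load 53 38, .op .plus 38 23 49,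
      .load 54 38]) ?_).seq (B' := (27 * W i + 6) + 7) ?_).mono (by simp; lia) fun _ h _ => h
    · simp [Prog.SafeAll, Prog.Safe, Prog.step, Op.eval, h23, h48, h49]
      lia
    rintro s₃ hs₃ -
    have hR₃ : Ready π T s₃ := hR₂.of_eq (fun r _ hr => by simp [hs₃, Prog.steps, Prog.step]; lia)
      fun _ _ => by rw [hs₃]; rfl
    have hm₃ : s₃.mem = s.mem := by rw [hs₃]; exact hm₂
    have e : s₃.reg 23 = π.base (j + 1) ∧ s₃.reg 48 = nodesBelow π.K π.θ T x π.J p i ∧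
        s₃.reg 49 = nodesBelow π.K π.θ T x π.J (p + 1) i ∧ s₃.reg 51 = π.J - i ∧
        s₃.reg 53 = nodesBelow π.K π.θ T x π.J p (i + 1) ∧
        s₃.reg 54 = nodesBelow π.K π.θ T x π.J (p + 1) (i + 1) ∧ s₃.out = s₂.out := by
      simp [hs₃, Prog.steps, Prog.step, Op.eval, h23, h48, h49, h51, hm₂, hl1, hl2]
    obtain ⟨g23, g48, g49, g51, g53, g54, gout⟩ := e
    refine (emitNodesProg_ends hπ hR₃ hxS (by rw [hm₃]; exact hL) (j := j) (by lia)
      (nodesBelow_mono (by lia) i) b6 g23 g48 g49).seq ?_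
    rintro s₄ hout₄ hF₄
    have hR₄ := hR₃.of_frame hF₄ (by decide) rfl
    have k23 : s₄.reg 23 = π.base (j + 1) := (hF₄.reg 23 rfl).trans g23
    have k51 : s₄.reg 51 = π.J - i := (hF₄.reg 51 rfl).trans g51
    have k53 := (hF₄.reg 53 rfl).trans g53
    have k54 := (hF₄.reg 54 rfl).trans g54
    have hJ : π.J < 2 ^ π.w := by
      have := Nat.mul_le_mul_left π.J hπ.size
      have h1 : (3 * π.J + 4) * π.S = 3 * (π.J * π.S) + 4 * π.S := by ring
      have := hπ.memory
      lia
    refine (Prog.SafeAll.ends ?_).mono le_rfl ?_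
    · simp [Prog.SafeAll, Prog.Safe, Prog.step, Op.eval, hR₄.one, hR₄.zero, hR₄.size, k23, k51, k53,
        k54]
      lia
    · rintro s₅ hs₅ -
      have hout₅ : s₅.out = s₄.out := by rw [hs₅]; rfl
      refine ⟨?_, ?_, ?_, ?_, ?_⟩
      · simp [hs₅, Prog.steps, Prog.step, Op.eval, hR₄.size, k23, hj']
        lia
      · simp [hs₅, Prog.steps, Prog.step, Op.eval, hR₄.zero, k53]
      · simp [hs₅, Prog.steps, Prog.step, Op.eval, hR₄.zero, k54]
      · simp [hs₅, Prog.steps, Prog.step, Op.eval, hR₄.one, k51]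
        lia
      · rw [hout₅, hout₄, gout, hout, List.range_succ, List.flatMap_append, List.flatMap_singleton,
          rulesBelow, hj]
        simp
  · rintro s' ⟨-, -, -, h51, -⟩
    rw [h51, Nat.sub_self]
  · rintro s₂ ⟨h23, h48, h49, h51, hout⟩ hfr
    have hR₂ := hR₁.of_frame hfr (by decide) rfl
    have hm₂ : s₂.mem = s.mem := (hfr.mem rfl).trans hm₁
    have b6 := nodesBelow_le (K := π.K) (θ := π.θ) (T := T) (x := x) (p := p + 1) hp π.J le_rfl
    rw [Nat.sub_self] at h23 b6
    refine (emitLeavesProg_ends hπ hR₂ hx hxS (by rw [hm₂]; exact hL)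
      (nodesBelow_mono (by lia) π.J) b6 h23 h48 h49).mono le_rfl ?_
    rintro s' hout' -
    rw [hout', hout]
    have h1 : grammarRules π.K π.θ T x π.J p (markedLevel π.K π.θ T x π.J)[p].1 =
        (ρ₀ :: (List.range π.J).flatMap (rulesBelow π.K π.θ T x π.J p)) ++
          rulesBelow π.K π.θ T x π.J p π.J := by
      rw [grammarRules, List.range_succ, List.flatMap_append, List.flatMap_singleton]
      rfl
    have h2 : ∀ l : List Rule, encodeRules l = l.length :: l.flatMap encodeRule := fun _ => rfl
    rw [h2, ← hl, h1, List.flatMap_append, rulesBelow, Nat.sub_self]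
    simp

theorem outputProg_ends (hπ : Fits π) (hs : Ready π T s) (hx : ∀ c ∈ x, c + 1 < 2 ^ π.h)
    (hxS : x.length + 1 < π.S) (hL : LevelsAt π T x s.mem π.J) (h23 : s.reg 23 = π.base π.J)
    (h29 : s.reg 29 = (markedLevel π.K π.θ T x π.J).length) (hout : s.out = []) :
    outputProg.Ends π.w s ((x.length + 1) * (58 * π.J + 62) + 5) fun s' =>
      Encodes s'.out ((level π.K π.θ T x π.J).flatten.map nodeGrammar) := by
  have hbw := hπ.base_lt (j := π.J) le_rfl
  set F := markedLevel π.K π.θ T x π.J with hF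
  have hFl : F.length ≤ x.length + 1 := length_markedLevel_le
  set W : ℕ → ℕ → ℕ := fun p i =>
    nodesBelow π.K π.θ T x π.J (p + 1) i - nodesBelow π.K π.θ T x π.J p i with hW
  set C : ℕ → ℕ := fun p => (31 * π.J + 31 + 27 * ∑ i ∈ Finset.range (π.J + 1), W p i) + 3 with hC
  have hsum : ∑ p ∈ Finset.range F.length, ∑ i ∈ Finset.range (π.J + 1), W p i ≤
      (π.J + 1) * (x.length + 1) := by
    rw [Finset.sum_comm]
    calc _ ≤ ∑ i ∈ Finset.range (π.J + 1), (x.length + 1) := by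
          refine Finset.sum_le_sum fun i hi => ?_
          rw [Finset.sum_range_tsub (f := fun p => nodesBelow π.K π.θ T x π.J p i)
            fun p q hpq => nodesBelow_mono hpq i]
          have hi' : i ≤ π.J := Nat.lt_succ_iff.1 (Finset.mem_range.1 hi)
          have h1 := nodesBelow_le (K := π.K) (θ := π.θ) (T := T) (x := x) (J := π.J) le_rfl i hi'
          have h2 : (markedLevel π.K π.θ T x (π.J - i)).length ≤ x.length + 1 := length_markedLevel_le
          exact (Nat.sub_le _ _).trans (h1.trans h2)
      _ = _ := by simp
  have hcost : 4 + (∑ p ∈ Finset.range F.length, (C p + 1) + 1) ≤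
      (x.length + 1) * (58 * π.J + 62) + 5 := by
    simp only [hC, Finset.sum_add_distrib, ← Finset.mul_sum, Finset.sum_const, Finset.card_range,
      smul_eq_mul]
    have h1 := Nat.mul_le_mul_right (31 * π.J + 35) hFl
    have h2 : (x.length + 1) * (58 * π.J + 62) =
        (x.length + 1) * (31 * π.J + 35) + 27 * ((π.J + 1) * (x.length + 1)) := by ring
    have h3 : F.length * (31 * π.J + 35) = F.length * (31 * π.J) + F.length * 35 := by ring
    lia
  refine ((Prog.SafeAll.ends (l := [.op .plus 57 23 4, .op .plus 47 4 4, .op .less 33 47 29])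
    ?_).seq (B' := ∑ p ∈ Finset.range F.length, (C p + 1) + 1) ?_).mono hcost fun _ h _ => h
  · simp [Prog.SafeAll, Prog.Safe, Prog.step, Op.eval, hs.zero, h23]
    split_ifs <;> lia
  rintro s₁ hs₁ -
  have hR₁ : Ready π T s₁ := hs.of_eq (fun r _ hr => by simp [hs₁, Prog.steps, Prog.step]; lia)
    fun _ _ => by rw [hs₁]; rfl
  have hm₁ : s₁.mem = s.mem := by rw [hs₁]; rfl
  have e : s₁.reg 57 = π.base π.J ∧ s₁.reg 47 = 0 ∧ s₁.reg 29 = F.length ∧ s₁.out = [] ∧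
      s₁.reg 33 = if 0 < F.length then 1 else 0 := by
    simp [hs₁, Prog.steps, Prog.step, Op.eval, hs.zero, h23, h29, hout]
  obtain ⟨e57, e47, e29, eout, e33⟩ := e
  set rs : List (Node × Bool) → List (List Rule) := fun l =>
    l.mapIdx fun p c => grammarRules π.K π.θ T x π.J p c.1 with hrs
  refine (Prog.Ends.loop F.length C (fun i s' => s'.reg 47 = i ∧
    (s'.reg 33 = if i < F.length then 1 else 0) ∧
    s'.out = (rs (F.take i)).flatMap encodeRules) ?_ ?_ ?_).mono le_rfl ?_
  · exact ⟨e47, e33, by simp [hrs, eout]⟩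
  · rintro p s₂ hp ⟨h47, h33, hout₂⟩ hfr
    refine ⟨by rw [h33, if_pos hp]; lia, ?_⟩
    have hR₂ := hR₁.of_frame hfr (by decide) rfl
    have hm₂ : s₂.mem = s.mem := (hfr.mem rfl).trans hm₁
    refine (emitGrammarProg_ends hπ hR₂ hx hxS (by rw [hm₂]; exact hL) hp
      ((hfr.reg 57 rfl).trans e57) h47).seq (B' := 3) ?_
    rintro s₃ hout₃ hF₃
    have hR₃ := hR₂.of_frame hF₃ (by decide) rfl
    have k47 : s₃.reg 47 = p := (hF₃.reg 47 rfl).trans h47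
    have k29 : s₃.reg 29 = F.length := (hF₃.reg 29 rfl).trans ((hfr.reg 29 rfl).trans e29)
    refine (Prog.SafeAll.ends ?_).mono le_rfl ?_
    · simp [Prog.SafeAll, Prog.Safe, Prog.step, Op.eval, hR₃.one, k47]
      refine ⟨by lia, by split_ifs <;> lia⟩
    · rintro _ rfl -
      refine ⟨?_, ?_, ?_⟩
      · simp [Prog.steps, Prog.step, Op.eval, hR₃.one, k47]
      · simp [Prog.steps, Prog.step, Op.eval, hR₃.one, k47, k29]
      · have : rs (F.take (p + 1)) = rs (F.take p) ++ [grammarRules π.K π.θ T x π.J p F[p].1] := by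
          rw [List.take_add_one, List.getElem?_eq_getElem hp, Option.toList_some]
          simp only [hrs, List.mapIdx_append, List.mapIdx_cons, List.mapIdx_nil, List.length_take,
            Nat.min_eq_left hp.le, Nat.zero_add]
        rw [this, List.flatMap_append, List.flatMap_singleton, ← hout₂]
        simpa [Prog.steps, Prog.step] using hout₃
  · rintro s' ⟨-, h33, -⟩
    rw [h33, if_neg (by lia)]
  · rintro s' ⟨-, -, hout'⟩ -
    refine ⟨rs F, ?_, by rwa [List.take_length] at hout'⟩
    rw [← map_fst_markedLevel, ← hF]
    refine List.ext_getElem (by simp [hrs]) fun p h1 h2 => ?_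
    have hp : p < F.length := by simpa [hrs] using h1
    simpa [hrs] using toFinset_grammarRules hp

end Output


/-! ### Random words from coins -/

/-- The results of the coin tosses as an infinite sequence. -/
def coinAt {m : ℕ} (ρ : Fin m → Bool) (i : ℕ) : Bool := if hi : i < m then ρ ⟨i, hi⟩ else false

/-- The number with the binary digits that the coins `t h, …, t h + h - 1` give. -/
def coinWord (h : ℕ) {m : ℕ} (ρ : Fin m → Bool) (t : ℕ) : ℕ :=
  ∑ i ∈ Finset.range h, (coinAt ρ (t * h + i)).toNat * 2 ^ i

/-- The random words that the coins give. -/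
def coinWords (N h : ℕ) (ρ : Fin (N * h) → Bool) (t : Fin N) : ZMod (2 ^ h) := coinWord h ρ t

theorem sum_toNat_mul_two_pow_lt (b : ℕ → Bool) (h : ℕ) :
    ∑ i ∈ Finset.range h, (b i).toNat * 2 ^ i < 2 ^ h := by
  induction h with
  | zero => simp
  | succ h ih =>
    rw [Finset.sum_range_succ, pow_succ]
    have : (b h).toNat * 2 ^ h ≤ 1 * 2 ^ h := Nat.mul_le_mul_right _ (Bool.toNat_le _)
    lia

theorem toNat_digits_injective {b b' : ℕ → Bool} : ∀ {h : ℕ}, ∑ i ∈ Finset.range h,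
    (b i).toNat * 2 ^ i = ∑ i ∈ Finset.range h, (b' i).toNat * 2 ^ i → ∀ i < h, b i = b' i
  | 0, _, i, hi => by lia
  | h + 1, heq, i, hi => by
    rw [Finset.sum_range_succ, Finset.sum_range_succ] at heq
    have h1 := sum_toNat_mul_two_pow_lt b h
    have h2 := sum_toNat_mul_two_pow_lt b' h
    have h3 : b h = b' h := by
      cases hb : b h <;> cases hb' : b' h <;> simp [hb, hb'] at heq ⊢ <;> lia
    rw [h3] at heq
    rcases (Nat.lt_succ_iff.1 hi).lt_or_eq with hi | rfl
    · exact toNat_digits_injective (Nat.add_right_cancel heq) i hi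
    · exact h3

theorem coinWord_lt (h : ℕ) {m : ℕ} (ρ : Fin m → Bool) (t : ℕ) : coinWord h ρ t < 2 ^ h :=
  sum_toNat_mul_two_pow_lt (fun i => coinAt ρ (t * h + i)) h

theorem val_coinWords {N h : ℕ} (ρ : Fin (N * h) → Bool) (t : Fin N) :
    (coinWords N h ρ t).val = coinWord h ρ t := ZMod.val_cast_of_lt (coinWord_lt h ρ t)

/-- The random words are uniformly distributed because they are the coins in another arrangement. -/
theorem coinWords_bijective (N h : ℕ) : (coinWords N h).Bijective := by
  rw [Fintype.bijective_iff_injective_and_card]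
  constructor
  · intro ρ ρ' heq
    funext i
    have hh : 0 < h := Nat.pos_of_ne_zero fun h0 => by
      have := i.2
      simp [h0] at this
    have h1 : (i : ℕ) / h < N := Nat.div_lt_of_lt_mul (i.2.trans_eq (Nat.mul_comm N h))
    have h2 := congrArg ZMod.val (congrFun heq ⟨i / h, h1⟩)
    rw [val_coinWords, val_coinWords] at h2
    have h3 := toNat_digits_injective h2 (i % h) (Nat.mod_lt _ hh)
    simpa only [Nat.div_add_mod', coinAt, i.2, dif_pos] using h3
  · simp [ZMod.card, pow_mul, mul_comm N h]

theorem coinProb_coinWords {N h : ℕ} (E : (Fin N → ZMod (2 ^ h)) → Prop) :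
    coinProb (fun ρ => E (coinWords N h ρ)) = prob E := by
  classical
  rw [coinProb_eq_prob, prob_eq_avg, prob_eq_avg]
  exact avg_comp_bijective (coinWords_bijective N h) fun ω => if E ω then 1 else 0

/-! ### Setting up the machine -/

/-- Toss the coins for one random word and put the word into register 15. -/
def tossWordProg : Prog :=
  .seq (.seqs [.op .plus 15 4 4, .op .plus 16 3 4, .op .plus 17 6 4]) <|
  .loop 17 (.seq (.coin 18) (.seqs [.op .times 18 18 16, .op .plus 15 15 18, .op .times 16 16 5,
    .op .minus 17 17 3]))

/-- Write the random words to memory. -/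
def tossProg : Prog :=
  .seq (.seqs [.op .plus 13 11 4, .op .plus 14 10 4]) <|
  .loop 13 (.seq tossWordProg (.seqs [.store 14 15, .op .plus 14 14 3, .op .minus 13 13 3]))

/-- Put the logarithm of the number in register 10 into register 14. -/
def logProg : Prog :=
  .seq (.seqs [.op .plus 13 10 4, .op .plus 14 4 4, .op .less 15 3 13]) <|
  .loop 15 (.seqs [.op .quot 13 13 5, .op .plus 14 14 3, .op .less 15 3 13])

/-- Put the power of two with the exponent in register 6 into register 7. -/
def powProg : Prog :=
  .seq (.seqs [.op .plus 7 3 4, .op .plus 13 6 4]) <|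
  .loop 13 (.seqs [.op .times 7 7 5, .op .minus 13 13 3])

/-- Compute the parameters and write the random words to memory. -/
def setupProg (β : ℕ) : Prog :=
  .seq (.seqs [.lit 3 1, .lit 5 2, .op .plus 10 0 5]) <|
  .seq logProg <|
  .seq (.seqs [.lit 16 β, .op .times 6 16 14, .lit 16 40, .op .times 8 16 14, .lit 16 90,
    .op .times 12 16 14, .lit 16 3, .op .times 43 16 6, .op .plus 43 43 3, .op .plus 17 6 3,
    .op .times 46 8 17, .op .plus 46 43 46, .op .plus 17 12 3, .op .times 11 17 46]) <|
  .seq powProg <|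
  .seq (.seqs [.lit 16 80, .op .times 16 16 1, .op .times 16 16 12, .op .times 16 16 17,
    .op .times 16 16 8, .op .quot 9 7 16]) tossProg

theorem Prog.Ends.coin {w i : ℕ} {s : MState} {b : Bool} {bs : List Bool} (hs : s.coins = b :: bs)
    (hw : 1 < 2 ^ w) : (Prog.coin i).Ends w s 1 fun s' =>
      s' = { s.setReg i b.toNat with coins := bs } := by
  refine ⟨1, _, .coin s i b bs hs, le_rfl, ?_⟩
  rw [Nat.mod_eq_of_lt ((Bool.toNat_le b).trans_lt hw)]

theorem drop_ofFn_eq_cons {m : ℕ} (ρ : Fin m → Bool) {i : ℕ} (hi : i < m) :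
    (List.ofFn ρ).drop i = coinAt ρ i :: (List.ofFn ρ).drop (i + 1) := by
  rw [List.drop_eq_getElem_cons (by simpa using hi)]
  simp [coinAt, hi]

theorem tossWordProg_ends {w h m t : ℕ} {s : MState} {ρ : Fin m → Bool}
    (hw : 2 * 2 ^ h < 2 ^ w) (hhw : h < 2 ^ w) (h3 : s.reg 3 = 1) (h4 : s.reg 4 = 0)
    (h5 : s.reg 5 = 2) (h6 : s.reg 6 = h) (hc : s.coins = (List.ofFn ρ).drop (t * h))
    (hm : t * h + h ≤ m) :
    tossWordProg.Ends w s (7 * h + 5) fun s' => s'.reg 15 = coinWord h ρ t ∧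
      s'.coins = (List.ofFn ρ).drop (t * h + h) := by
  have hpow := Nat.one_le_two_pow (n := h)
  refine ((Prog.SafeAll.ends (l := [.op .plus 15 4 4, .op .plus 16 3 4, .op .plus 17 6 4]) ?_).seq
    (B' := h * ((1 + 5) + 1) + 1) ?_).mono (by simp; lia) fun _ h _ => h
  · simp [Prog.SafeAll, Prog.Safe, Prog.step, Op.eval, h3, h4, h6]
    lia
  rintro s₁ hs₁ -
  have k : ∀ r < 13, s₁.reg r = s.reg r := fun r hr => by
    simp [hs₁, Prog.steps, Prog.step]
    lia
  have e : s₁.reg 15 = 0 ∧ s₁.reg 16 = 1 ∧ s₁.reg 17 = h ∧ s₁.coins = s.coins := by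
    simp [hs₁, Prog.steps, Prog.step, Op.eval, h3, h4, h6]
  refine (Prog.Ends.loop_const h (fun i s' => s'.reg 17 = h - i ∧ s'.reg 16 = 2 ^ i ∧
    s'.reg 15 = ∑ a ∈ Finset.range i, (coinAt ρ (t * h + a)).toNat * 2 ^ a ∧
    s'.coins = (List.ofFn ρ).drop (t * h + i)) ?_ ?_ ?_).mono le_rfl ?_
  · exact ⟨e.2.2.1, e.2.1, by simpa using e.1, by simpa [e.2.2.2] using hc⟩
  · rintro i s₂ hi ⟨h17, h16, h15, hcoins⟩ hfr
    refine ⟨by lia, ?_⟩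
    rw [drop_ofFn_eq_cons ρ (by lia)] at hcoins
    refine (Prog.Ends.coin hcoins (by lia)).seq ?_
    rintro s₃ rfl -
    have k₂ : ∀ r < 13, s₂.reg r = s.reg r := fun r hr => by
      rw [hfr.reg r (by interval_cases r <;> rfl), k r hr]
    have g3 := (k₂ 3 (by lia)).trans h3
    have g5 := (k₂ 5 (by lia)).trans h5
    have b1 := sum_toNat_mul_two_pow_lt (fun a => coinAt ρ (t * h + a)) i
    have b2 : (coinAt ρ (t * h + i)).toNat * 2 ^ i ≤ 1 * 2 ^ i :=
      Nat.mul_le_mul_right _ (Bool.toNat_le _)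
    have b3 : 2 ^ i ≤ 2 ^ h := Nat.pow_le_pow_right (by lia) hi.le
    refine (Prog.SafeAll.ends ?_).mono (by simp) ?_
    · simp [Prog.SafeAll, Prog.Safe, Prog.step, Op.eval, h17, h16, h15, g3, g5]
      refine ⟨by lia, by lia, by lia, by lia⟩
    · rintro _ rfl -
      simp [Prog.steps, Prog.step, Op.eval, h17, h16, h15, g3, g5, Finset.sum_range_succ, pow_succ,
        add_assoc]
      lia
  · rintro s' ⟨h17, -⟩
    rw [h17, Nat.sub_self]
  · rintro s' ⟨-, -, h15, hcoins⟩ -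
    exact ⟨h15, hcoins⟩

theorem tossProg_ends {w h N S : ℕ} {s : MState} {ρ : Fin (N * h) → Bool}
    (hw : 2 * 2 ^ h < 2 ^ w) (hhw : h < 2 ^ w) (hS : S + N < 2 ^ w) (h3 : s.reg 3 = 1)
    (h4 : s.reg 4 = 0) (h5 : s.reg 5 = 2) (h6 : s.reg 6 = h) (h10 : s.reg 10 = S)
    (h11 : s.reg 11 = N) (hc : s.coins = List.ofFn ρ) :
    tossProg.Ends w s (N * (7 * h + 10) + 4) fun s' =>
      (∀ t < N, s'.mem (S + t) = coinWord h ρ t) ∧ ∀ a < S, s'.mem a = s.mem a := by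
  refine ((Prog.SafeAll.ends (l := [.op .plus 13 11 4, .op .plus 14 10 4]) ?_).seq
    (B' := N * (((7 * h + 5) + 4) + 1) + 1) ?_).mono (by simp; lia) fun _ h _ => h
  · simp [Prog.SafeAll, Prog.Safe, Prog.step, Op.eval, h4, h10, h11]
    lia
  rintro s₁ hs₁ -
  have k : ∀ r < 13, s₁.reg r = s.reg r := fun r hr => by
    simp [hs₁, Prog.steps, Prog.step]
    lia
  have e : s₁.reg 13 = N ∧ s₁.reg 14 = S ∧ s₁.coins = s.coins ∧ s₁.mem = s.mem := by
    simp [hs₁, Prog.steps, Prog.step, Op.eval, h4, h10, h11]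
  refine (Prog.Ends.loop_const N (fun i s' => s'.reg 13 = N - i ∧ s'.reg 14 = S + i ∧
    s'.coins = (List.ofFn ρ).drop (i * h) ∧ (∀ t < i, s'.mem (S + t) = coinWord h ρ t) ∧
    ∀ a < S, s'.mem a = s.mem a) ?_ ?_ ?_).mono le_rfl ?_
  · exact ⟨e.1, e.2.1, by simpa [e.2.2.1] using hc, by simp, fun a _ => by rw [e.2.2.2]⟩
  · rintro i s₂ hi ⟨h13, h14, hcoins, htab, hmem⟩ hfr
    refine ⟨by lia, ?_⟩
    have k₂ : ∀ r < 13, s₂.reg r = s.reg r := fun r hr => by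
      rw [hfr.reg r (by interval_cases r <;> rfl), k r hr]
    have hN : i * h + h ≤ N * h := by
      rw [← Nat.succ_mul]
      exact Nat.mul_le_mul_right _ hi
    refine ((tossWordProg_ends hw hhw ((k₂ 3 (by lia)).trans h3) ((k₂ 4 (by lia)).trans h4)
      ((k₂ 5 (by lia)).trans h5) ((k₂ 6 (by lia)).trans h6) hcoins hN).seq (B' := 4) ?_).mono le_rfl
      fun _ h _ => h
    rintro s₃ ⟨h15, hcoins₃⟩ hF₃
    have g3 : s₃.reg 3 = 1 := (hF₃.reg 3 rfl).trans ((k₂ 3 (by lia)).trans h3)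
    have g13 : s₃.reg 13 = N - i := (hF₃.reg 13 rfl).trans h13
    have g14 : s₃.reg 14 = S + i := (hF₃.reg 14 rfl).trans h14
    have hm₃ : s₃.mem = s₂.mem := hF₃.mem rfl
    refine (Prog.SafeAll.ends ?_).mono le_rfl ?_
    · simp [Prog.SafeAll, Prog.Safe, Prog.step, Op.eval, g3, g13, g14]
      lia
    · rintro s₄ hs₄ -
      have hm₄ : s₄.mem = Function.update s₂.mem (S + i) (coinWord h ρ i) := by
        simp [hs₄, Prog.steps, Prog.step, g14, h15, hm₃]
      refine ⟨?_, ?_, ?_, fun t ht => ?_, fun a ha => ?_⟩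
      · simp [hs₄, Prog.steps, Prog.step, Op.eval, g3, g13]
        lia
      · simp [hs₄, Prog.steps, Prog.step, Op.eval, g3, g14, add_assoc]
      · rw [Nat.succ_mul, ← hcoins₃, hs₄]
        rfl
      · rw [hm₄]
        rcases (Nat.lt_succ_iff.1 ht).lt_or_eq with ht | rfl
        · rw [Function.update_of_ne (by lia), htab t ht]
        · rw [Function.update_self]
      · rw [hm₄, Function.update_of_ne (by lia), hmem a ha]
  · rintro s' ⟨h13, -⟩
    rw [h13, Nat.sub_self]
  · rintro s' ⟨-, -, -, htab, hmem⟩ -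
    exact ⟨htab, hmem⟩

theorem one_lt_div_two_pow_iff {n i : ℕ} (hn : n ≠ 0) : 1 < n / 2 ^ i ↔ i < Nat.log 2 n := by
  rw [Nat.lt_iff_add_one_le, Nat.le_div_iff_mul_le (by positivity), Nat.lt_iff_add_one_le,
    Nat.le_log_iff_pow_le (by lia) hn, pow_succ, mul_comm]

theorem logProg_ends {w S : ℕ} {s : MState} (hS : 1 < S) (hw : S < 2 ^ w) (h3 : s.reg 3 = 1)
    (h4 : s.reg 4 = 0) (h5 : s.reg 5 = 2) (h10 : s.reg 10 = S) :
    logProg.Ends w s (5 * Nat.log 2 S + 5) fun s' => s'.reg 14 = Nat.log 2 S := by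
  have hlog : Nat.log 2 S < S := Nat.log_lt_self 2 (by lia)
  refine ((Prog.SafeAll.ends (l := [.op .plus 13 10 4, .op .plus 14 4 4, .op .less 15 3 13]) ?_).seq
    (B' := Nat.log 2 S * (4 + 1) + 1) ?_).mono (by simp; lia) fun _ h _ => h
  · simp [Prog.SafeAll, Prog.Safe, Prog.step, Op.eval, h3, h4, h10]
    split_ifs <;> lia
  rintro s₁ hs₁ -
  have e : s₁.reg 3 = 1 ∧ s₁.reg 5 = 2 ∧ s₁.reg 13 = S ∧ s₁.reg 14 = 0 ∧
      s₁.reg 15 = if 1 < S then 1 else 0 := by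
    simp [hs₁, Prog.steps, Prog.step, Op.eval, h3, h4, h5, h10]
  obtain ⟨e3, e5, e13, e14, e15⟩ := e
  refine (Prog.Ends.loop_const (Nat.log 2 S) (fun i s' => s'.reg 13 = S / 2 ^ i ∧ s'.reg 14 = i ∧
    s'.reg 15 = if 1 < S / 2 ^ i then 1 else 0) ?_ ?_ ?_).mono le_rfl ?_
  · simpa using ⟨e13, e14, e15⟩
  · rintro i s₂ hi ⟨h13, h14, h15⟩ hfr
    have g3 : s₂.reg 3 = 1 := (hfr.reg 3 rfl).trans e3
    have g5 : s₂.reg 5 = 2 := (hfr.reg 5 rfl).trans e5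
    refine ⟨by rw [h15, if_pos ((one_lt_div_two_pow_iff (by lia)).2 hi)]; lia, ?_⟩
    have hdiv : S / 2 ^ i / 2 ≤ S := (Nat.div_le_self _ _).trans (Nat.div_le_self _ _)
    refine (Prog.SafeAll.ends ?_).mono le_rfl ?_
    · simp [Prog.SafeAll, Prog.Safe, Prog.step, Op.eval, h13, h14, g3, g5]
      refine ⟨by lia, by lia, by split_ifs <;> lia⟩
    · rintro _ rfl -
      simp [Prog.steps, Prog.step, Op.eval, h13, h14, g3, g5, Nat.div_div_eq_div_mul, pow_succ]
  · rintro s' ⟨-, -, h15⟩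
    rw [h15, if_neg fun h => lt_irrefl _ ((one_lt_div_two_pow_iff (by lia)).1 h)]
  · rintro s' ⟨-, h14, -⟩ -
    exact h14

theorem powProg_ends {w h : ℕ} {s : MState} (hw : 2 * 2 ^ h < 2 ^ w) (hhw : h < 2 ^ w)
    (h3 : s.reg 3 = 1) (h4 : s.reg 4 = 0) (h5 : s.reg 5 = 2) (h6 : s.reg 6 = h) :
    powProg.Ends w s (4 * h + 4) fun s' => s'.reg 7 = 2 ^ h := by
  have hpow := Nat.one_le_two_pow (n := h)
  refine ((Prog.SafeAll.ends (l := [.op .plus 7 3 4, .op .plus 13 6 4]) ?_).seq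
    (B' := h * (3 + 1) + 1) ?_).mono (by simp; lia) fun _ h _ => h
  · simp [Prog.SafeAll, Prog.Safe, Prog.step, Op.eval, h3, h4, h6]
    lia
  rintro s₁ hs₁ -
  have e : s₁.reg 3 = 1 ∧ s₁.reg 5 = 2 ∧ s₁.reg 7 = 1 ∧ s₁.reg 13 = h := by
    simp [hs₁, Prog.steps, Prog.step, Op.eval, h3, h4, h5, h6]
  obtain ⟨e3, e5, e7, e13⟩ := e
  refine (Prog.Ends.loop_const h (fun i s' => s'.reg 13 = h - i ∧ s'.reg 7 = 2 ^ i)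
    ?_ ?_ ?_).mono le_rfl ?_
  · simpa using ⟨e13, e7⟩
  · rintro i s₂ hi ⟨h13, h7⟩ hfr
    have g3 : s₂.reg 3 = 1 := (hfr.reg 3 rfl).trans e3
    have g5 : s₂.reg 5 = 2 := (hfr.reg 5 rfl).trans e5
    have b3 : 2 ^ i ≤ 2 ^ h := Nat.pow_le_pow_right (by lia) hi.le
    refine ⟨by lia, ?_⟩
    refine (Prog.SafeAll.ends ?_).mono le_rfl ?_
    · simp [Prog.SafeAll, Prog.Safe, Prog.step, Op.eval, h13, h7, g3, g5]
      refine ⟨by lia, by lia⟩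
    · rintro _ rfl -
      simp [Prog.steps, Prog.step, Op.eval, h13, h7, g3, g5, pow_succ]
      lia
  · rintro s' ⟨h13, -⟩
    rw [h13, Nat.sub_self]
  · rintro s' ⟨-, h7⟩ -
    exact h7

/-- The divisor `D` of the splitting threshold `2 ^ h / D`, which is also the bound for the number of
names in a block.  It is so large that the at most `k` edits, each of which touches at most `4 j + 4`
names at level `j < J`, meet a splitting name with probability at most `1 / 20`. -/
def splitDiv (k J K : ℕ) : ℕ := 80 * k * J * (J + 1) * K

/-- The parameters of a run, as the program computes them from `n` and `k`.  Two rounds shrink the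
blocks by a factor `3 / 4` and a row of the splitting test fails with probability at most `5 / 8`, so
`90 lg n` rounds and `40 lg n` rows bring both error probabilities far below `1 / n ^ 2`. -/
def runParams (β b n k : ℕ) : Params where
  w := b * lg n
  h := β * lg n
  K := 40 * lg n
  θ := 2 ^ (β * lg n) / splitDiv k (90 * lg n) (40 * lg n)
  S := n + 2
  J := 90 * lg n
  N := (90 * lg n + 1) * chunk (β * lg n) (40 * lg n)

theorem lg_pos (n : ℕ) : 0 < lg n := Nat.log_pos (by lia) (by lia)

/-- The set-up leaves the parameters in the registers and the random words, read off the coins, in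
memory; the input and the output are untouched. -/
theorem setupProg_ends {β b n k : ℕ} {π : Params} (hπe : π = runParams β b n k) (hk : 1 ≤ k)
    (hπ : Fits π) (hD : splitDiv k π.J π.K ≤ 2 ^ π.h) {x : List ℕ} (hx : x.length ≤ n)
    (ρ : Fin (π.N * π.h) → Bool) :
    (setupProg β).Ends π.w (initState n k x ρ)
      (5 * lg n + 4 * π.h + π.N * (7 * π.h + 10) + 39) fun s' =>
      Ready π (padWords (coinWords _ _ ρ)) s' ∧ s'.reg 2 = x.length ∧
      s'.reg 43 = 3 * π.h + 1 ∧ s'.reg 46 = chunk π.h π.K ∧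
      (∀ i c, x[i]? = some c → s'.mem i = c) ∧ s'.out = [] := by
  have eh : π.h = β * lg n := by rw [hπe]; rfl
  have eK : π.K = 40 * lg n := by rw [hπe]; rfl
  have eJ : π.J = 90 * lg n := by rw [hπe]; rfl
  have eS : π.S = n + 2 := by rw [hπe]; rfl
  have eN : π.N = (π.J + 1) * chunk π.h π.K := by rw [hπe]; rfl
  have eθ : π.θ = 2 ^ π.h / splitDiv k π.J π.K := by rw [hπe]; rfl
  have hmod := hπ.modulus
  have hmem := hπ.memory
  have hwid := hπ.width
  have hq := lg_pos n
  have hpow := Nat.one_le_two_pow (n := π.h)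
  have hck : chunk π.h π.K = 3 * π.h + 1 + π.K * (π.h + 1) := rfl
  have hNc : chunk π.h π.K ≤ π.N := by
    rw [eN]
    exact Nat.le_mul_of_pos_left _ (by lia)
  have hNJ : π.J + 1 ≤ π.N := by
    rw [eN]
    exact Nat.le_mul_of_pos_right _ (by lia)
  have hβ : β ≤ π.h := eh ▸ Nat.le_mul_of_pos_right _ hq
  have hKw := hπ.rows
  have hND : π.S + π.N < 2 ^ π.w := by lia
  have hD1 : 80 * k ≤ 80 * k * π.J := Nat.le_mul_of_pos_right _ (by lia)
  have hD2 : 80 * k * π.J ≤ 80 * k * π.J * (π.J + 1) := Nat.le_mul_of_pos_right _ (by lia)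
  have hD3 : 80 * k * π.J * (π.J + 1) ≤ splitDiv k π.J π.K := Nat.le_mul_of_pos_right _ (by lia)
  have hD4 : splitDiv k π.J π.K = 80 * k * π.J * (π.J + 1) * π.K := rfl
  refine ((Prog.SafeAll.ends (l := [.lit 3 1, .lit 5 2, .op .plus 10 0 5]) ?_).seq
    (B' := (5 * lg n + 5) + (15 + ((4 * π.h + 4) + (7 + (π.N * (7 * π.h + 10) + 4))))) ?_).mono
    (by simp; lia) fun _ h _ => h
  · simp [Prog.SafeAll, Prog.Safe, Prog.step, Op.eval, initState]
    lia
  rintro s₁ hs₁ -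
  have e : s₁.reg 1 = k ∧ s₁.reg 2 = x.length ∧ s₁.reg 3 = 1 ∧ s₁.reg 4 = 0 ∧ s₁.reg 5 = 2 ∧
      s₁.reg 10 = π.S ∧ s₁.coins = List.ofFn ρ ∧ s₁.out = [] ∧ s₁.mem = fun i => x.getD i 0 := by
    simp [hs₁, Prog.steps, Prog.step, Op.eval, initState, eS]
  obtain ⟨e1, e2, e3, e4, e5, e10, ec, eo, em⟩ := e
  have elg : Nat.log 2 π.S = lg n := by rw [eS]; rfl
  refine (elg ▸ logProg_ends (w := π.w) (S := π.S) (by lia) (by lia) e3 e4 e5 e10).seq ?_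
  intro s₂ h14 hF₂
  have f1 : s₂.reg 1 = k := (hF₂.reg 1 rfl).trans e1
  have f2 : s₂.reg 2 = x.length := (hF₂.reg 2 rfl).trans e2
  have f3 : s₂.reg 3 = 1 := (hF₂.reg 3 rfl).trans e3
  have f4 : s₂.reg 4 = 0 := (hF₂.reg 4 rfl).trans e4
  have f5 : s₂.reg 5 = 2 := (hF₂.reg 5 rfl).trans e5
  have f10 : s₂.reg 10 = π.S := (hF₂.reg 10 rfl).trans e10
  refine (Prog.SafeAll.ends (l := [.lit 16 β, .op .times 6 16 14, .lit 16 40, .op .times 8 16 14,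
    .lit 16 90, .op .times 12 16 14, .lit 16 3, .op .times 43 16 6, .op .plus 43 43 3,
    .op .plus 17 6 3, .op .times 46 8 17, .op .plus 46 43 46, .op .plus 17 12 3,
    .op .times 11 17 46]) ?_).seq ?_
  · have b1 : π.K * (π.h + 1) < 2 ^ π.w := by lia
    have b2 : chunk π.h π.K < 2 ^ π.w := by lia
    have b3 : 3 * π.h + 1 ≤ chunk π.h π.K := by lia
    simp [Prog.SafeAll, Prog.Safe, Prog.step, Op.eval, f3, h14, ← eh, ← eK, ← eJ, ← hck, ← eN]
    repeat' apply And.intro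
    all_goals lia
  rintro s₃ hs₃ -
  have g : s₃.reg 1 = k ∧ s₃.reg 2 = x.length ∧ s₃.reg 3 = 1 ∧ s₃.reg 4 = 0 ∧ s₃.reg 5 = 2 ∧
      s₃.reg 6 = π.h ∧ s₃.reg 8 = π.K ∧ s₃.reg 10 = π.S ∧ s₃.reg 11 = π.N ∧ s₃.reg 12 = π.J ∧
      s₃.reg 17 = π.J + 1 ∧ s₃.reg 43 = 3 * π.h + 1 ∧ s₃.reg 46 = chunk π.h π.K := by
    simp [hs₃, Prog.steps, Prog.step, Op.eval, f1, f2, f3, f4, f5, f10, h14, ← eh, ← eK, ← eJ,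
      ← hck, ← eN]
  have gs : s₃.coins = s₁.coins ∧ s₃.out = s₁.out ∧ s₃.mem = s₁.mem := by
    rw [hs₃]
    exact ⟨hF₂.coins rfl, hF₂.out rfl, hF₂.mem rfl⟩
  obtain ⟨g1, g2, g3, g4, g5, g6, g8, g10, g11, g12, g17, g43, g46⟩ := g
  refine (powProg_ends hmod (by lia) g3 g4 g5 g6).seq ?_
  intro s₄ h7 hF₄
  have k12 : s₄.reg 12 = π.J := (hF₄.reg 12 rfl).trans g12
  have k17 : s₄.reg 17 = π.J + 1 := (hF₄.reg 17 rfl).trans g17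
  have k8 : s₄.reg 8 = π.K := (hF₄.reg 8 rfl).trans g8
  have k1 : s₄.reg 1 = k := (hF₄.reg 1 rfl).trans g1
  refine (Prog.SafeAll.ends (l := [.lit 16 80, .op .times 16 16 1, .op .times 16 16 12,
    .op .times 16 16 17, .op .times 16 16 8, .op .quot 9 7 16]) ?_).seq ?_
  · have hθ := Nat.div_le_self (2 ^ π.h) (splitDiv k π.J π.K)
    simp [Prog.SafeAll, Prog.Safe, Prog.step, Op.eval, k1, k8, k12, k17, h7, ← hD4]
    lia
  rintro s₅ hs₅ -
  have k₀ : ∀ r, r ≠ 9 → r ≠ 16 → s₅.reg r = s₄.reg r := fun r h1 h2 => by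
    simp [hs₅, Prog.steps, Prog.step, h1, h2]
  have e9 : s₅.reg 9 = π.θ := by
    simp [hs₅, Prog.steps, Prog.step, Op.eval, k1, k8, k12, k17, h7, ← hD4, eθ]
  have e7 : s₅.reg 7 = 2 ^ π.h := (k₀ 7 (by lia) (by lia)).trans h7
  have k₅ : ∀ r, r ≠ 7 → r ≠ 9 → r ≠ 13 → r ≠ 16 → s₅.reg r = s₃.reg r := fun r h1 h2 h3 h4 => by
    rw [k₀ r h2 h4]
    exact hF₄.reg r (by simp [Prog.writes, powProg, Prog.seqs, h1, h3])
  have gs₅ : s₅.coins = List.ofFn ρ ∧ s₅.out = [] ∧ s₅.mem = fun i => x.getD i 0 := by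
    rw [hs₅]
    exact ⟨((hF₄.coins rfl).trans gs.1).trans ec, ((hF₄.out rfl).trans gs.2.1).trans eo,
      ((hF₄.mem rfl).trans gs.2.2).trans em⟩
  refine (tossProg_ends hmod (by lia) hND ((k₅ 3 (by lia) (by lia) (by lia) (by lia)).trans g3)
    ((k₅ 4 (by lia) (by lia) (by lia) (by lia)).trans g4)
    ((k₅ 5 (by lia) (by lia) (by lia) (by lia)).trans g5)
    ((k₅ 6 (by lia) (by lia) (by lia) (by lia)).trans g6)
    ((k₅ 10 (by lia) (by lia) (by lia) (by lia)).trans g10)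
    ((k₅ 11 (by lia) (by lia) (by lia) (by lia)).trans g11) gs₅.1).mono le_rfl ?_
  rintro s₆ ⟨htab, hother⟩ hF₆
  have k₆ : ∀ r, r < 13 ∨ r = 43 ∨ r = 46 → s₆.reg r = s₅.reg r := by
    rintro r (hr | rfl | rfl)
    · exact hF₆.reg r (by interval_cases r <;> rfl)
    all_goals exact hF₆.reg _ rfl
  have k₆' : ∀ r, (r < 13 ∨ r = 43 ∨ r = 46) → r ≠ 7 → r ≠ 9 → s₆.reg r = s₃.reg r :=
    fun r h1 h2 h3 => (k₆ r h1).trans (k₅ r h2 h3 (by lia) (by lia))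
  refine ⟨⟨(k₆' 3 (by lia) (by lia) (by lia)).trans g3, (k₆' 4 (by lia) (by lia) (by lia)).trans g4,
    (k₆' 5 (by lia) (by lia) (by lia)).trans g5, (k₆' 6 (by lia) (by lia) (by lia)).trans g6,
    (k₆ 7 (by lia)).trans e7, (k₆' 8 (by lia) (by lia) (by lia)).trans g8,
    (k₆ 9 (by lia)).trans e9, (k₆' 10 (by lia) (by lia) (by lia)).trans g10,
    (k₆' 11 (by lia) (by lia) (by lia)).trans g11, (k₆' 12 (by lia) (by lia) (by lia)).trans g12,
    fun t ht => ?_⟩, (k₆' 2 (by lia) (by lia) (by lia)).trans g2,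
    (k₆' 43 (by lia) (by lia) (by lia)).trans g43, (k₆' 46 (by lia) (by lia) (by lia)).trans g46,
    fun i c hc => ?_, (hF₆.out rfl).trans gs₅.2.1⟩
  · rw [htab t ht, padWords, dif_pos ht, val_coinWords]
  · have hi := (List.getElem?_eq_some_iff.1 hc).1
    rw [hother i (by lia), gs₅.2.2]
    simp [hc]


/-! ### The choice of the parameters -/

/-- The parameters for inputs of length at most `n` over an alphabet of `(n + 1) ^ a` symbols.  As
`n + 2 ≤ 4 ^ lg n`, the `(2 a + 40) lg n` bits of a name give room for the letters and keep
the total probability of a collision of names below `1 / (100 n)`. -/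
def params (a n k : ℕ) : Params := runParams (2 * a + 40) (2 * a + 100) n k

theorem two_le_two_pow_lg (n : ℕ) : 2 ≤ 2 ^ lg n := Nat.le_self_pow (lg_pos n).ne' 2

theorem add_two_le_two_pow_lg_sq (n : ℕ) : n + 2 ≤ (2 ^ lg n) ^ 2 := by
  have h1 : n + 2 < 2 ^ (lg n + 1) := Nat.lt_pow_succ_log_self one_lt_two _
  have h2 := Nat.mul_le_mul_left (2 ^ lg n) (two_le_two_pow_lg n)
  rw [pow_succ] at h1
  rw [sq]
  exact h1.le.trans h2

theorem const_mul_lg_add_one_le (n : ℕ) : 90 * lg n + 1 ≤ (2 ^ lg n) ^ 8 := by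
  have h1 := two_le_two_pow_lg n
  have h2 : lg n < 2 ^ lg n := Nat.lt_two_pow_self
  have h3 := Nat.pow_le_pow_left h1 7
  have h4 := Nat.mul_le_mul_right (2 ^ lg n) h3
  rw [← pow_succ] at h4
  lia

theorem two_pow_width (a n k : ℕ) : 2 ^ (params a n k).h = (2 ^ lg n) ^ (2 * a + 40) := by
  rw [← pow_mul, mul_comm]; rfl

theorem splitDiv_le {a n k : ℕ} (hkn : k ≤ n) :
    splitDiv k (params a n k).J (params a n k).K ≤ 2 ^ (params a n k).h := by
  have h1 := two_le_two_pow_lg n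
  have h2 := add_two_le_two_pow_lg_sq n
  have h3 := const_mul_lg_add_one_le n
  have h7 := Nat.pow_le_pow_left h1 7
  rw [two_pow_width]
  show 80 * k * (90 * lg n) * (90 * lg n + 1) * (40 * lg n) ≤ _
  generalize hQ : 2 ^ lg n = Q at *
  calc 80 * k * (90 * lg n) * (90 * lg n + 1) * (40 * lg n)
      ≤ Q ^ 7 * Q ^ 2 * Q ^ 8 * Q ^ 8 * Q ^ 8 := by gcongr <;> lia
    _ = Q ^ 33 := by ring
    _ ≤ Q ^ (2 * a + 40) := Nat.pow_le_pow_right (by lia) (by lia)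

theorem splitDiv_pos {a n k : ℕ} (hk : 1 ≤ k) :
    0 < splitDiv k (params a n k).J (params a n k).K := by
  have := lg_pos n
  show 0 < 80 * k * (90 * lg n) * (90 * lg n + 1) * (40 * lg n)
  positivity

theorem fits_params (a n k : ℕ) : Fits (params a n k) := by
  have h1 := two_le_two_pow_lg n
  have h2 := add_two_le_two_pow_lg_sq n
  have h3 := const_mul_lg_add_one_le n
  have hq : lg n < 2 ^ lg n := Nat.lt_two_pow_self
  have hw : 2 ^ (params a n k).w = (2 ^ lg n) ^ (2 * a + 100) := by
    rw [← pow_mul, mul_comm]; rfl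
  set β := 2 * a + 40 with hβ
  have hβQ : β ≤ (2 ^ lg n) ^ β :=
    Nat.lt_two_pow_self.le.trans (Nat.pow_le_pow_left h1 β)
  have hM := two_pow_width a n k
  have e1 : (params a n k).h = β * lg n := rfl
  have e2 : (params a n k).K = 40 * lg n := rfl
  have e3 : (params a n k).S = n + 2 := rfl
  have e4 : (params a n k).J = 90 * lg n := rfl
  have e5 : (params a n k).N = (90 * lg n + 1) * (3 * (β * lg n) + 1 +
    40 * lg n * (β * lg n + 1)) := rfl
  have e6 : (params a n k).θ = 2 ^ (params a n k).h / splitDiv k (90 * lg n) (40 * lg n) := rfl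
  generalize hQ : 2 ^ lg n = Q at *
  have hp : ∀ {i j}, i < j → 2 * Q ^ i ≤ Q ^ j := fun {i j} hij => by
    calc 2 * Q ^ i ≤ Q * Q ^ i := Nat.mul_le_mul_right _ h1
      _ = Q ^ (i + 1) := by ring
      _ ≤ Q ^ j := Nat.pow_le_pow_right (by lia) hij
  have hpos : ∀ i, 0 < Q ^ i := fun i => Nat.pow_pos (by lia)
  have hβq : β * lg n + 1 ≤ Q ^ (β + 2) := by
    have := Nat.mul_le_mul hβQ hq.le
    rw [← pow_succ] at this
    have h5 := hp (i := β + 1) (j := β + 2) (by lia)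
    have := hpos (β + 1)
    lia
  have h4 : Q ^ (β + 2) * 4 ≤ Q ^ (β + 4) := by
    have h5 := hp (i := β + 2) (j := β + 3) (by lia)
    have h6 := hp (i := β + 3) (j := β + 4) (by lia)
    lia
  refine ⟨?_, ?_, ?_, ?_, ?_, ?_⟩
  · rw [hw, hM]
    have h5 := hp (i := β) (j := β + 1) (by lia)
    have h6 := hp (i := β + 1) (j := 2 * a + 100) (by lia)
    have := hpos (β + 1)
    lia
  · rw [hw, e1]
    have h6 := hp (i := β + 4) (j := 2 * a + 100) (by lia)
    have := hpos (β + 4)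
    lia
  · rw [hw, e2]
    have := lg_pos n
    have h6 := hp (i := 8) (j := 2 * a + 100) (by lia)
    have := hpos 8
    lia
  · rw [e6]
    exact Nat.div_le_self _ _
  · rw [hw, e3, e4, e5]
    have c1 : 3 * (β * lg n) + 1 + 40 * lg n * (β * lg n + 1) ≤ Q ^ (β + 13) := by
      have c2 : 40 * lg n * (β * lg n + 1) ≤ Q ^ 8 * Q ^ (β + 4) := by gcongr <;> lia
      have c3 := hp (i := β + 12) (j := β + 13) (by lia)
      have c4 : Q ^ 8 * Q ^ (β + 4) = Q ^ (β + 12) := by ring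
      have c5 : Q ^ (β + 4) ≤ Q ^ (β + 12) := Nat.pow_le_pow_right (by lia) (by lia)
      lia
    have c6 := Nat.mul_le_mul h3 c1
    have c7 : Q ^ 8 * Q ^ (β + 13) = Q ^ (β + 21) := by ring
    have c8 : (3 * (90 * lg n) + 4) * (n + 2) ≤ Q ^ 10 * Q ^ 2 := by
      have c9 := hp (i := 8) (j := 9) (by lia)
      have c10 := hp (i := 9) (j := 10) (by lia)
      gcongr
      lia
    have c11 : Q ^ 10 * Q ^ 2 ≤ Q ^ (β + 21) := by
      rw [← pow_add]
      exact Nat.pow_le_pow_right (by lia) (by lia)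
    have c12 : Q ^ 2 ≤ Q ^ (β + 21) := Nat.pow_le_pow_right (by lia) (by lia)
    have c13 := hp (i := β + 21) (j := β + 22) (by lia)
    have c14 := hp (i := β + 22) (j := β + 23) (by lia)
    have c15 := hp (i := β + 23) (j := 2 * a + 100) (by lia)
    have := hpos (β + 21)
    lia
  · rw [e3]; lia

theorem length_add_one_lt_two_pow {a n : ℕ} (k : ℕ) {x : List ℕ} (hx : IsInput a n x) :
    x.length + 1 < 2 ^ (params a n k).h := by
  have h1 := add_two_le_two_pow_lg_sq n
  have h2 : (2 ^ lg n) ^ 2 ≤ (2 ^ lg n) ^ (2 * a + 40) :=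
    Nat.pow_le_pow_right (by have := two_le_two_pow_lg n; lia) (by lia)
  have := hx.1
  rw [two_pow_width]
  lia

theorem symbol_add_one_lt_two_pow {a n : ℕ} (k : ℕ) {x : List ℕ} (hx : IsInput a n x) :
    ∀ c ∈ x, c + 1 < 2 ^ (params a n k).h := fun c hc => by
  have h1 := add_two_le_two_pow_lg_sq n
  have h2 : (n + 1) ^ a ≤ ((2 ^ lg n) ^ 2) ^ a := Nat.pow_le_pow_left (by lia) a
  have h3 : (2 ^ lg n) ^ (2 * a) < (2 ^ lg n) ^ (2 * a + 40) :=
    Nat.pow_lt_pow_right (by have := two_le_two_pow_lg n; lia) (by lia)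
  have := hx.2 c hc
  rw [← pow_mul] at h2
  rw [two_pow_width]
  lia

/-! ### The decomposition and its running time -/

/-- The program of the decomposition algorithm. -/
def decomposeProg (a : ℕ) : Prog :=
  .seq (setupProg (2 * a + 40)) (.seq levelsProg outputProg)

/-- The decomposition of `x` with the random words `T`. -/
def wordGrammars (π : Params) (T : ℕ → ZMod (2 ^ π.h)) (x : List ℕ) : List Grammar :=
  (level π.K π.θ T x π.J).flatten.map nodeGrammar

/-- The decomposition of `x` as a function of the coins. -/
def coinGrammars (a n k : ℕ) (ρ : Fin ((params a n k).N * (params a n k).h) → Bool)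
    (x : List ℕ) : List Grammar :=
  wordGrammars (params a n k) (padWords (coinWords _ _ ρ)) x

/-- The constant in the bounds for the running time and the size of the grammars, with room to
spare. -/
def boundConst (a : ℕ) : ℕ := 10 ^ 10 * (2 * a + 41) ^ 2

/-- The sum of the costs of the set-up, the rounds and the output, for a string of length `l`. -/
theorem decomposeProg_cost (a n k l : ℕ) :
    (5 * lg n + 4 * (params a n k).h + (params a n k).N * (7 * (params a n k).h + 10) + 39) +
      (((params a n k).J + 1) * ((l + 1) * (nodeCost (params a n k) + 1) + 27) +
        ((l + 1) * (58 * (params a n k).J + 62) + 5)) ≤ boundConst a * (l + 1) * lg n ^ 4 := by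
  show 5 * lg n + 4 * ((2 * a + 40) * lg n) + (90 * lg n + 1) * (3 * ((2 * a + 40) * lg n) + 1 +
    40 * lg n * ((2 * a + 40) * lg n + 1)) * (7 * ((2 * a + 40) * lg n) + 10) + 39 +
    ((90 * lg n + 1) * ((l + 1) * (30 * ((2 * a + 40) * lg n) + 40 * lg n *
      (10 * ((2 * a + 40) * lg n) + 12) + 63 + 1) + 27) +
        ((l + 1) * (58 * (90 * lg n) + 62) + 5)) ≤ 10 ^ 10 * (2 * a + 41) ^ 2 * (l + 1) * lg n ^ 4
  obtain ⟨B, hB⟩ : ∃ B, 2 * a + 41 = B + 1 := ⟨2 * a + 40, rfl⟩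
  have hB' : 2 * a + 40 = B := by lia
  rw [hB, hB']
  have hL : 1 ≤ l + 1 := by lia
  have hp : 1 ≤ lg n := lg_pos n
  generalize lg n = p at *
  set L := l + 1
  set b := B + 1
  have hb : 1 ≤ b := by lia
  have hBb : B ≤ b := by lia
  have hBp : B * p ≤ b * p := Nat.mul_le_mul_right p hBb
  have hbp : 1 ≤ b * p := Nat.mul_pos hb hp
  have hBp' : B * p + 1 ≤ b * p := by
    have : b * p = B * p + p := by ring
    lia
  have c1 : 3 * (B * p) + 1 ≤ 3 * (b * p) * p :=
    (by lia : 3 * (B * p) + 1 ≤ 3 * (b * p)).trans (Nat.le_mul_of_pos_right _ hp)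
  calc _ ≤ 5 * (b * p) + 4 * (b * p) + 91 * p * (3 * (b * p) * p + 40 * p * (b * p)) *
        (17 * (b * p)) + 39 * (b * p) +
        (91 * p * (L * (30 * (b * p) * p + 40 * p * (22 * (b * p)) + 64 * (b * p) * p) +
          27 * L * (b * p) * p) +
        (L * (120 * 90 * (b * p)) + 5 * (b * p))) := by
        have c2 : p ≤ b * p := Nat.le_mul_of_pos_left _ hb
        have c3 : b * p ≤ b * p * p := Nat.le_mul_of_pos_right _ hp
        have c4 : L ≤ L * (b * p * p) := Nat.le_mul_of_pos_right _ (by lia)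
        have c5 : 27 * L * (b * p) * p = 27 * (L * (b * p * p)) := by ring
        have c6 : 64 ≤ 64 * (b * p) * p := by lia
        have c7 : 30 * (B * p) ≤ 30 * (b * p) * p := by lia
        have c8 : L * (30 * (B * p) + 40 * p * (10 * (B * p) + 12) + 63 + 1) ≤
            L * (30 * (b * p) * p + 40 * p * (22 * (b * p)) + 64 * (b * p) * p) := by
          refine Nat.mul_le_mul_left L ?_
          have : 40 * p * (10 * (B * p) + 12) ≤ 40 * p * (22 * (b * p)) :=
            Nat.mul_le_mul_left _ (by lia)
          lia
        have c9 : 27 ≤ 27 * L * (b * p) * p := by rw [c5]; lia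
        refine Nat.add_le_add (Nat.add_le_add (Nat.add_le_add (by lia) ?_) (by lia))
          (Nat.add_le_add (Nat.mul_le_mul (by lia) (Nat.add_le_add c8 c9)) ?_)
        · exact Nat.mul_le_mul (Nat.mul_le_mul (by lia) (Nat.add_le_add c1
            (Nat.mul_le_mul_left _ hBp'))) (by lia)
        · exact Nat.add_le_add (Nat.mul_le_mul_left L (by lia)) (by lia)
    _ = 53 * (b * p) + 66521 * (b * p) ^ 2 * p ^ 2 + 91 * 1001 * (L * b * p ^ 3) +
        10800 * (L * b * p) := by ring
    _ ≤ 53 * (b ^ 2 * L * p ^ 4) + 66521 * (b ^ 2 * L * p ^ 4) + 91 * 1001 * (b ^ 2 * L * p ^ 4) +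
        10800 * (b ^ 2 * L * p ^ 4) := by
        have d1 : b ≤ b ^ 2 := Nat.le_self_pow (by lia) b
        have d2 : p ≤ p ^ 4 := Nat.le_self_pow (by lia) p
        have d3 : p ^ 3 ≤ p ^ 4 := Nat.pow_le_pow_right hp (by lia)
        have d4 : b * p ≤ b ^ 2 * L * p ^ 4 := by
          calc b * p = b * 1 * p := by ring
            _ ≤ _ := by gcongr
        have d5 : (b * p) ^ 2 * p ^ 2 ≤ b ^ 2 * L * p ^ 4 := by
          calc (b * p) ^ 2 * p ^ 2 = b ^ 2 * 1 * p ^ 4 := by ring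
            _ ≤ _ := by gcongr
        have d6 : L * b * p ^ 3 ≤ b ^ 2 * L * p ^ 4 := by
          rw [mul_comm L b]; gcongr
        have d7 : L * b * p ≤ b ^ 2 * L * p ^ 4 := by
          rw [mul_comm L b]; gcongr
        rw [Nat.mul_assoc 66521]
        gcongr
    _ = 168465 * (b ^ 2 * L * p ^ 4) := by ring
    _ ≤ 10 ^ 10 * (b ^ 2 * L * p ^ 4) := by gcongr; norm_num
    _ = _ := by ring

theorem decomposeProg_computes {a n k : ℕ} (hk : 1 ≤ k) (hkn : k ≤ n) {x : List ℕ}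
    (hx : IsInput a n x) (ρ : Fin ((params a n k).N * (params a n k).h) → Bool) :
    (decomposeProg a).Computes ((2 * a + 100) * lg n) (initState n k x ρ)
      (boundConst a * (x.length + 1) * lg n ^ 4) (coinGrammars a n k ρ x) := by
  have hπ := fits_params a n k
  have hxS : x.length + 1 < (params a n k).S := by
    have := hx.1
    show _ < n + 2
    lia
  refine ((setupProg_ends (π := params a n k) rfl hk hπ (splitDiv_le hkn) hx.1 ρ).seq
    (B' := _ + _) ?_).mono (decomposeProg_cost a n k x.length) fun _ h _ => h
  rintro s ⟨hR, h2, h43, h46, hmx, hout⟩ -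
  refine (levelsProg_ends hπ hR (symbol_add_one_lt_two_pow k hx) (length_add_one_lt_two_pow k hx)
    hxS le_rfl h2 h43 h46 hmx).seq ?_
  rintro s' ⟨hR', hL, h23, h29⟩ hF
  exact outputProg_ends hπ hR' (symbol_add_one_lt_two_pow k hx) hxS hL h23 h29
    ((hF.out rfl).trans hout)

/-! ### The probability that the decomposition is good -/

section Good

variable (π : Params) (T : ℕ → ZMod (2 ^ π.h)) (x : List ℕ)

/-- At all levels, the names that occur determine their rules. -/
def AllFresh : Prop := ∀ i ≤ π.J, FreshNames π.K π.θ T x i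

/-- The blocks are split so often that each of them has at most `D` names. -/
def AllFew (D : ℕ) : Prop := ∀ i < π.J, FewNames π.K π.θ D T x i

/-- Each block of the last level is a single node. -/
def AllSingle : Prop := ∀ b ∈ level π.K π.θ T x π.J, b.length = 1

variable {π T x}

theorem AllFresh.evaluateTo (h : AllFresh π T x) : EvaluateTo (wordGrammars π T x) x :=
  ⟨_, evaluateTo_map_nodeGrammar h, by rw [← List.flatMap_def]; exact expand_level _⟩

theorem AllFresh.sizeAtMost {D S : ℕ} (h : AllFresh π T x) (hD : AllFew π T x D)
    (hS : π.J * D + 2 ≤ S) : SizeAtMost S (wordGrammars π T x) := by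
  intro G hG
  obtain ⟨n, hn, rfl⟩ := List.mem_map.1 hG
  exact (card_nodeGrammar_le (fun i hi => h i hi.le) hD hn).trans hS

end Good

theorem size_le {a n k : ℕ} (hk : 1 ≤ k) :
    (params a n k).J * splitDiv k (params a n k).J (params a n k).K + 2 ≤
      boundConst a * k * lg n ^ 4 := by
  show 90 * lg n * (80 * k * (90 * lg n) * (90 * lg n + 1) * (40 * lg n)) + 2 ≤
    10 ^ 10 * (2 * a + 41) ^ 2 * k * lg n ^ 4
  have hq := lg_pos n
  calc 90 * lg n * (80 * k * (90 * lg n) * (90 * lg n + 1) * (40 * lg n)) + 2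
      ≤ 90 * lg n * (80 * k * (90 * lg n) * (91 * lg n) * (40 * lg n)) + 2 * (k * lg n ^ 4) := by
        have := Nat.mul_pos hk (Nat.pow_pos (n := 4) hq)
        gcongr <;> lia
    _ = 2358720002 * (1 ^ 2 * k * lg n ^ 4) := by ring
    _ ≤ 10 ^ 10 * ((2 * a + 41) ^ 2 * k * lg n ^ 4) := by gcongr <;> lia
    _ = _ := by ring

section Events

variable {a n k : ℕ} {x : List ℕ}

/-- With `Q = 2 ^ lg n`, every quantity of the analysis is bounded by a power of `Q`, so that the
estimates become comparisons of exponents. -/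
theorem scale_facts (hk : 1 ≤ k) (hkn : k ≤ n) : ∃ Q : ℝ, 2 ≤ Q ∧ (n : ℝ) + 2 ≤ Q ^ 2 ∧
    90 * (lg n : ℝ) + 1 ≤ Q ^ 8 ∧ 100 * (n : ℝ) ≤ Q ^ 9 ∧ Q = 2 ^ lg n ∧ (1 : ℝ) ≤ n := by
  have h1 := two_le_two_pow_lg n
  have h2 := add_two_le_two_pow_lg_sq n
  have h3 := const_mul_lg_add_one_le n
  have h4 : 100 * n ≤ (2 ^ lg n) ^ 9 := by
    calc 100 * n ≤ 2 ^ 7 * (2 ^ lg n) ^ 2 := by gcongr <;> lia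
      _ ≤ (2 ^ lg n) ^ 7 * (2 ^ lg n) ^ 2 := by gcongr
      _ = _ := by ring
  exact ⟨2 ^ lg n, by exact_mod_cast h1, by exact_mod_cast h2, by exact_mod_cast h3,
    by exact_mod_cast h4, rfl, by exact_mod_cast hk.trans hkn⟩

theorem prob_not_allFresh (hk : 1 ≤ k) (hkn : k ≤ n) (hx : IsInput a n x) :
    prob (fun ω : Fin (params a n k).N → ZMod (2 ^ (params a n k).h) =>
      ¬ AllFresh _ (padWords ω) x) ≤ 1 / (100 * n) := by
  obtain ⟨Q, hQ, hnQ, hqQ, hn, hQq, hn1⟩ := scale_facts hk hkn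
  have hM : (2 : ℝ) ^ (params a n k).h = Q ^ (2 * a + 40) := by
    rw [hQq]; exact_mod_cast two_pow_width a n k
  have hJ : ((params a n k).J : ℝ) + 1 ≤ Q ^ 8 := by
    refine le_trans (le_of_eq ?_) hqQ
    rw [show (params a n k).J = 90 * lg n from rfl]
    push_cast
    rfl
  have hxl : (x.length : ℝ) + 1 ≤ Q ^ 2 := by
    have : (x.length : ℝ) ≤ n := by exact_mod_cast hx.1
    linarith
  have hstep : ∀ i ∈ Finset.range (params a n k).J,
      prob (fun ω : Fin (params a n k).N → ZMod (2 ^ (params a n k).h) =>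
        ¬ FreshNames (params a n k).K (params a n k).θ (padWords ω) x (i + 1)) ≤
        Q ^ 8 * (Q ^ 2) ^ 2 / Q ^ (2 * a + 40) := fun i hi => by
    have hi' := Finset.mem_range.1 hi
    refine (prob_not_freshNames_succ (symbol_add_one_lt_two_pow k hx)
      (length_add_one_lt_two_pow k hx) ?_).trans ?_
    · refine le_trans ?_ (Nat.mul_le_mul_right (chunk (params a n k).h (params a n k).K)
        (by lia : i + 1 + 1 ≤ (params a n k).J + 1))
      rw [Nat.succ_mul (i + 1)]
      exact Nat.add_le_add_left (Nat.le_add_right _ _) _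
    · rw [hM]
      have : (i : ℝ) + 2 ≤ Q ^ 8 := by
        have : (i : ℝ) + 1 ≤ (params a n k).J := by exact_mod_cast hi'
        linarith
      gcongr
  refine (prob_mono fun ω hω => ?_).trans ((prob_exists_le _ _).trans
    ((Finset.sum_le_card_nsmul _ _ _ hstep).trans ?_))
  · simp only [AllFresh, not_forall] at hω
    obtain ⟨i, hi, hω⟩ := hω
    cases i with
    | zero => exact absurd freshNames_zero hω
    | succ i => exact ⟨i, Finset.mem_range.2 hi, hω⟩
  · rw [Finset.card_range, nsmul_eq_mul, le_div_iff₀ (by positivity)]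
    calc (params a n k).J * (Q ^ 8 * (Q ^ 2) ^ 2 / Q ^ (2 * a + 40)) * (100 * n)
        ≤ Q ^ 8 * (Q ^ 8 * (Q ^ 2) ^ 2 / Q ^ (2 * a + 40)) * Q ^ 9 := by
          gcongr
          linarith
      _ = Q ^ 29 / Q ^ (2 * a + 40) := by ring
      _ ≤ 1 := by
          rw [div_le_one (by positivity)]
          exact pow_le_pow_right₀ (by linarith) (by lia)

theorem prob_not_allFew (hk : 1 ≤ k) (hkn : k ≤ n) (hx : IsInput a n x) :
    prob (fun ω : Fin (params a n k).N → ZMod (2 ^ (params a n k).h) =>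
      ¬ AllFew _ (padWords ω) x (splitDiv k (params a n k).J (params a n k).K)) ≤
      1 / (100 * n) := by
  obtain ⟨Q, hQ, hnQ, hqQ, hn, hQq, hn1⟩ := scale_facts hk hkn
  have hJ : ((params a n k).J : ℝ) ≤ Q ^ 8 := by
    refine le_trans (le_of_eq ?_) ((lt_add_one _).le.trans hqQ)
    rw [show (params a n k).J = 90 * lg n from rfl]
    push_cast
    rfl
  have hxl : (x.length : ℝ) + 2 ≤ Q ^ 2 := by
    have : (x.length : ℝ) ≤ n := by exact_mod_cast hx.1
    linarith
  have hK : (5 / 8 : ℝ) ^ (params a n k).K ≤ 1 / Q ^ 26 := by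
    rw [show (params a n k).K = 40 * lg n from rfl, pow_mul, hQq, ← pow_mul (2 : ℝ),
      mul_comm (lg n), pow_mul (2 : ℝ), ← one_div_pow]
    exact pow_le_pow_left₀ (by norm_num) (by norm_num) _
  have hstep : ∀ i ∈ Finset.range (params a n k).J,
      prob (fun ω : Fin (params a n k).N → ZMod (2 ^ (params a n k).h) =>
        ¬ FewNames (params a n k).K (params a n k).θ
          (splitDiv k (params a n k).J (params a n k).K) (padWords ω) x i) ≤
        (Q ^ 2) ^ 2 * (1 / Q ^ 26) := fun i hi => by
    have hi' := Finset.mem_range.1 hi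
    refine (prob_not_fewNames (h := (params a n k).h) (K := (params a n k).K)
      (D := splitDiv k (params a n k).J (params a n k).K) (symbol_add_one_lt_two_pow k hx)
      (splitDiv_pos hk) (splitDiv_le hkn) (Nat.mul_le_mul_right _ ?_)).trans ?_
    · show i + 1 ≤ (params a n k).J + 1
      lia
    · exact mul_le_mul (by gcongr) hK (by positivity) (by positivity)
  refine (prob_mono fun ω hω => ?_).trans ((prob_exists_le _ _).trans
    ((Finset.sum_le_card_nsmul _ _ _ hstep).trans ?_))
  · simp only [AllFew, not_forall] at hω
    obtain ⟨i, hi, hω⟩ := hω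
    exact ⟨i, Finset.mem_range.2 hi, hω⟩
  · rw [Finset.card_range, nsmul_eq_mul, le_div_iff₀ (by positivity)]
    calc (params a n k).J * ((Q ^ 2) ^ 2 * (1 / Q ^ 26)) * (100 * n)
        ≤ Q ^ 8 * ((Q ^ 2) ^ 2 * (1 / Q ^ 26)) * Q ^ 9 := by gcongr
      _ = Q ^ 21 / Q ^ 26 := by ring
      _ ≤ 1 := by
          rw [div_le_one (by positivity)]
          exact pow_le_pow_right₀ (by linarith) (by lia)

theorem prob_not_allSingle (hk : 1 ≤ k) (hkn : k ≤ n) (hx : IsInput a n x) :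
    prob (fun ω : Fin (params a n k).N → ZMod (2 ^ (params a n k).h) =>
      ¬ AllSingle _ (padWords ω) x) ≤ 1 / (100 * n) := by
  obtain ⟨Q, hQ, hnQ, hqQ, hn, hQq, hn1⟩ := scale_facts hk hkn
  have hJ : (params a n k).J = 2 * (45 * lg n) := by
    rw [show (params a n k).J = 90 * lg n from rfl]; lia
  have hxl : (x.length : ℝ) ≤ Q ^ 2 := by
    have : (x.length : ℝ) ≤ n := by exact_mod_cast hx.1
    linarith
  have hi : (3 / 4 : ℝ) ^ (45 * lg n) ≤ 1 / Q ^ 18 := by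
    rw [pow_mul, hQq, ← pow_mul (2 : ℝ), mul_comm (lg n), pow_mul (2 : ℝ), ← one_div_pow]
    exact pow_le_pow_left₀ (by norm_num) (by norm_num) _
  have h := prob_exists_length_ne_one (h := (params a n k).h) (K := (params a n k).K)
    (θ := (params a n k).θ) (N := (params a n k).N)
    (Nat.mul_pos (by lia) (lg_pos n)) (symbol_add_one_lt_two_pow k hx)
    (length_add_one_lt_two_pow k hx) (45 * lg n) (by rw [← hJ]; rfl)
  rw [← hJ] at h
  refine h.trans ?_
  rw [le_div_iff₀ (by positivity)]
  calc (3 / 4 : ℝ) ^ (45 * lg n) * x.length * (100 * n) ≤ 1 / Q ^ 18 * Q ^ 2 * Q ^ 9 := by gcongr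
    _ = Q ^ 11 / Q ^ 18 := by ring
    _ ≤ 1 := by
      rw [div_le_one (by positivity)]
      exact pow_le_pow_right₀ (by linarith) (by lia)

theorem prob_not_apart {y : List ℕ} (hk : 1 ≤ k) (hxy : editDist x y ≤ k) :
    prob (fun ω : Fin (params a n k).N → ZMod (2 ^ (params a n k).h) =>
      ¬ ApartBy expand (editDist x y)
        (level (params a n k).K (params a n k).θ (padWords ω) x (params a n k).J)
        (level (params a n k).K (params a n k).θ (padWords ω) y (params a n k).J)) ≤ 1 / 20 := by
  refine (prob_not_apartBy (h := (params a n k).h) (K := (params a n k).K)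
    (D := splitDiv k (params a n k).J (params a n k).K) (editsIn_editDist x y) _ le_rfl).trans ?_
  have hq : (0 : ℝ) < lg n := by exact_mod_cast lg_pos n
  have hk' : (0 : ℝ) < k := by exact_mod_cast hk
  have hJ : ((params a n k).J : ℝ) = 90 * lg n := by
    rw [show (params a n k).J = 90 * lg n from rfl]; push_cast; rfl
  have hK : ((params a n k).K : ℝ) = 40 * lg n := by
    rw [show (params a n k).K = 40 * lg n from rfl]; push_cast; rfl
  rw [splitDiv]
  push_cast
  rw [hJ, hK]
  calc (editDist x y : ℝ) * (90 * lg n * (4 * (90 * lg n) + 4) *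
        (40 * lg n / (80 * k * (90 * lg n) * (90 * lg n + 1) * (40 * lg n))))
      ≤ k * (90 * lg n * (4 * (90 * lg n) + 4) *
        (40 * lg n / (80 * k * (90 * lg n) * (90 * lg n + 1) * (40 * lg n)))) := by
        gcongr
    _ = 1 / 20 := by field_simp; ring

end Events

theorem one_sub_le_coinProb {N h : ℕ} {E : (Fin N → ZMod (2 ^ h)) → Prop} {ε : ℝ}
    (hE : prob (fun ω => ¬ E ω) ≤ ε) : 1 - ε ≤ coinProb fun ρ => E (coinWords N h ρ) := by
  rw [coinProb_coinWords]
  rw [prob_not] at hE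
  linarith

theorem prob_or_le_add {Ω : Type*} [Fintype Ω] {E F : Ω → Prop} {ε δ : ℝ} (hE : prob E ≤ ε)
    (hF : prob F ≤ δ) : prob (fun ω => E ω ∨ F ω) ≤ ε + δ :=
  (prob_or_le E F).trans (add_le_add hE hF)

section Pair

variable {a n k : ℕ} {x y : List ℕ}

theorem one_sub_le_coinProb_good (hk : 1 ≤ k) (hkn : k ≤ n) (hx : IsInput a n x) :
    1 - (2 / (100 * n) : ℝ) ≤ coinProb fun ρ =>
      EvaluateTo (coinGrammars a n k ρ x) x ∧
      SizeAtMost (boundConst a * k * lg n ^ 4) (coinGrammars a n k ρ x) := by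
  refine one_sub_le_coinProb (E := fun ω => EvaluateTo (wordGrammars _ (padWords ω) x) x ∧
    SizeAtMost (boundConst a * k * lg n ^ 4) (wordGrammars (params a n k) (padWords ω) x)) ?_
  refine (prob_mono fun ω hω => ?_).trans ((prob_or_le_add (prob_not_allFresh hk hkn hx)
    (prob_not_allFew hk hkn hx)).trans_eq (by ring))
  by_contra! h
  exact hω ⟨h.1.evaluateTo, h.1.sizeAtMost h.2 (size_le hk)⟩

theorem four_fifths_le_coinProb (hk : 1 ≤ k) (hkn : k ≤ n) (hx : IsInput a n x)
    (hy : IsInput a n y) (hxy : editDist x y ≤ k) : (4 / 5 : ℝ) ≤ coinProb fun ρ =>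
      EvaluateTo (coinGrammars a n k ρ x) x ∧ EvaluateTo (coinGrammars a n k ρ y) y ∧
      SizeAtMost (boundConst a * k * lg n ^ 4) (coinGrammars a n k ρ x) ∧
      SizeAtMost (boundConst a * k * lg n ^ 4) (coinGrammars a n k ρ y) ∧
      Aligned k x y (coinGrammars a n k ρ x) (coinGrammars a n k ρ y) := by
  refine le_trans ?_ (one_sub_le_coinProb (ε := 6 / (100 * n) + 1 / 20) (E := fun ω =>
    EvaluateTo (wordGrammars _ (padWords ω) x) x ∧ EvaluateTo (wordGrammars _ (padWords ω) y) y ∧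
    SizeAtMost (boundConst a * k * lg n ^ 4) (wordGrammars (params a n k) (padWords ω) x) ∧
    SizeAtMost (boundConst a * k * lg n ^ 4) (wordGrammars (params a n k) (padWords ω) y) ∧
    Aligned k x y (wordGrammars _ (padWords ω) x) (wordGrammars _ (padWords ω) y)) ?_)
  · have hn1 : (1 : ℝ) ≤ n := by exact_mod_cast hk.trans hkn
    have : 6 / (100 * n : ℝ) ≤ 6 / 100 := by gcongr; linarith
    linarith
  · refine (prob_mono fun ω hω => ?_).trans ((prob_or_le_add (prob_or_le_add
      (prob_or_le_add (prob_not_allFresh hk hkn hx) (prob_not_allFresh hk hkn hy))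
      (prob_or_le_add (prob_or_le_add (prob_not_allFew hk hkn hx) (prob_not_allFew hk hkn hy))
        (prob_or_le_add (prob_not_allSingle hk hkn hx) (prob_not_allSingle hk hkn hy))))
      (prob_not_apart hk hxy)).trans_eq (by ring))
    by_contra! h
    obtain ⟨⟨⟨hfx, hfy⟩, ⟨hDx, hDy⟩, hsx, hsy⟩, hap⟩ := h
    exact hω ⟨hfx.evaluateTo, hfy.evaluateTo, hfx.sizeAtMost hDx (size_le hk),
      hfy.sizeAtMost hDy (size_le hk), aligned_of_apartBy hap hxy hsx hsy hfx hfy⟩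

theorem one_sub_le_coinProb_evaluateTo (hk : 1 ≤ k) (hkn : k ≤ n) (hx : IsInput a n x)
    (hy : IsInput a n y) : 1 - 2 / (n : ℝ) ≤ coinProb fun ρ =>
      EvaluateTo (coinGrammars a n k ρ x) x ∧ EvaluateTo (coinGrammars a n k ρ y) y := by
  refine le_trans ?_ (one_sub_le_coinProb (ε := 2 / (100 * n)) (E := fun ω =>
    EvaluateTo (wordGrammars (params a n k) (padWords ω) x) x ∧
    EvaluateTo (wordGrammars (params a n k) (padWords ω) y) y) ?_)
  · have hn1 : (1 : ℝ) ≤ n := by exact_mod_cast hk.trans hkn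
    have : 2 / (100 * n : ℝ) ≤ 2 / n := by gcongr; linarith
    linarith
  · refine (prob_mono fun ω hω => ?_).trans ((prob_or_le_add (prob_not_allFresh hk hkn hx)
      (prob_not_allFresh hk hkn hy)).trans_eq (by ring))
    by_contra! h
    exact hω ⟨h.1.evaluateTo, h.2.evaluateTo⟩

theorem one_sub_le_coinProb_sizeAtMost (hk : 1 ≤ k) (hkn : k ≤ n) (hx : IsInput a n x)
    (hy : IsInput a n y) : 1 - 2 / (n : ℝ) ≤ coinProb fun ρ =>
      SizeAtMost (boundConst a * k * lg n ^ 4) (coinGrammars a n k ρ x) ∧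
      SizeAtMost (boundConst a * k * lg n ^ 4) (coinGrammars a n k ρ y) := by
  refine le_trans ?_ (one_sub_le_coinProb (ε := 4 / (100 * n)) (E := fun ω =>
    SizeAtMost (boundConst a * k * lg n ^ 4) (wordGrammars (params a n k) (padWords ω) x) ∧
    SizeAtMost (boundConst a * k * lg n ^ 4) (wordGrammars (params a n k) (padWords ω) y)) ?_)
  · have hn1 : (1 : ℝ) ≤ n := by exact_mod_cast hk.trans hkn
    have : 4 / (100 * n : ℝ) ≤ 2 / n := by
      rw [div_le_div_iff₀ (by positivity) (by positivity)]
      linarith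
    linarith
  · refine (prob_mono fun ω hω => ?_).trans ((prob_or_le_add
      (prob_or_le_add (prob_not_allFresh hk hkn hx) (prob_not_allFresh hk hkn hy))
      (prob_or_le_add (prob_not_allFew hk hkn hx) (prob_not_allFew hk hkn hy))).trans_eq (by ring))
    by_contra! h
    obtain ⟨⟨hfx, hfy⟩, hDx, hDy⟩ := h
    exact hω ⟨hfx.sizeAtMost hDx (size_le hk), hfy.sizeAtMost hDy (size_le hk)⟩

theorem nine_tenths_le_coinProb_aligned (hk : 1 ≤ k) (hkn : k ≤ n) (hx : IsInput a n x)
    (hy : IsInput a n y) (hxy : editDist x y ≤ k) : (9 / 10 : ℝ) ≤ coinProb fun ρ =>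
      Aligned k x y (coinGrammars a n k ρ x) (coinGrammars a n k ρ y) := by
  refine le_trans ?_ (one_sub_le_coinProb (ε := 4 / (100 * n) + 1 / 20) (E := fun ω =>
    Aligned k x y (wordGrammars (params a n k) (padWords ω) x)
      (wordGrammars (params a n k) (padWords ω) y)) ?_)
  · have hn1 : (1 : ℝ) ≤ n := by exact_mod_cast hk.trans hkn
    have : 4 / (100 * n : ℝ) ≤ 4 / 100 := by gcongr; linarith
    linarith
  · refine (prob_mono fun ω hω => ?_).trans ((prob_or_le_add (prob_or_le_add
      (prob_or_le_add (prob_not_allFresh hk hkn hx) (prob_not_allFresh hk hkn hy))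
      (prob_or_le_add (prob_not_allSingle hk hkn hx) (prob_not_allSingle hk hkn hy)))
      (prob_not_apart hk hxy)).trans_eq (by ring))
    by_contra! h
    obtain ⟨⟨⟨hfx, hfy⟩, hsx, hsy⟩, hap⟩ := h
    exact hω (aligned_of_apartBy hap hxy hsx hsy hfx hfy)

end Pair

theorem theorem1 (a : ℕ) :
    ∃ (P : Prog) (b C c n₀ : ℕ) (m : ℕ → ℕ → ℕ)
      (G : (n k : ℕ) → (Fin (m n k) → Bool) → List ℕ → List Grammar),
      ∀ n k : ℕ, 1 ≤ k → k ≤ n →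
        -- the algorithm: its running time, for every outcome of the coins
        (∀ x, IsInput a n x → ∀ ρ : Fin (m n k) → Bool,
          P.Computes (b * lg n) (initState n k x ρ) (C * (x.length + 1) * lg n ^ c)
            (G n k ρ x)) ∧
        -- a single string
        (∀ x, IsInput a n x →
          1 - (C : ℝ) / n ≤ coinProb fun ρ =>
            EvaluateTo (G n k ρ x) x ∧ SizeAtMost (C * k * lg n ^ c) (G n k ρ x)) ∧
        -- two strings, decomposed with the same coins
        (∀ x y, IsInput a n x → IsInput a n y → editDist x y ≤ k →
          (4 / 5 : ℝ) ≤ (coinProb fun ρ =>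
            EvaluateTo (G n k ρ x) x ∧ EvaluateTo (G n k ρ y) y ∧
            SizeAtMost (C * k * lg n ^ c) (G n k ρ x) ∧
            SizeAtMost (C * k * lg n ^ c) (G n k ρ y) ∧
            Aligned k x y (G n k ρ x) (G n k ρ y)) ∧
          (n₀ ≤ n →
            1 - 2 / (n : ℝ) ≤ (coinProb fun ρ =>
              EvaluateTo (G n k ρ x) x ∧ EvaluateTo (G n k ρ y) y) ∧
            1 - 2 / (n : ℝ) ≤ (coinProb fun ρ =>
              SizeAtMost (C * k * lg n ^ c) (G n k ρ x) ∧
              SizeAtMost (C * k * lg n ^ c) (G n k ρ y)) ∧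
            (9 / 10 : ℝ) ≤ coinProb fun ρ =>
              Aligned k x y (G n k ρ x) (G n k ρ y))) := by
  refine ⟨decomposeProg a, 2 * a + 100, boundConst a, 4, 0,
    fun n k => (params a n k).N * (params a n k).h, coinGrammars a, fun n k hk hkn =>
    ⟨fun x hx ρ => decomposeProg_computes hk hkn hx ρ, fun x hx => ?_, fun x y hx hy hxy =>
      ⟨four_fifths_le_coinProb hk hkn hx hy hxy, fun _ =>
        ⟨one_sub_le_coinProb_evaluateTo hk hkn hx hy, one_sub_le_coinProb_sizeAtMost hk hkn hx hy,
          nine_tenths_le_coinProb_aligned hk hkn hx hy hxy⟩⟩⟩⟩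
  refine le_trans ?_ (one_sub_le_coinProb_good hk hkn hx)
  have hn1 : (1 : ℝ) ≤ n := by exact_mod_cast hk.trans hkn
  have hC : (2 : ℝ) ≤ boundConst a := by
    have : 10 ^ 10 * 1 ≤ boundConst a := Nat.mul_le_mul_left _ (Nat.one_le_pow _ _ (by lia))
    exact_mod_cast (by norm_num : 2 ≤ 10 ^ 10 * 1).trans this
  have : 2 / (100 * n : ℝ) ≤ boundConst a / n := by gcongr; linarith
  linarith
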